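/- \textbf{Setting.} Let $\beta,\gamma,U,V$ be functions of $(u,r,\theta)$, smooth for $u\in\mathbb R$, $r>r_0\ge 0$, $0\le\theta\le\pi$, such that the axi-symmetric Bondi metric $$\tilde g=\Big(\tfrac Vr e^{2\beta}+r^2e^{2\gamma}U^2\Big)du^2-2e^{2\beta}du\,dr-2r^2e^{2\gamma}U\,du\,d\theta+r^2\big(e^{2\gamma}d\theta^2+e^{-2\gamma}\sin^2\theta\,d\psi^2\big)$$ satisfies the vacuum Einstein equations $\mathrm{Ric}(\tilde g)=0$. Write $f_{,0}=\partial_uf$, $f_{,2}=\partial_\theta f$. Assume the outgoing radiation condition: there are functions of $(u,\theta)$, smooth on $\mathbb R\times[0,\pi]$, among them $c$ and the mass aspect $M$, such that, as $r\to\infty$, $$\gamma=\frac cr+\frac{\gamma_3}{r^3}+O(r^{-4}),\quad \beta=\frac{\beta_2}{r^2}+O(r^{-4}),\quad U=\frac{U_2}{r^2}+\frac{U_3}{r^3}+O(r^{-4}),\quad V=-r+2M+\frac{V_1}{r}+O(r^{-2}),$$ where the error terms are uniform in $\theta\in(0,\pi)$ and in $u\le u_1$ for every $u_1$, and may be differentiated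 up to twice in $(u,r,\theta)$, each $\partial_r$ gaining a factor $r^{-1}$. Let $\breve e_1=\partial_r$ (at fixed $t=u+r$), $\breve e_2=r^{-1}\partial_\theta$, $\breve e_3=(r\sin\theta)^{-1}\partial_\psi$, and let $\mathcal C_{\{a_1,a_2,a_3\}}$ be the class of functions $f$ for which $r^{a_1}f$, $r^{a_2}\breve e_if$ and $r^{a_3}\breve e_i\breve e_jf$ (all $i,j$) stay bounded, uniformly on the sphere, in the iterated limit $\lim_{r\to\infty}\lim_{u\to-\infty}$. Assume (A) $\beta,\gamma,U,V$ and their derivatives up to second order agree at $\psi=0$ and $\psi=2\pi$ (automatic here); (B) $\int_0^{2\pi}c(u,0)\,d\psi=\int_0^{2\pi}c(u,\pi)\,d\psi=0$ for all $u$; (D) $\gamma\in\mathcal C_{\{1,1,1\}}$, $\beta,U\in\mathcal C_{\{2,2,2\}}$, $V+r\in\mathcal C_{\{0,0,0\}}$. Let $m_\nu(u)=\frac1{4\pi}\int_{S^2}M(u,\theta)\,n^\nu\,dS$ with $n=(1,\sin\theta\cos\psi,\sin\theta\sin\psi,\cos\theta)$ be the Bondi energy-momentum. Let $g$ be the induced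 metric of the slice $N_{t_0}=\{u+r=t_0\}$, $\mathcal N=(-\tilde g^{tt})^{-1/2}$ its lapse, $X_i=\tilde g_{ti}$ its shift (in the coordinates $(t,r,\theta,\psi)$), and $h_{ij}=\frac1{2\mathcal N}(\nabla_iX_j+\nabla_jX_i-\partial_t\tilde g_{ij})$ its second fundamental form. Let $g_0$ be the flat metric in the polar coordinates $(r,\theta,\psi)$, with connection $\breve\nabla$, and $y^k$ the associated Cartesian coordinates. Its ADM energy and momentum are $$\mathbb E(t_0)=\frac1{16\pi}\lim_{r\to\infty}\int_{S_r}\big[\breve\nabla^jg(\breve e_1,\breve e_j)-\breve\nabla_1\mathrm{tr}_{g_0}g\big]r^2\sin\theta\,d\theta\,d\psi,$$ $$\mathbb P_k(t_0)=\frac1{8\pi}\lim_{r\to\infty}\int_{S_r}\big[h(\partial_{y^k},\partial_r)-g(\partial_{y^k},\partial_r)\,\mathrm{tr}_gh\big]r^2\sin\theta\,d\theta\,d\psi.$$ \textbf{Statement.} For every $t_0$, the limits $m_\nu(-\infty)=\lim_{u\to-\infty}m_\nu(u)$ and all other limits below exist, the integrands of $\mathbb E$ and $\mathbb P_k$ are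 integrable over $S_r$ for all large $r$, and $$\mathbb E(t_0)=m_0(-\infty)+\lim_{u\to-\infty}\int_0^\pi c\,c_{,0}\sin\theta\,d\theta,\qquad \mathbb P_1(t_0)=m_1(-\infty),\qquad \mathbb P_2(t_0)=m_2(-\infty),$$ $$\mathbb P_3(t_0)=m_3(-\infty)-\frac14\lim_{u\to-\infty}\int_0^\pi\Big[-(c_{,0})^2+\frac{c_{,220}}2+\kappa\,c_{,20}\cot\theta\Big]\big(c_{,2}+2c\cot\theta\big)\sin^2\theta\,d\theta,$$ both for $\kappa=1$ and for $\kappa=\tfrac32$; the two limits are equal. -/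

import Mathlib

open Real Set Filter Topology MeasureTheory
open scoped ContDiff

noncomputable section

namespace AxiBondi

/-! ### Tensor calculus in coordinates -/

section Coordinates

/-- Partial derivative `∂_i f` of a function of `n` coordinates. -/
def pd {n : ℕ} (i : Fin n) (f : (Fin n → ℝ) → ℝ) (x : Fin n → ℝ) : ℝ :=
  deriv (fun s => f (Function.update x i s)) (x i)

/-- Christoffel symbol `Γ^k_{ij}` of the metric `g`. -/
def christoffel {n : ℕ} (g : (Fin n → ℝ) → Matrix (Fin n) (Fin n) ℝ) (k i j : Fin n)
    (x : Fin n → ℝ) : ℝ :=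
  (1 / 2) * ∑ l, (g x)⁻¹ k l *
    (pd i (fun y => g y j l) x + pd j (fun y => g y i l) x - pd l (fun y => g y i j) x)

/-- Ricci tensor `R_{ij} = ∂_k Γ^k_{ij} - ∂_j Γ^k_{ik} + Γ^k_{kl} Γ^l_{ij} - Γ^k_{jl} Γ^l_{ik}`. -/
def ricci {n : ℕ} (g : (Fin n → ℝ) → Matrix (Fin n) (Fin n) ℝ) (i j : Fin n)
    (x : Fin n → ℝ) : ℝ :=
  (∑ k, (pd k (christoffel g k i j) x - pd j (christoffel g k i k) x)) +
    ∑ k, ∑ l, (christoffel g k k l x * christoffel g l i j x -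
      christoffel g k j l x * christoffel g l i k x)

/-- `∇_i X_j` for a covector field `X`. -/
def covDCovector {n : ℕ} (g : (Fin n → ℝ) → Matrix (Fin n) (Fin n) ℝ)
    (X : Fin n → (Fin n → ℝ) → ℝ) (i j : Fin n) (x : Fin n → ℝ) : ℝ :=
  pd i (X j) x - ∑ k, christoffel g k i j x * X k x

/-- `(∇_k T)_{ij}` for a covariant 2-tensor field `T`. -/
def covDTensor {n : ℕ} (g T : (Fin n → ℝ) → Matrix (Fin n) (Fin n) ℝ) (k i j : Fin n)
    (x : Fin n → ℝ) : ℝ :=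
  pd k (fun y => T y i j) x - (∑ l, christoffel g l k i x * T x l j)
    - ∑ l, christoffel g l k j x * T x i l

end Coordinates

/-! ### Axi-symmetric Bondi metrics -/

/-- The four functions of `(u, r, θ)` which enter the axi-symmetric Bondi metric. -/
structure BondiData where
  β : ℝ → ℝ → ℝ → ℝ
  γ : ℝ → ℝ → ℝ → ℝ
  U : ℝ → ℝ → ℝ → ℝ
  V : ℝ → ℝ → ℝ → ℝ

/-- A function of `(u, r, θ)` as a `ψ`-independent function of `(u, r, θ, ψ)`. -/
def lift (f : ℝ → ℝ → ℝ → ℝ) (x : Fin 4 → ℝ) : ℝ := f (x 0) (x 1) (x 2)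

/-- The metric
`(V/r e^{2β} + r² e^{2γ} U²) du² - 2 e^{2β} du dr - 2 r² e^{2γ} U du dθ
  + r² (e^{2γ} dθ² + e^{-2γ} sin² θ dψ²)` in the coordinates `x = (u, r, θ, ψ)`. -/
def bondiMetric (S : BondiData) (x : Fin 4 → ℝ) : Matrix (Fin 4) (Fin 4) ℝ :=
  let r := x 1
  let θ := x 2
  let β := lift S.β x
  let γ := lift S.γ x
  let U := lift S.U x
  let V := lift S.V x
  !![V / r * exp (2 * β) + r ^ 2 * exp (2 * γ) * U ^ 2, -exp (2 * β),
        -(r ^ 2 * exp (2 * γ) * U), 0;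
     -exp (2 * β), 0, 0, 0;
     -(r ^ 2 * exp (2 * γ) * U), 0, r ^ 2 * exp (2 * γ), 0;
     0, 0, 0, r ^ 2 * exp (-2 * γ) * sin θ ^ 2]

/-- Smoothness for `r > r₀`, up to the poles `θ = 0, π`. -/
def SmoothOutside (r₀ : ℝ) (f : ℝ → ℝ → ℝ → ℝ) : Prop :=
  ContDiffOn ℝ ∞ (fun p : ℝ × ℝ × ℝ => f p.1 p.2.1 p.2.2)
    {p | r₀ < p.2.1 ∧ p.2.2 ∈ Icc 0 π}

/-- Smoothness of a function of `(u, θ)`, up to the poles. -/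
def SmoothCoeff (f : ℝ → ℝ → ℝ) : Prop :=
  ContDiffOn ℝ ∞ (fun p : ℝ × ℝ => f p.1 p.2) {p | p.2 ∈ Icc 0 π}

def BondiData.Smooth (S : BondiData) (r₀ : ℝ) : Prop :=
  SmoothOutside r₀ S.β ∧ SmoothOutside r₀ S.γ ∧ SmoothOutside r₀ S.U ∧ SmoothOutside r₀ S.V

/-- The vacuum Einstein equations in `r > r₀`. -/
def BondiData.IsVacuum (S : BondiData) (r₀ : ℝ) : Prop :=
  ∀ x : Fin 4 → ℝ, r₀ < x 1 → x 2 ∈ Ioo 0 π → ∀ i j, ricci (bondiMetric S) i j x = 0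

/-- `f = O(r⁻ᵏ)` as `r → ∞`, uniformly in `θ` and in `u ≤ u₁` for every `u₁`; the estimate may be
differentiated twice, each `∂_r` gaining one power of `r`. -/
def IsRemainder (k : ℕ) (f : ℝ → ℝ → ℝ → ℝ) : Prop :=
  ∀ u₁ : ℝ, ∃ K R : ℝ, ∀ u ≤ u₁, ∀ r ≥ R, ∀ θ ∈ Ioo 0 π, ∀ i j l : ℕ, i + j + l ≤ 2 →
    r ^ (k + j) * |iteratedDeriv i (fun u' => iteratedDeriv j (fun r' =>
      iteratedDeriv l (fun θ' => f u' r' θ') θ) r) u| ≤ K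

/-- Outgoing radiation condition: for large `r` the metric functions have expansions in `1/r` of
the form below, without a `1/r²` term in `γ`, where `c` is the radiation field and `M` the mass
aspect. The coefficients are smooth functions of `(u, θ)`; the relations among them are not part of
the condition. -/
def BondiData.OutgoingRadiation (S : BondiData) (c M : ℝ → ℝ → ℝ) : Prop :=
  SmoothCoeff c ∧ SmoothCoeff M ∧ ∃ γ₃ β₂ U₂ U₃ V₁ : ℝ → ℝ → ℝ,
    SmoothCoeff γ₃ ∧ SmoothCoeff β₂ ∧ SmoothCoeff U₂ ∧ SmoothCoeff U₃ ∧ SmoothCoeff V₁ ∧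
    IsRemainder 4 (fun u r θ => S.γ u r θ - (c u θ / r + γ₃ u θ / r ^ 3)) ∧
    IsRemainder 4 (fun u r θ => S.β u r θ - β₂ u θ / r ^ 2) ∧
    IsRemainder 4 (fun u r θ => S.U u r θ - (U₂ u θ / r ^ 2 + U₃ u θ / r ^ 3)) ∧
    IsRemainder 2 (fun u r θ => S.V u r θ - (-r + 2 * M u θ + V₁ u θ / r))

/-! ### Conditions A, B and D -/

/-- Equality at `ψ = 0` and `ψ = 2π` of a function and its derivatives up to second order. -/
def PeriodicToSecondOrder (f : (Fin 4 → ℝ) → ℝ) : Prop :=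
  ∀ x : Fin 4 → ℝ,
    f (Function.update x 3 0) = f (Function.update x 3 (2 * π)) ∧
    (∀ i, pd i f (Function.update x 3 0) = pd i f (Function.update x 3 (2 * π))) ∧
    ∀ i j, pd i (pd j f) (Function.update x 3 0) = pd i (pd j f) (Function.update x 3 (2 * π))

def BondiData.ConditionA (S : BondiData) : Prop :=
  PeriodicToSecondOrder (lift S.β) ∧ PeriodicToSecondOrder (lift S.γ) ∧
    PeriodicToSecondOrder (lift S.U) ∧ PeriodicToSecondOrder (lift S.V)

def ConditionB (c : ℝ → ℝ → ℝ) : Prop :=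
  ∀ u : ℝ, (∫ _ψ in (0 : ℝ)..2 * π, c u 0) = 0 ∧ (∫ _ψ in (0 : ℝ)..2 * π, c u π) = 0

/-- The flat orthonormal frame `∂_r, r⁻¹ ∂_θ, (r sin θ)⁻¹ ∂_ψ` of the slices `t = u + r = const`,
acting on functions of `(u, r, θ, ψ)`. The radial field is taken at fixed `t`, so it is
`∂_r - ∂_u` in these coordinates. -/
def frame (i : Fin 3) (f : (Fin 4 → ℝ) → ℝ) (x : Fin 4 → ℝ) : ℝ :=
  ![pd 1 f x - pd 0 f x, pd 2 f x / x 1, pd 3 f x / (x 1 * sin (x 2))] i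

/-- `lim_{r → ∞} lim_{u → -∞} r^a f = O(1)`: in the iterated limit `r^a f` stays bounded,
uniformly on the sphere. -/
def BoundedAtSpatialInfinity (a : ℕ) (f : (Fin 4 → ℝ) → ℝ) : Prop :=
  ∃ K : ℝ, ∀ᶠ r in atTop, ∀ᶠ u in atBot, ∀ θ ∈ Ioo 0 π, ∀ ψ : ℝ,
    |r ^ a * f ![u, r, θ, ψ]| ≤ K

/-- The decay class `𝒞_{a₁, a₂, a₃}`. -/
def DecayClass (a₁ a₂ a₃ : ℕ) (f : (Fin 4 → ℝ) → ℝ) : Prop :=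
  BoundedAtSpatialInfinity a₁ f ∧ (∀ i, BoundedAtSpatialInfinity a₂ (frame i f)) ∧
    ∀ i j, BoundedAtSpatialInfinity a₃ (frame i (frame j f))

def BondiData.ConditionD (S : BondiData) : Prop :=
  DecayClass 1 1 1 (lift S.γ) ∧ DecayClass 2 2 2 (lift S.β) ∧ DecayClass 2 2 2 (lift S.U) ∧
    DecayClass 0 0 0 (lift fun u r θ => S.V u r θ + r)

/-! ### Bondi energy-momentum -/

/-- `(n⁰, n¹, n², n³) = (1, sin θ cos ψ, sin θ sin ψ, cos θ)`. -/
def nvec (ν : Fin 4) (θ ψ : ℝ) : ℝ :=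
  ![1, sin θ * cos ψ, sin θ * sin ψ, cos θ] ν

/-- `m_ν(u) = (4π)⁻¹ ∫_{S²} M(u, ·) n^ν dS`. -/
def bondiMomentum (M : ℝ → ℝ → ℝ) (ν : Fin 4) (u : ℝ) : ℝ :=
  1 / (4 * π) * ∫ p in Ioo 0 π ×ˢ Ioo 0 (2 * π), M u p.1 * nvec ν p.1 p.2 * sin p.1

/-! ### The slices `t = u + r = const` and their ADM quantities -/

/-- The spacetime metric in the coordinates `(t, r, θ, ψ)`, `u = t - r`. -/
def tMetric (S : BondiData) (x : Fin 4 → ℝ) : Matrix (Fin 4) (Fin 4) ℝ :=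
  let J : Matrix (Fin 4) (Fin 4) ℝ := !![1, -1, 0, 0; 0, 1, 0, 0; 0, 0, 1, 0; 0, 0, 0, 1]
  J.transpose * bondiMetric S ![x 0 - x 1, x 1, x 2, x 3] * J

/-- Induced metric on the slice, in the coordinates `y = (r, θ, ψ)`. -/
def inducedMetric (S : BondiData) (t : ℝ) (y : Fin 3 → ℝ) : Matrix (Fin 3) (Fin 3) ℝ :=
  (tMetric S (Matrix.vecCons t y)).submatrix Fin.succ Fin.succ

/-- Lapse `(-g̃^{tt})^{-1/2}`. -/
def lapse (S : BondiData) (t : ℝ) (y : Fin 3 → ℝ) : ℝ :=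
  (√(-((tMetric S (Matrix.vecCons t y))⁻¹ 0 0)))⁻¹

/-- Shift covector `X_i = g̃_{ti}`. -/
def shift (S : BondiData) (t : ℝ) (i : Fin 3) (y : Fin 3 → ℝ) : ℝ :=
  tMetric S (Matrix.vecCons t y) 0 i.succ

/-- Second fundamental form `h_{ij} = (∇_i X_j + ∇_j X_i - ∂_t g̃_{ij}) / (2 𝒩)`. -/
def secondFundamentalForm (S : BondiData) (t : ℝ) (i j : Fin 3) (y : Fin 3 → ℝ) : ℝ :=
  1 / (2 * lapse S t y) *
    (covDCovector (inducedMetric S t) (shift S t) i j y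
      + covDCovector (inducedMetric S t) (shift S t) j i y
      - deriv (fun s => inducedMetric S s y i j) t)

/-- The flat metric `dr² + r² dθ² + r² sin² θ dψ²`. -/
def flatMetric (y : Fin 3 → ℝ) : Matrix (Fin 3) (Fin 3) ℝ :=
  Matrix.diagonal ![1, y 0 ^ 2, y 0 ^ 2 * sin (y 1) ^ 2]

/-- Components in `(∂_r, ∂_θ, ∂_ψ)` of the Cartesian field `∂/∂y^k`, where
`y¹ = r sin θ cos ψ`, `y² = r sin θ sin ψ`, `y³ = r cos θ`. -/
def cartesianField (k i : Fin 3) (y : Fin 3 → ℝ) : ℝ :=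
  let r := y 0
  let θ := y 1
  let ψ := y 2
  (!![sin θ * cos ψ, cos θ * cos ψ / r, -sin ψ / (r * sin θ);
      sin θ * sin ψ, cos θ * sin ψ / r, cos ψ / (r * sin θ);
      cos θ, -sin θ / r, 0] : Matrix (Fin 3) (Fin 3) ℝ) k i

/-- `∇̆^j g(e₁, e_j) - ∇̆₁ tr_{g₀} g`, with `e₁ = ∂_r` and `∇̆` the flat connection. -/
def energyIntegrand (S : BondiData) (t : ℝ) (y : Fin 3 → ℝ) : ℝ :=
  (∑ j, ∑ k, (flatMetric y)⁻¹ j k * covDTensor flatMetric (inducedMetric S t) j 0 k y)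
    - pd 0 (fun z => ∑ j, ∑ k, (flatMetric z)⁻¹ j k * inducedMetric S t z j k) y

/-- `h(∂/∂y^k, ∂/∂r) - g(∂/∂y^k, ∂/∂r) tr_g h`. -/
def momentumIntegrand (S : BondiData) (t : ℝ) (k : Fin 3) (y : Fin 3 → ℝ) : ℝ :=
  (∑ i, cartesianField k i y * secondFundamentalForm S t i 0 y)
    - (∑ i, cartesianField k i y * inducedMetric S t y i 0) *
      ∑ i, ∑ j, (inducedMetric S t y)⁻¹ i j * secondFundamentalForm S t i j y

/-- `∫_{S_r} F` tends to `L` as `r → ∞`, where the area form is `r² sin θ dθ dψ` and `F` is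
integrable over `S_r` for all large `r`. -/
def SphereIntegralTendsto (F : (Fin 3 → ℝ) → ℝ) (L : ℝ) : Prop :=
  (∀ᶠ r : ℝ in atTop, IntegrableOn (fun p : ℝ × ℝ => F ![r, p.1, p.2] * (r ^ 2 * sin p.1))
    (Ioo 0 π ×ˢ Ioo 0 (2 * π))) ∧
  Tendsto (fun r : ℝ => ∫ p in Ioo 0 π ×ˢ Ioo 0 (2 * π),
    F ![r, p.1, p.2] * (r ^ 2 * sin p.1)) atTop (𝓝 L)

/-- The ADM total energy of the slice `t = t₀` exists and equals `E`. -/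
def HasADMEnergy (S : BondiData) (t₀ E : ℝ) : Prop :=
  SphereIntegralTendsto (fun y => 1 / (16 * π) * energyIntegrand S t₀ y) E

/-- The `k`-th ADM total linear momentum of the slice `t = t₀` exists and equals `P`
(`k = 0, 1, 2` for the directions `y¹, y², y³`). -/
def HasADMMomentum (S : BondiData) (t₀ : ℝ) (k : Fin 3) (P : ℝ) : Prop :=
  SphereIntegralTendsto (fun y => 1 / (8 * π) * momentumIntegrand S t₀ k y) P

/-! ### Derivatives of functions of `(u, θ)` -/

/-- `f_{,0} = ∂f/∂u`. -/
def d0 (f : ℝ → ℝ → ℝ) (u θ : ℝ) : ℝ := deriv (fun s => f s θ) u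

/-- `f_{,2} = ∂f/∂θ`. -/
def d2 (f : ℝ → ℝ → ℝ) (u θ : ℝ) : ℝ := deriv (fun s => f u s) θ

/-- `∫₀^π [-(c_{,0})² + c_{,220}/2 + κ c_{,20} cot θ] (c_{,2} + 2 c cot θ) sin² θ dθ`. -/
def momentumCorrection (c : ℝ → ℝ → ℝ) (κ u : ℝ) : ℝ :=
  ∫ θ in (0 : ℝ)..π,
    (-(d0 c u θ) ^ 2 + d0 (d2 (d2 c)) u θ / 2 + κ * (d0 (d2 c) u θ * cot θ)) *
      (d2 c u θ + 2 * c u θ * cot θ) * sin θ ^ 2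

end AxiBondi

end

/-!
The vacuum equations enter only through two components at order `r⁻²`. The component `R_{rθ}` gives
`U₂ = -(∂_θ c + 2 c cot θ)` (`vacuum_rθ`), and `R_{uu}` gives the loss of mass by radiation: with
`m = 2 M`, the function `m + ∂_θ U₂ + U₂ cot θ` has `u`-derivative `-2 (∂_u c)²` (`vacuum_uu`).

The decay conditions concern the metric functions at large `r` and `u → -∞`; comparing two radii
turns them into bounds on `c`, `U₂`, `m` and their derivatives up to second order, and the
expansions then hold uniformly as `u → -∞` (`leadingTerm_of_decay`). Hence
`m + ∂_θ U₂ + U₂ cot θ` is bounded and monotone in `u`, so it converges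
(`ScriData.exists_mass_limit`). Its derivative is, up to a factor, the square of the news function
`∂_u c`, which varies slowly because `∂_u² c` is bounded, so `∂_u c → 0`
(`ScriData.tendsto_d0_c`). Interpolating between bounds on second derivatives and this decay,
`∂_u ∂_θ c`, `∂_u U₂`, `∂_u ∂_θ U₂` and `∂_u m` tend to zero as well, pointwise in `θ`.

By bounded convergence the Bondi energy-momentum has a limit: the total divergence
`∂_θ U₂ + U₂ cot θ` and its first moment integrate to zero, the latter because `U₂ sin² θ` is again
a total derivative. By the same theorem both correction terms tend to zero, for every `κ`
(`ScriData.tendsto_integral_c_d0_c`, `ScriData.tendsto_momentumCorrection`); in particular the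
limits for `κ = 1` and `κ = 3 / 2` agree.

On the slice `u = t - r` letting `r → ∞` sends `u` to `-∞`. With the inverse of the induced metric,
the lapse and the shift vector in closed form, the ADM integrands become explicit functions of the
metric functions and their first derivatives (`energyIntegrand_eq`, `momentumIntegrand_eq`), in
which every `u`-derivative of a leading coefficient drops out in the limit. Times `r²`, what remains
is `2 m + ∂_θ U₂ + U₂ cot θ` for the energy, `2 m + ∂_θ U₂ + U₂ cot θ` for the radial momentum and
`U₂ - ∂_θ m / 2` for the momentum in the unit direction `r⁻¹ ∂_θ`. Integration by parts over
the sphere leaves the integrals of `m` and `m cos θ` (`ScriData.integral_energy`,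
`ScriData.integral_momentum`), which are the limits of the Bondi energy-momentum; the momentum
orthogonal to the axis vanishes by axial symmetry.
-/

namespace AxiBondi

/-! ### Partial derivatives of functions of `(u, r, θ)` -/

section

/-- The partial derivatives `∂_u, ∂_r, ∂_θ` of a function of `(u, r, θ)`. -/
noncomputable def par : Fin 3 → (ℝ → ℝ → ℝ → ℝ) → ℝ → ℝ → ℝ → ℝ
  | 0, f => fun u r θ => deriv (fun s => f s r θ) u
  | 1, f => fun u r θ => deriv (fun s => f u s θ) r
  | 2, f => fun u r θ => deriv (fun s => f u r s) θ

/-- The open region `r > r₀`, `0 < θ < π`. -/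
def region (r₀ : ℝ) : Set (ℝ × ℝ × ℝ) := {p | r₀ < p.2.1 ∧ p.2.2 ∈ Ioo 0 π}

/-- Smoothness in `r > r₀` away from the poles. -/
def Smth (r₀ : ℝ) (f : ℝ → ℝ → ℝ → ℝ) : Prop :=
  ContDiffOn ℝ ∞ (fun p : ℝ × ℝ × ℝ => f p.1 p.2.1 p.2.2) (region r₀)

theorem isOpen_region (r₀ : ℝ) : IsOpen (region r₀) :=
  (isOpen_lt continuous_const (continuous_fst.comp continuous_snd)).inter
    (isOpen_Ioo.preimage (continuous_snd.comp continuous_snd))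

/-- The coordinate directions of `(u, r, θ)`. -/
def dir : Fin 3 → ℝ × ℝ × ℝ := ![(1, 0, 0), (0, 1, 0), (0, 0, 1)]

variable {r₀ u r θ : ℝ} {f g : ℝ → ℝ → ℝ → ℝ}

theorem Smth.contDiffAt (hf : Smth r₀ f) (hr : r₀ < r) (hθ : θ ∈ Ioo 0 π) :
    ContDiffAt ℝ ∞ (fun p : ℝ × ℝ × ℝ => f p.1 p.2.1 p.2.2) (u, r, θ) :=
  ContDiffOn.contDiffAt hf ((isOpen_region r₀).mem_nhds ⟨hr, hθ⟩)

theorem Smth.hasFDerivAt (hf : Smth r₀ f) (hr : r₀ < r) (hθ : θ ∈ Ioo 0 π) :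
    HasFDerivAt (fun p : ℝ × ℝ × ℝ => f p.1 p.2.1 p.2.2)
      (fderiv ℝ (fun p : ℝ × ℝ × ℝ => f p.1 p.2.1 p.2.2) (u, r, θ)) (u, r, θ) :=
  ((hf.contDiffAt hr hθ).differentiableAt (by simp)).hasFDerivAt

theorem Smth.par_eq_fderiv (hf : Smth r₀ f) (hr : r₀ < r) (hθ : θ ∈ Ioo 0 π) (i : Fin 3) :
    par i f u r θ =
      fderiv ℝ (fun p : ℝ × ℝ × ℝ => f p.1 p.2.1 p.2.2) (u, r, θ) (dir i) := by
  have h := hf.hasFDerivAt (u := u) hr hθ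
  fin_cases i
  · exact (h.comp_hasDerivAt (f := fun s => (s, r, θ)) u
      ((hasDerivAt_id u).prodMk (hasDerivAt_const u (r, θ)))).deriv
  · exact (h.comp_hasDerivAt (f := fun s => (u, s, θ)) r
      ((hasDerivAt_const r u).prodMk ((hasDerivAt_id r).prodMk (hasDerivAt_const r θ)))).deriv
  · exact (h.comp_hasDerivAt (f := fun s => (u, r, s)) θ
      ((hasDerivAt_const θ u).prodMk ((hasDerivAt_const θ r).prodMk (hasDerivAt_id θ)))).deriv

theorem Smth.hasDerivAt_u (hf : Smth r₀ f) (hr : r₀ < r) (hθ : θ ∈ Ioo 0 π) :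
    HasDerivAt (fun s => f s r θ) (par 0 f u r θ) u :=
  ((hf.hasFDerivAt (u := u) hr hθ).comp_hasDerivAt (f := fun s => (s, r, θ)) u
    ((hasDerivAt_id u).prodMk (hasDerivAt_const u (r, θ)))).differentiableAt.hasDerivAt

theorem Smth.hasDerivAt_r (hf : Smth r₀ f) (hr : r₀ < r) (hθ : θ ∈ Ioo 0 π) :
    HasDerivAt (fun s => f u s θ) (par 1 f u r θ) r :=
  ((hf.hasFDerivAt (u := u) hr hθ).comp_hasDerivAt (f := fun s => (u, s, θ)) r
    ((hasDerivAt_const r u).prodMk ((hasDerivAt_id r).prodMk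
      (hasDerivAt_const r θ)))).differentiableAt.hasDerivAt

theorem Smth.hasDerivAt_θ (hf : Smth r₀ f) (hr : r₀ < r) (hθ : θ ∈ Ioo 0 π) :
    HasDerivAt (fun s => f u r s) (par 2 f u r θ) θ :=
  ((hf.hasFDerivAt (u := u) hr hθ).comp_hasDerivAt (f := fun s => (u, r, s)) θ
    ((hasDerivAt_const θ u).prodMk ((hasDerivAt_const θ r).prodMk
      (hasDerivAt_id θ)))).differentiableAt.hasDerivAt

/-- The derivative along a slice `u + r = const`. -/
theorem Smth.hasDerivAt_slice (hf : Smth r₀ f) {t : ℝ} (hr : r₀ < r) (hθ : θ ∈ Ioo 0 π) :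
    HasDerivAt (fun s => f (t - s) s θ) (par 1 f (t - r) r θ - par 0 f (t - r) r θ) r := by
  have h := (hf.hasFDerivAt (u := t - r) hr hθ).comp_hasDerivAt (f := fun s => (t - s, s, θ)) r
    (((hasDerivAt_id r).const_sub t).prodMk ((hasDerivAt_id r).prodMk (hasDerivAt_const r θ)))
  have e : dir 1 - dir 0 = (-1, 1, 0) := by simp [dir]
  rw [hf.par_eq_fderiv hr hθ, hf.par_eq_fderiv hr hθ, ← map_sub, e]
  exact h

theorem Smth.par (hf : Smth r₀ f) (i : Fin 3) : Smth r₀ (par i f) := by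
  have h : ContDiffOn ℝ ∞ (fun p => fderiv ℝ (fun p : ℝ × ℝ × ℝ => f p.1 p.2.1 p.2.2) p (dir i))
      (region r₀) :=
    (ContDiffOn.fderiv_of_isOpen hf (isOpen_region r₀) (by simp)).clm_apply contDiffOn_const
  exact h.congr fun p hp => hf.par_eq_fderiv hp.1 hp.2 i

/-- Partial derivatives depend on the function in the open region only. -/
theorem par_congr (h : ∀ u r θ, r₀ < r → θ ∈ Ioo 0 π → f u r θ = g u r θ) (i : Fin 3)
    (hr : r₀ < r) (hθ : θ ∈ Ioo 0 π) : AxiBondi.par i f u r θ = AxiBondi.par i g u r θ := by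
  fin_cases i
  · exact congrArg (fun F => deriv F u) (funext fun s => h s r θ hr hθ)
  · exact Filter.EventuallyEq.deriv_eq
      ((eventually_gt_nhds hr).mono fun s hs => h u s θ hs hθ)
  · exact Filter.EventuallyEq.deriv_eq
      ((Ioo_mem_nhds hθ.1 hθ.2 : Ioo 0 π ∈ 𝓝 θ) |> fun hm =>
        Filter.mem_of_superset hm fun s hs => h u r s hr hs)

theorem Smth.par_comm (hf : Smth r₀ f) (i j : Fin 3) (hr : r₀ < r) (hθ : θ ∈ Ioo 0 π) :
    AxiBondi.par i (AxiBondi.par j f) u r θ = AxiBondi.par j (AxiBondi.par i f) u r θ := by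
  have key : ∀ i j : Fin 3, AxiBondi.par i (AxiBondi.par j f) u r θ =
      fderiv ℝ (fderiv ℝ (fun p : ℝ × ℝ × ℝ => f p.1 p.2.1 p.2.2)) (u, r, θ) (dir i) (dir j) := by
    intro i j
    rw [(hf.par j).par_eq_fderiv hr hθ]
    have e : (fun p : ℝ × ℝ × ℝ => AxiBondi.par j f p.1 p.2.1 p.2.2) =ᶠ[𝓝 (u, r, θ)]
        fun p => fderiv ℝ (fun p : ℝ × ℝ × ℝ => f p.1 p.2.1 p.2.2) p (dir j) := by
      filter_upwards [(isOpen_region r₀).mem_nhds (show (u, r, θ) ∈ region r₀ from ⟨hr, hθ⟩)]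
        with p hp
      exact hf.par_eq_fderiv hp.1 hp.2 j
    rw [e.fderiv_eq]
    have hd : DifferentiableAt ℝ (fderiv ℝ (fun p : ℝ × ℝ × ℝ => f p.1 p.2.1 p.2.2)) (u, r, θ) :=
      ((hf.contDiffAt hr hθ).fderiv_right (m := 1) (by norm_cast)).differentiableAt (by simp)
    rw [fderiv_clm_apply hd (differentiableAt_const _)]
    simp
  rw [key, key]
  exact (hf.contDiffAt hr hθ).isSymmSndFDerivAt (by simp; norm_cast) _ _

theorem Smth.sub (hf : Smth r₀ f) (hg : Smth r₀ g) :
    Smth r₀ fun u r θ => f u r θ - g u r θ := ContDiffOn.sub hf hg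

theorem Smth.add (hf : Smth r₀ f) (hg : Smth r₀ g) :
    Smth r₀ fun u r θ => f u r θ + g u r θ := ContDiffOn.add hf hg

theorem par_sub (hf : Smth r₀ f) (hg : Smth r₀ g) (i : Fin 3) (hr : r₀ < r)
    (hθ : θ ∈ Ioo 0 π) : AxiBondi.par i (fun u r θ => f u r θ - g u r θ) u r θ =
      AxiBondi.par i f u r θ - AxiBondi.par i g u r θ := by
  fin_cases i
  · exact ((hf.hasDerivAt_u hr hθ).sub (hg.hasDerivAt_u hr hθ)).deriv
  · exact ((hf.hasDerivAt_r hr hθ).sub (hg.hasDerivAt_r hr hθ)).deriv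
  · exact ((hf.hasDerivAt_θ hr hθ).sub (hg.hasDerivAt_θ hr hθ)).deriv

/-! ### Jets -/

/-- `∂_u^i ∂_r^j ∂_θ^l f`. -/
noncomputable def jet (i j l : ℕ) (f : ℝ → ℝ → ℝ → ℝ) : ℝ → ℝ → ℝ → ℝ :=
  (AxiBondi.par 0)^[i] ((AxiBondi.par 1)^[j] ((AxiBondi.par 2)^[l] f))

/-- `∂_u^i ∂_θ^l a` for a function of `(u, θ)`. -/
noncomputable def cjet (i l : ℕ) (a : ℝ → ℝ → ℝ) : ℝ → ℝ → ℝ := d0^[i] (d2^[l] a)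

/-- The function `a(u, θ) r^m`. -/
noncomputable def mono (a : ℝ → ℝ → ℝ) (m : ℤ) : ℝ → ℝ → ℝ → ℝ := fun u r θ => a u θ * r ^ m

theorem par_mono_u (a : ℝ → ℝ → ℝ) (m : ℤ) : AxiBondi.par 0 (mono a m) = mono (d0 a) m := by
  funext u r θ; simp [AxiBondi.par, mono, d0]

theorem par_mono_θ (a : ℝ → ℝ → ℝ) (m : ℤ) : AxiBondi.par 2 (mono a m) = mono (d2 a) m := by
  funext u r θ; simp [AxiBondi.par, mono, d2]

theorem par_mono_r (a : ℝ → ℝ → ℝ) (m : ℤ) (k : ℝ) :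
    AxiBondi.par 1 (fun u r θ => k * mono a m u r θ) =
      fun u r θ => k * m * mono a (m - 1) u r θ := by
  funext u r θ; simp [AxiBondi.par, mono]; ring

theorem iterate_par_sub (i : Fin 3) (n : ℕ) : ∀ {f g : ℝ → ℝ → ℝ → ℝ}, Smth r₀ f → Smth r₀ g →
    ∀ {u r θ}, r₀ < r → θ ∈ Ioo 0 π →
    Smth r₀ ((AxiBondi.par i)^[n] f) ∧
    (AxiBondi.par i)^[n] (fun u r θ => f u r θ - g u r θ) u r θ =
      (AxiBondi.par i)^[n] f u r θ - (AxiBondi.par i)^[n] g u r θ := by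
  induction n with
  | zero => intro f g hf hg u r θ _ _; exact ⟨hf, rfl⟩
  | succ n ih =>
    intro f g hf hg u r θ hr hθ
    simp only [Function.iterate_succ_apply']
    refine ⟨(ih hf hg hr hθ (u := u)).1.par i, ?_⟩
    rw [par_congr (fun u r θ hr hθ => (ih hf hg hr hθ (u := u)).2) i hr hθ]
    exact par_sub (ih hf hg hr hθ (u := u)).1 (ih hg hf hr hθ (u := u)).1 i hr hθ

theorem Smth.iterate_par (i : Fin 3) (n : ℕ) (hf : Smth r₀ f) :
    Smth r₀ ((AxiBondi.par i)^[n] f) := by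
  induction n with
  | zero => exact hf
  | succ n ih => rw [Function.iterate_succ_apply']; exact ih.par i

theorem iterate_par_congr (h : ∀ u r θ, r₀ < r → θ ∈ Ioo 0 π → f u r θ = g u r θ) (i : Fin 3)
    (n : ℕ) : ∀ u r θ, r₀ < r → θ ∈ Ioo 0 π →
      (AxiBondi.par i)^[n] f u r θ = (AxiBondi.par i)^[n] g u r θ := by
  induction n with
  | zero => exact h
  | succ n ih =>
    intro u r θ hr hθ
    simp only [Function.iterate_succ_apply']
    exact par_congr ih i hr hθ

theorem Smth.jet (hf : Smth r₀ f) (i j l : ℕ) : Smth r₀ (jet i j l f) :=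
  ((hf.iterate_par 2 l).iterate_par 1 j).iterate_par 0 i

theorem jet_sub (hf : Smth r₀ f) (hg : Smth r₀ g) (i j l : ℕ) (hr : r₀ < r)
    (hθ : θ ∈ Ioo 0 π) : AxiBondi.jet i j l (fun u r θ => f u r θ - g u r θ) u r θ =
      AxiBondi.jet i j l f u r θ - AxiBondi.jet i j l g u r θ := by
  unfold AxiBondi.jet
  rw [iterate_par_congr (iterate_par_congr (fun u r θ hr hθ =>
    (iterate_par_sub 2 l hf hg (u := u) hr hθ).2) 1 j) 0 i u r θ hr hθ,
    iterate_par_congr (fun u r θ hr hθ => (iterate_par_sub 1 j (hf.iterate_par 2 l)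
      (hg.iterate_par 2 l) (u := u) hr hθ).2) 0 i u r θ hr hθ]
  exact (iterate_par_sub 0 i ((hf.iterate_par 2 l).iterate_par 1 j)
    ((hg.iterate_par 2 l).iterate_par 1 j) hr hθ).2

/-- The factor `m (m - 1) ⋯ (m - j + 1)` produced by `∂_r^j r^m`. -/
def fallingFactor (m : ℤ) (j : ℕ) : ℝ := ∏ t ∈ Finset.range j, ((m : ℝ) - t)

theorem jet_mono (a : ℝ → ℝ → ℝ) (m : ℤ) (i j l : ℕ) (u r θ : ℝ) :
    AxiBondi.jet i j l (mono a m) u r θ = fallingFactor m j * (cjet i l a u θ * r ^ (m - j)) := by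
  have h2 : ∀ (l : ℕ) (a : ℝ → ℝ → ℝ), (AxiBondi.par 2)^[l] (mono a m) = mono (d2^[l] a) m := by
    intro l
    induction l with
    | zero => intro a; rfl
    | succ l ih => intro a; simp only [Function.iterate_succ_apply, par_mono_θ, ih]
  have h1 : ∀ (j : ℕ) (a : ℝ → ℝ → ℝ), (AxiBondi.par 1)^[j] (mono a m) =
      fun u r θ => fallingFactor m j * mono a (m - j) u r θ := by
    intro j
    induction j with
    | zero => intro a; funext u r θ; simp [fallingFactor]
    | succ j ih =>
      intro a
      rw [Function.iterate_succ_apply', ih, par_mono_r]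
      funext u r θ
      simp only [fallingFactor, Finset.prod_range_succ]
      push_cast
      rw [sub_sub]
  have h0 : ∀ (i : ℕ) (k : ℝ) (a : ℝ → ℝ → ℝ) (m : ℤ),
      (AxiBondi.par 0)^[i] (fun u r θ => k * mono a m u r θ) =
        fun u r θ => k * mono (d0^[i] a) m u r θ := by
    intro i k
    induction i with
    | zero => intro a m; rfl
    | succ i ih =>
      intro a m
      have : AxiBondi.par 0 (fun u r θ => k * mono a m u r θ) =
          fun u r θ => k * mono (d0 a) m u r θ := by
        funext u r θ; simp [AxiBondi.par, mono, d0]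
      rw [Function.iterate_succ_apply, this, ih, Function.iterate_succ_apply]
  rw [AxiBondi.jet, h2, h1, h0]
  rfl

theorem smth_mono (hr₀ : 0 ≤ r₀) {a : ℝ → ℝ → ℝ} (ha : SmoothCoeff a) (m : ℤ) :
    Smth r₀ (mono a m) := by
  have h1 : ContDiffOn ℝ ∞ (fun p : ℝ × ℝ × ℝ => a p.1 p.2.2) (region r₀) :=
    ContDiffOn.comp (g := fun p : ℝ × ℝ => a p.1 p.2) ha
      (f := fun p : ℝ × ℝ × ℝ => (p.1, p.2.2)) (by fun_prop)
      (fun p hp => Ioo_subset_Icc_self hp.2)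
  have h2 : ContDiffOn ℝ ∞ (fun p : ℝ × ℝ × ℝ => p.2.1 ^ m) (region r₀) := by
    intro p hp
    have : p.2.1 ≠ 0 := (hr₀.trans_lt hp.1).ne'
    have e : ContDiffAt ℝ ∞ (fun x : ℝ => x ^ m) p.2.1 := by
      rcases m with n | n
      · simpa using contDiffAt_id.pow n
      · simp only [zpow_negSucc]
        exact (contDiffAt_id.pow (n + 1)).inv (pow_ne_zero _ this)
    exact (e.comp p (contDiff_fst.comp contDiff_snd).contDiffAt).contDiffWithinAt
  exact h1.mul h2

theorem SmoothOutside.smth (hf : SmoothOutside r₀ f) : Smth r₀ f :=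
  ContDiffOn.mono hf fun _ hp => ⟨hp.1, Ioo_subset_Icc_self hp.2⟩

/-- The bounds on a remainder, in terms of jets. -/
theorem IsRemainder.jet_le {k : ℕ} (h : IsRemainder k f) (u₁ : ℝ) :
    ∃ K R : ℝ, ∀ u ≤ u₁, ∀ r ≥ R, ∀ θ ∈ Ioo 0 π, ∀ i j l : ℕ, i + j + l ≤ 2 →
      r ^ (k + j) * |AxiBondi.jet i j l f u r θ| ≤ K := by
  obtain ⟨K, R, hK⟩ := h u₁
  refine ⟨K, R, fun u hu r hr θ hθ i j l hijl => ?_⟩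
  have h0 : ∀ (n : ℕ) (F : ℝ → ℝ → ℝ → ℝ) (u r θ : ℝ),
      (AxiBondi.par 0)^[n] F u r θ = iteratedDeriv n (fun s => F s r θ) u := by
    intro n
    induction n with
    | zero => intro F u r θ; simp
    | succ n ih => intro F u r θ; rw [Function.iterate_succ_apply, ih, iteratedDeriv_succ']; rfl
  have h1 : ∀ (n : ℕ) (F : ℝ → ℝ → ℝ → ℝ) (u r θ : ℝ),
      (AxiBondi.par 1)^[n] F u r θ = iteratedDeriv n (fun s => F u s θ) r := by
    intro n
    induction n with
    | zero => intro F u r θ; simp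
    | succ n ih => intro F u r θ; rw [Function.iterate_succ_apply, ih, iteratedDeriv_succ']; rfl
  have h2 : ∀ (n : ℕ) (F : ℝ → ℝ → ℝ → ℝ) (u r θ : ℝ),
      (AxiBondi.par 2)^[n] F u r θ = iteratedDeriv n (fun s => F u r s) θ := by
    intro n
    induction n with
    | zero => intro F u r θ; simp
    | succ n ih => intro F u r θ; rw [Function.iterate_succ_apply, ih, iteratedDeriv_succ']; rfl
  have := hK u hu r hr θ hθ i j l hijl
  simpa only [AxiBondi.jet, h0, h1, h2] using this

end

/-! ### Bounds on the expansion coefficients -/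

section

theorem pd_lift_u (f : ℝ → ℝ → ℝ → ℝ) : pd 0 (lift f) = lift (par 0 f) := by
  funext x; simp [pd, lift, par]

theorem pd_lift_r (f : ℝ → ℝ → ℝ → ℝ) : pd 1 (lift f) = lift (par 1 f) := by
  funext x; simp [pd, lift, par]

theorem pd_lift_θ (f : ℝ → ℝ → ℝ → ℝ) : pd 2 (lift f) = lift (par 2 f) := by
  funext x; simp [pd, lift, par]

theorem pd_lift_ψ (f : ℝ → ℝ → ℝ → ℝ) : pd 3 (lift f) = lift fun _ _ _ => 0 := by
  funext x; simp [pd, lift]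

theorem frame_zero_lift (f : ℝ → ℝ → ℝ → ℝ) :
    frame 0 (lift f) = lift fun u r θ => par 1 f u r θ - par 0 f u r θ := by
  funext x; simp [frame, pd_lift_u, pd_lift_r, lift]

theorem frame_one_lift (f : ℝ → ℝ → ℝ → ℝ) :
    frame 1 (lift f) = lift fun u r θ => par 2 f u r θ / r := by
  funext x; simp [frame, pd_lift_θ, lift]

/-- For each fixed large `r`, `f` is bounded as `u → -∞`, uniformly in `θ`. -/
def EvBdd (f : ℝ → ℝ → ℝ → ℝ) : Prop :=
  ∀ᶠ r in atTop, ∃ K, ∀ᶠ u in atBot, ∀ θ ∈ Ioo 0 π, |f u r θ| ≤ K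

/-- A function of `(u, θ)` is bounded as `u → -∞`, uniformly in `θ`. -/
def CBdd (a : ℝ → ℝ → ℝ) : Prop := ∃ K, ∀ᶠ u in atBot, ∀ θ ∈ Ioo 0 π, |a u θ| ≤ K

variable {r₀ : ℝ} {f g : ℝ → ℝ → ℝ → ℝ} {a b : ℝ → ℝ → ℝ}

theorem EvBdd.add (hf : EvBdd f) (hg : EvBdd g) : EvBdd fun u r θ => f u r θ + g u r θ := by
  filter_upwards [hf, hg] with r ⟨K, hK⟩ ⟨K', hK'⟩
  refine ⟨K + K', ?_⟩
  filter_upwards [hK, hK'] with u h h' θ hθ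
  exact (abs_add_le _ _).trans (add_le_add (h θ hθ) (h' θ hθ))

theorem EvBdd.mul_left (hf : EvBdd f) (φ : ℝ → ℝ) : EvBdd fun u r θ => φ r * f u r θ := by
  filter_upwards [hf] with r ⟨K, hK⟩
  refine ⟨|φ r| * K, ?_⟩
  filter_upwards [hK] with u h θ hθ
  rw [abs_mul]
  exact mul_le_mul_of_nonneg_left (h θ hθ) (abs_nonneg _)

theorem EvBdd.congr (hf : EvBdd f) (r₀ : ℝ)
    (h : ∀ u r θ, r₀ < r → θ ∈ Ioo 0 π → f u r θ = g u r θ) : EvBdd g := by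
  filter_upwards [hf, eventually_gt_atTop r₀] with r ⟨K, hK⟩ hr
  refine ⟨K, ?_⟩
  filter_upwards [hK] with u hu θ hθ
  rw [← h u r θ hr hθ]
  exact hu θ hθ

theorem CBdd.evBdd (ha : CBdd a) : EvBdd fun u _ θ => a u θ :=
  Eventually.of_forall fun _ => ha

theorem BoundedAtSpatialInfinity.evBdd {n : ℕ} (h : BoundedAtSpatialInfinity n (lift f)) :
    EvBdd f := by
  obtain ⟨K, hK⟩ := h
  filter_upwards [hK, eventually_gt_atTop 0] with r hr hr0
  refine ⟨K / r ^ n, ?_⟩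
  filter_upwards [hr] with u hu θ hθ
  have := hu θ hθ 0
  rw [le_div_iff₀ (by positivity), mul_comm]
  simpa [lift, abs_mul, abs_of_pos hr0] using this

/-- Two powers of `r` are independent: if `a r⁻ᵖ + b r⁻ᑫ` is bounded as `u → -∞` for each large
`r`, then so are `a` and `b`. Compare the radii `r` and `2 r`. -/
theorem cBdd_of_evBdd {p q : ℕ} (hpq : p < q)
    (h : EvBdd fun u r θ => a u θ * r ^ (-p : ℤ) + b u θ * r ^ (-q : ℤ)) :
    CBdd a ∧ CBdd b := by
  have h2 : ∀ᶠ r : ℝ in atTop, ∃ K, ∀ᶠ u in atBot, ∀ θ ∈ Ioo 0 π,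
      |a u θ * (2 * r) ^ (-p : ℤ) + b u θ * (2 * r) ^ (-q : ℤ)| ≤ K :=
    (tendsto_id.const_mul_atTop (by norm_num : (0 : ℝ) < 2)).eventually h
  obtain ⟨r, ⟨K₁, h₁⟩, ⟨K₂, h₂⟩, hr⟩ := (h.and (h2.and (eventually_gt_atTop 0))).exists
  have hpq' : (1 : ℝ) < 2 ^ (q - p) := one_lt_pow₀ (by norm_num) (by omega)
  have eA : ∀ u θ, a u θ = (2 ^ q * (a u θ * (2 * r) ^ (-p : ℤ) + b u θ * (2 * r) ^ (-q : ℤ)) -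
      (a u θ * r ^ (-p : ℤ) + b u θ * r ^ (-q : ℤ))) * (r ^ p / (2 ^ (q - p) - 1)) := by
    intro u θ
    have : (2 : ℝ) ^ (q - p) - 1 ≠ 0 := by linarith
    obtain ⟨n, rfl⟩ : ∃ n, q = p + n := ⟨q - p, by omega⟩
    simp only [Nat.add_sub_cancel_left, zpow_neg, zpow_natCast, mul_pow, pow_add] at this ⊢
    field_simp
    ring
  have bA : ∀ᶠ u in atBot, ∀ θ ∈ Ioo 0 π,
      |a u θ| ≤ (2 ^ q * K₂ + K₁) * (r ^ p / (2 ^ (q - p) - 1)) := by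
    filter_upwards [h₁, h₂] with u hu hu' θ hθ
    have hpos : (0 : ℝ) ≤ r ^ p / (2 ^ (q - p) - 1) :=
      div_nonneg (by positivity) (by linarith)
    rw [eA u θ, abs_mul, abs_of_nonneg hpos]
    refine mul_le_mul_of_nonneg_right ?_ hpos
    refine (abs_sub _ _).trans (add_le_add ?_ (hu θ hθ))
    rw [abs_mul, abs_of_pos (by positivity)]
    exact mul_le_mul_of_nonneg_left (hu' θ hθ) (by positivity)
  refine ⟨⟨_, bA⟩, ((K₁ + (2 ^ q * K₂ + K₁) * (r ^ p / (2 ^ (q - p) - 1)) * r ^ (-p : ℤ)) * r ^ q),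
    ?_⟩
  filter_upwards [h₁, bA] with u hu hA θ hθ
  have eB : b u θ = ((a u θ * r ^ (-p : ℤ) + b u θ * r ^ (-q : ℤ)) - a u θ * r ^ (-p : ℤ)) *
      r ^ q := by
    simp only [zpow_neg, zpow_natCast]
    field_simp
    ring
  rw [eB, abs_mul, abs_of_pos (by positivity : (0 : ℝ) < r ^ q)]
  refine mul_le_mul_of_nonneg_right ?_ (by positivity)
  refine (abs_sub _ _).trans (add_le_add (hu θ hθ) ?_)
  rw [abs_mul, abs_of_pos (by positivity : (0 : ℝ) < r ^ (-p : ℤ))]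
  exact mul_le_mul_of_nonneg_right (hA θ hθ) (by positivity)

/-- `f = a r⁻ᵖ + O(r⁻ᵖ⁻¹)` as `u → -∞` and `r → ∞` independently, uniformly in `θ`, where the
estimate may be differentiated twice and `a` is bounded together with its derivatives up to
second order. -/
def LeadingTerm (f : ℝ → ℝ → ℝ → ℝ) (p : ℕ) (a : ℝ → ℝ → ℝ) : Prop :=
  ∃ K, ∀ᶠ q : ℝ × ℝ in atBot ×ˢ atTop, ∀ θ ∈ Ioo 0 π, ∀ i j l : ℕ, i + j + l ≤ 2 →
    |cjet i l a q.1 θ| ≤ K ∧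
    |q.2 ^ (p + j) * jet i j l f q.1 q.2 θ - fallingFactor (-p) j * cjet i l a q.1 θ| ≤ K / q.2

/-- The decay conditions bound the coefficients of an expansion with their derivatives up to second
order. Each derivative of order at most two in `(u, θ)` is reached by a frame derivative, up to
terms with fewer derivatives in `(u, θ)`, which are bounded once the corresponding derivatives of
the coefficients are. -/
theorem leadingTerm_of_decay (hr₀ : 0 ≤ r₀) (hf : Smth r₀ f) (ha : SmoothCoeff a)
    (hb : SmoothCoeff b) {p q m : ℕ} (hpq : p < q) (hpm : p < m)
    (hrem : IsRemainder m fun u r θ => f u r θ - mono a (-p) u r θ - mono b (-q) u r θ)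
    {a₁ a₂ a₃ : ℕ} (hD : DecayClass a₁ a₂ a₃ (lift f)) : LeadingTerm f p a := by
  set g : ℝ → ℝ → ℝ → ℝ := fun u r θ => f u r θ - mono a (-p) u r θ - mono b (-q) u r θ with hg
  have hsa := smth_mono hr₀ ha (-p)
  have hsb := smth_mono hr₀ hb (-q)
  have hjet : ∀ i j l u r θ, r₀ < r → θ ∈ Ioo 0 π → jet i j l g u r θ = jet i j l f u r θ -
      fallingFactor (-p) j * (cjet i l a u θ * r ^ (-p - j : ℤ)) -
      fallingFactor (-q) j * (cjet i l b u θ * r ^ (-q - j : ℤ)) := by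
    intro i j l u r θ hr hθ
    rw [hg, jet_sub (hf.sub hsa) hsb i j l hr hθ, jet_sub hf hsa i j l hr hθ, jet_mono, jet_mono]
  obtain ⟨K, R, hK⟩ := hrem.jet_le 0
  have hgb : ∀ i j l, i + j + l ≤ 2 → EvBdd (jet i j l g) := by
    intro i j l h
    filter_upwards [eventually_ge_atTop R, eventually_gt_atTop 0] with r hr hr0
    refine ⟨K / r ^ (m + j), ?_⟩
    filter_upwards [eventually_le_atBot 0] with u hu θ hθ
    rw [le_div_iff₀ (by positivity), mul_comm]
    exact hK u hu r hr θ hθ i j l h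
  -- A bound on a derivative of `f` is a bound on the derivatives of both coefficients, and, in
  -- `ofCoef`, bounds on the coefficients control every further `r`-derivative of `f`.
  have toCoef : ∀ i l, i + l ≤ 2 → EvBdd (jet i 0 l f) →
      CBdd (cjet i l a) ∧ CBdd (cjet i l b) := by
    intro i l h hfb
    refine cBdd_of_evBdd hpq ((hfb.add ((hgb i 0 l (by omega)).mul_left fun _ => -1)).congr r₀ ?_)
    intro u r θ hr hθ
    rw [hjet i 0 l u r θ hr hθ]
    simp [fallingFactor]
    ring
  have ofCoef : ∀ i j l, i + j + l ≤ 2 → CBdd (cjet i l a) ∧ CBdd (cjet i l b) →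
      EvBdd (jet i j l f) := by
    intro i j l h hc
    refine ((hgb i j l h).add ((hc.1.evBdd.mul_left
      fun r => fallingFactor (-p) j * r ^ (-p - j : ℤ)).add (hc.2.evBdd.mul_left
      fun r => fallingFactor (-q) j * r ^ (-q - j : ℤ)))).congr r₀ ?_
    intro u r θ hr hθ
    rw [hjet i j l u r θ hr hθ]
    ring
  obtain ⟨hD0, hD1, hD2⟩ := hD
  have c00 := toCoef 0 0 (by norm_num) hD0.evBdd
  have f1 : EvBdd (par 1 f) := ofCoef 0 1 0 (by norm_num) c00
  have c01 := toCoef 0 1 (by norm_num) <| by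
    have := (frame_one_lift f ▸ hD1 1).evBdd.mul_left fun r => r
    refine this.congr r₀ fun u r θ hr hθ => ?_
    have : r ≠ 0 := (hr₀.trans_lt hr).ne'
    simp only [jet, Function.iterate_zero, Function.iterate_one, id]
    field_simp
  have f2 : EvBdd (par 2 f) := ofCoef 0 0 1 (by norm_num) c01
  have c10 := toCoef 1 0 (by norm_num) <| by
    have := f1.add ((frame_zero_lift f ▸ hD1 0).evBdd.mul_left fun _ => -1)
    refine this.congr r₀ fun u r θ hr hθ => ?_
    simp only [jet, Function.iterate_zero, Function.iterate_one, id]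
    ring
  have c02 := toCoef 0 2 (by norm_num) <| by
    have h := hD2 1 1
    rw [frame_one_lift, frame_one_lift] at h
    refine (h.evBdd.mul_left fun r => r ^ 2).congr r₀ fun u r θ hr hθ => ?_
    have : r ≠ 0 := (hr₀.trans_lt hr).ne'
    have e : par 2 (fun u r θ => par 2 f u r θ / r) u r θ = par 2 (par 2 f) u r θ / r :=
      ((hf.par 2).hasDerivAt_θ hr hθ |>.div_const r).deriv
    rw [e]
    simp only [jet, Function.iterate_zero, id, Function.iterate_succ, Function.comp]
    field_simp
  have f12 : EvBdd (par 1 (par 2 f)) := ofCoef 0 1 1 (by norm_num) c01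
  have c11 := toCoef 1 1 (by norm_num) <| by
    have h := hD2 0 1
    rw [frame_one_lift, frame_zero_lift] at h
    refine ((f12.add (f2.mul_left fun r => -1 / r)).add
      (h.evBdd.mul_left fun r => -r)).congr r₀ fun u r θ hr hθ => ?_
    have hr' : r ≠ 0 := (hr₀.trans_lt hr).ne'
    have e0 : par 0 (fun u r θ => par 2 f u r θ / r) u r θ = par 0 (par 2 f) u r θ / r :=
      ((hf.par 2).hasDerivAt_u hr hθ |>.div_const r).deriv
    have e1 : par 1 (fun u r θ => par 2 f u r θ / r) u r θ =
        (par 1 (par 2 f) u r θ * r - par 2 f u r θ * 1) / r ^ 2 :=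
      ((hf.par 2).hasDerivAt_r hr hθ |>.div (hasDerivAt_id r) hr').deriv
    rw [e0, e1]
    simp only [jet, Function.iterate_zero, id, Function.iterate_one]
    field_simp
    ring
  have f11 : EvBdd (par 1 (par 1 f)) := ofCoef 0 2 0 (by norm_num) c00
  have f01 : EvBdd (par 0 (par 1 f)) := ofCoef 1 1 0 (by norm_num) c10
  have c20 := toCoef 2 0 (by norm_num) <| by
    have h := hD2 0 0
    rw [frame_zero_lift, frame_zero_lift] at h
    refine ((h.evBdd.add (f11.mul_left fun _ => -1)).add
      (f01.mul_left fun r => 2)).congr r₀ fun u r θ hr hθ => ?_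
    rw [par_sub (hf.par 1) (hf.par 0) 1 hr hθ, par_sub (hf.par 1) (hf.par 0) 0 hr hθ,
      hf.par_comm 1 0 hr hθ]
    simp only [jet, Function.iterate_zero, id, Function.iterate_succ, Function.comp]
    ring
  have call : ∀ i l, i + l ≤ 2 → CBdd (cjet i l a) ∧ CBdd (cjet i l b) := by
    intro i l h
    have hi : i ≤ 2 := by omega
    have hl : l ≤ 2 := by omega
    interval_cases i <;> interval_cases l <;> first | assumption | omega
  -- one bound for the finitely many derivatives of order at most two
  have hcb : ∃ C, ∀ᶠ u in atBot, ∀ θ ∈ Ioo 0 π, ∀ i l, i + l ≤ 2 →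
      |cjet i l a u θ| ≤ C ∧ |cjet i l b u θ| ≤ C := by
    have : ∀ x : Fin 3 × Fin 3, ∃ C, ∀ᶠ u in atBot, ∀ θ ∈ Ioo 0 π, (x.1 : ℕ) + x.2 ≤ 2 →
        |cjet x.1 x.2 a u θ| ≤ C ∧ |cjet x.1 x.2 b u θ| ≤ C := by
      intro x
      by_cases hx : (x.1 : ℕ) + x.2 ≤ 2
      · obtain ⟨⟨C, hC⟩, ⟨C', hC'⟩⟩ := call x.1 x.2 hx
        refine ⟨max C C', ?_⟩
        filter_upwards [hC, hC'] with u h h' θ hθ _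
        exact ⟨(h θ hθ).trans (le_max_left _ _), (h' θ hθ).trans (le_max_right _ _)⟩
      · exact ⟨0, Eventually.of_forall fun u θ _ h => absurd h hx⟩
    choose C hC using this
    refine ⟨∑ x, |C x|, ?_⟩
    filter_upwards [eventually_all.2 hC] with u hu θ hθ i l h
    have hle : C (⟨i, by omega⟩, ⟨l, by omega⟩) ≤ ∑ x, |C x| :=
      (le_abs_self _).trans (Finset.single_le_sum (f := fun x => |C x|)
        (fun _ _ => abs_nonneg _) (Finset.mem_univ _))
    have := hu (⟨i, by omega⟩, ⟨l, by omega⟩) θ hθ h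
    exact ⟨this.1.trans hle, this.2.trans hle⟩
  obtain ⟨C, hC⟩ := hcb
  set Q : ℝ := ∑ j ∈ Finset.range 3, |fallingFactor (-q) j| with hQ
  refine ⟨|C| + |K| + Q * |C|, ?_⟩
  have hQ0 : 0 ≤ Q := Finset.sum_nonneg fun _ _ => abs_nonneg _
  filter_upwards [(hC.and (eventually_le_atBot 0)).prod_mk ((eventually_ge_atTop R).and
    ((eventually_gt_atTop r₀).and (eventually_ge_atTop 1)))] with x hx θ hθ i j l hijl
  obtain ⟨⟨hx1, hx2⟩, hx3, hx4, hx5⟩ := hx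
  obtain ⟨hca, hcb⟩ := hx1 θ hθ i l (by omega)
  have hC0 : C ≤ |C| := le_abs_self C
  refine ⟨hca.trans (by nlinarith [abs_nonneg K, abs_nonneg C]), ?_⟩
  set r := x.2
  have hr : 0 < r := by linarith
  have e : r ^ (p + j) * jet i j l f x.1 r θ - fallingFactor (-p) j * cjet i l a x.1 θ =
      (r ^ (m + j) * jet i j l g x.1 r θ) * ((r ^ (m - p))⁻¹) +
      fallingFactor (-q) j * cjet i l b x.1 θ * ((r ^ (q - p))⁻¹) := by
    rw [hjet i j l x.1 r θ hx4 hθ]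
    obtain ⟨n, rfl⟩ : ∃ n, m = p + n := ⟨m - p, by omega⟩
    obtain ⟨n', rfl⟩ : ∃ n, q = p + n := ⟨q - p, by omega⟩
    have e1 : r ^ (-(p : ℤ) - j) = (r ^ p * r ^ j)⁻¹ := by
      rw [← pow_add, ← zpow_natCast, ← zpow_neg]; congr 1; push_cast; ring
    have e2 : r ^ (-((p + n' : ℕ) : ℤ) - j) = (r ^ p * r ^ n' * r ^ j)⁻¹ := by
      rw [← pow_add, ← pow_add, ← zpow_natCast, ← zpow_neg]; congr 1; push_cast; ring
    rw [e1, e2]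
    simp only [Nat.add_sub_cancel_left, pow_add]
    field_simp
    ring
  have hinv : ∀ n, 0 < n → (r ^ n)⁻¹ ≤ r⁻¹ := fun n hn =>
    inv_anti₀ hr (le_self_pow₀ hx5 hn.ne')
  rw [e]
  refine (abs_add_le _ _).trans ?_
  rw [abs_mul, abs_mul, abs_mul, abs_mul, abs_of_pos (by positivity : 0 < r ^ (m + j)),
    abs_of_pos (by positivity : 0 < (r ^ (m - p))⁻¹),
    abs_of_pos (by positivity : 0 < (r ^ (q - p))⁻¹), add_div, add_div, add_assoc]
  have h1 : r ^ (m + j) * |jet i j l g x.1 r θ| * (r ^ (m - p))⁻¹ ≤ |K| / r :=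
    mul_le_mul ((hK x.1 hx2 r hx3 θ hθ i j l hijl).trans (le_abs_self K)) (hinv _ (by omega))
      (by positivity) (abs_nonneg _)
  have hq : |fallingFactor (-q) j| ≤ Q := Finset.single_le_sum
    (f := fun j => |fallingFactor (-q) j|) (fun _ _ => abs_nonneg _)
    (Finset.mem_range.2 (by omega))
  have h2 : |fallingFactor (-q) j| * |cjet i l b x.1 θ| * (r ^ (q - p))⁻¹ ≤ Q * |C| / r :=
    mul_le_mul (mul_le_mul hq (hcb.trans hC0) (abs_nonneg _) hQ0) (hinv _ (by omega))
      (by positivity) (by positivity)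
  have h3 : 0 ≤ |C| / r := by positivity
  linarith

end

/-! ### Christoffel symbols and Ricci tensor of the Bondi metric -/

section

/-- `V + r`, which stays bounded, with limit `2 M`. -/
def BondiData.W (S : BondiData) : ℝ → ℝ → ℝ → ℝ := fun u r θ => S.V u r θ + r

/-- `g_{uu}` -/
noncomputable def guu (S : BondiData) : ℝ → ℝ → ℝ → ℝ := fun u r θ =>
  S.V u r θ / r * exp (2 * S.β u r θ) + r ^ 2 * exp (2 * S.γ u r θ) * S.U u r θ ^ 2

/-- `g_{ur}` -/
noncomputable def gur (S : BondiData) : ℝ → ℝ → ℝ → ℝ := fun u r θ => -exp (2 * S.β u r θ)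

/-- `g_{uθ}` -/
noncomputable def guθ (S : BondiData) : ℝ → ℝ → ℝ → ℝ := fun u r θ =>
  -(r ^ 2 * exp (2 * S.γ u r θ) * S.U u r θ)

/-- `g_{θθ}` -/
noncomputable def gθθ (S : BondiData) : ℝ → ℝ → ℝ → ℝ := fun u r θ =>
  r ^ 2 * exp (2 * S.γ u r θ)

/-- `g_{ψψ}` -/
noncomputable def gψψ (S : BondiData) : ℝ → ℝ → ℝ → ℝ := fun u r θ =>
  r ^ 2 * exp (-2 * S.γ u r θ) * sin θ ^ 2

theorem bondiMetric_eq (S : BondiData) (x : Fin 4 → ℝ) : bondiMetric S x =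
    !![lift (guu S) x, lift (gur S) x, lift (guθ S) x, 0;
       lift (gur S) x, 0, 0, 0;
       lift (guθ S) x, 0, lift (gθθ S) x, 0;
       0, 0, 0, lift (gψψ S) x] := rfl

/-- The inverse metric. -/
theorem bondiMetric_inv (S : BondiData) {u r θ : ℝ} (ψ : ℝ) (hr : 0 < r) (hθ : θ ∈ Ioo 0 π) :
    (bondiMetric S ![u, r, θ, ψ])⁻¹ =
      !![0, -(exp (2 * S.β u r θ))⁻¹, 0, 0;
         -(exp (2 * S.β u r θ))⁻¹, -(S.V u r θ / r * (exp (2 * S.β u r θ))⁻¹),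
            -(S.U u r θ * (exp (2 * S.β u r θ))⁻¹), 0;
         0, -(S.U u r θ * (exp (2 * S.β u r θ))⁻¹), (r ^ 2 * exp (2 * S.γ u r θ))⁻¹, 0;
         0, 0, 0, exp (2 * S.γ u r θ) * (r ^ 2 * sin θ ^ 2)⁻¹] := by
  have hs : sin θ ≠ 0 := (sin_pos_of_pos_of_lt_pi hθ.1 hθ.2).ne'
  have hE := (exp_pos (2 * S.β u r θ)).ne'
  have hG := (exp_pos (2 * S.γ u r θ)).ne'
  apply Matrix.inv_eq_left_inv
  rw [bondiMetric_eq]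
  simp only [lift, guu, gur, guθ, gθθ, gψψ, neg_mul, exp_neg, Matrix.cons_val_zero,
    Matrix.cons_val_one, Matrix.cons_val]
  ext i j
  fin_cases i <;> fin_cases j <;> simp [Matrix.mul_apply, Fin.sum_univ_four] <;> field_simp <;> ring

theorem update_u (u r θ ψ s : ℝ) : Function.update ![u, r, θ, ψ] 0 s = ![s, r, θ, ψ] := by
  funext i; fin_cases i <;> simp
theorem update_r (u r θ ψ s : ℝ) : Function.update ![u, r, θ, ψ] 1 s = ![u, s, θ, ψ] := by
  funext i; fin_cases i <;> simp
theorem update_θ (u r θ ψ s : ℝ) : Function.update ![u, r, θ, ψ] 2 s = ![u, r, s, ψ] := by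
  funext i; fin_cases i <;> simp
theorem update_ψ (u r θ ψ s : ℝ) : Function.update ![u, r, θ, ψ] 3 s = ![u, r, θ, s] := by
  funext i; fin_cases i <;> simp

/-- The Christoffel symbols `Γ^k_{ij}` of the Bondi metric. The function `V` enters through
`V / r = W / r - 1`, so that the cancellations at large `r` are manifest. -/
noncomputable def bondiΓ (S : BondiData) (u r θ : ℝ) : Fin 4 → Matrix (Fin 4) (Fin 4) ℝ :=
  let E := exp (2 * S.β u r θ)
  let G := exp (2 * S.γ u r θ)
  let U := S.U u r θ
  let W := S.W u r θ
  let v := S.W u r θ / r - 1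
  let β0 := par 0 S.β u r θ
  let β1 := par 1 S.β u r θ
  let β2 := par 2 S.β u r θ
  let γ0 := par 0 S.γ u r θ
  let γ1 := par 1 S.γ u r θ
  let γ2 := par 2 S.γ u r θ
  let U0 := par 0 S.U u r θ
  let U1 := par 1 S.U u r θ
  let U2 := par 2 S.U u r θ
  let W0 := par 0 S.W u r θ
  let W1 := par 1 S.W u r θ
  let W2 := par 2 S.W u r θ
  let Γ002 := -(E⁻¹ * G * (r ^ 2 * U * γ1 + r * U + r ^ 2 * U1 / 2)) + β2
  let Γ101 := -(E⁻¹ * G * r ^ 2 * U * U1 / 2) - U * β2 - v * β1 + (W / r - W1) / (2 * r)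
  let Γ102 := -(E⁻¹ * G * (r ^ 2 * U * U2 + r * U * v + r ^ 2 * U * v * γ1 + r ^ 2 * U * γ0 +
    r ^ 2 * U ^ 2 * γ2 + r ^ 2 * U1 * v / 2)) - W2 / (2 * r)
  let Γ112 := E⁻¹ * G * r ^ 2 * U1 / 2 + β2
  let Γ201 := E * G⁻¹ * β2 / r ^ 2 - U * γ1 - U / r - U1 / 2
  let Γ202 := -(E⁻¹ * G * (r ^ 2 * U * U1 / 2 + r ^ 2 * U ^ 2 * γ1 + r * U ^ 2)) + U * β2 + γ0
  let Γ212 := γ1 + 1 / r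
  let Γ303 := -γ0
  let Γ313 := 1 / r - γ1
  let Γ323 := cos θ / sin θ - γ2
  ![!![E⁻¹ * G * (r ^ 2 * U * U1 + r ^ 2 * U ^ 2 * γ1 + r * U ^ 2) + v * β1 +
          (W1 - W / r) / (2 * r) + 2 * β0, 0, Γ002, 0;
       0, 0, 0, 0;
       Γ002, 0, E⁻¹ * G * (r ^ 2 * γ1 + r), 0;
       0, 0, 0, E⁻¹ * G⁻¹ * sin θ ^ 2 * (r - r ^ 2 * γ1)],
    !![E⁻¹ * G * U * (r ^ 2 * U1 * v + r ^ 2 * U * U2 + r * U * v + r ^ 2 * U * v * γ1 +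
          r ^ 2 * U * γ0 + r ^ 2 * U ^ 2 * γ2) + U * (v * β2 + W2 / (2 * r)) + v * β0 +
          v ^ 2 * β1 + v * ((W1 - W / r) / (2 * r)) - W0 / (2 * r), Γ101, Γ102, 0;
       Γ101, 2 * β1, Γ112, 0;
       Γ102, Γ112, E⁻¹ * G * (r ^ 2 * U * γ2 + r ^ 2 * U2 + r * v + r ^ 2 * v * γ1 +
          r ^ 2 * γ0), 0;
       0, 0, 0, E⁻¹ * G⁻¹ * sin θ * (r ^ 2 * U * cos θ - r ^ 2 * U * γ2 * sin θ -
          r ^ 2 * v * γ1 * sin θ + r * v * sin θ - r ^ 2 * γ0 * sin θ)],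
    !![E⁻¹ * G * U ^ 2 * (r ^ 2 * U1 + r ^ 2 * U * γ1 + r * U) -
          E * G⁻¹ * (v * β2 + W2 / (2 * r)) / r ^ 2 +
          U * (-U2 + v * β1 + (W1 - W / r) / (2 * r) + 2 * β0 - 2 * γ0 - U * γ2) - U0,
          Γ201, Γ202, 0;
       Γ201, 0, Γ212, 0;
       Γ202, Γ212, E⁻¹ * G * (r ^ 2 * U * γ1 + r * U) + γ2, 0;
       0, 0, 0, E⁻¹ * G⁻¹ * sin θ ^ 2 * (r * U - r ^ 2 * U * γ1) - G⁻¹ ^ 2 * cos θ * sin θ +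
          G⁻¹ ^ 2 * γ2 * sin θ ^ 2],
    !![0, 0, 0, Γ303; 0, 0, 0, Γ313; 0, 0, 0, Γ323; Γ303, Γ313, Γ323, 0]]

/-- Smoothness of the metric functions where the Christoffel symbols are computed. -/
structure BondiData.Regular (S : BondiData) (r₀ : ℝ) : Prop where
  nonneg : 0 ≤ r₀
  β : Smth r₀ S.β
  γ : Smth r₀ S.γ
  U : Smth r₀ S.U
  W : Smth r₀ S.W

variable {S : BondiData} {r₀ u r θ : ℝ}

theorem BondiData.Smooth.regular (h : S.Smooth r₀) (hr₀ : 0 ≤ r₀) : S.Regular r₀ where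
  nonneg := hr₀
  β := h.1.smth
  γ := h.2.1.smth
  U := h.2.2.1.smth
  W := h.2.2.2.smth.add (contDiff_fst.comp contDiff_snd).contDiffOn

section Derivatives

variable (hS : S.Regular r₀) (hr : r₀ < r) (hθ : θ ∈ Ioo 0 π)
include hS hr hθ

theorem par_guu_u : par 0 (guu S) u r θ =
    (par 0 S.W u r θ / r + (S.W u r θ / r - 1) * (2 * par 0 S.β u r θ)) * exp (2 * S.β u r θ) +
      r ^ 2 * exp (2 * S.γ u r θ) * (2 * par 0 S.γ u r θ * S.U u r θ ^ 2 +
        2 * S.U u r θ * par 0 S.U u r θ) := by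
  have hr0 : r ≠ 0 := (hS.nonneg.trans_lt hr).ne'
  have hV : HasDerivAt (fun s => S.V s r θ) (par 0 S.W u r θ) u := by
    simpa [BondiData.W] using (hS.W.hasDerivAt_u (u := u) hr hθ).sub_const r
  have h := ((hV.div_const r).mul ((hS.β.hasDerivAt_u (u := u) hr hθ).const_mul 2).exp).add
    ((((hS.γ.hasDerivAt_u (u := u) hr hθ).const_mul 2).exp.const_mul (r ^ 2)).mul
      ((hS.U.hasDerivAt_u (u := u) hr hθ).pow 2))
  refine h.deriv.trans ?_
  simp only [BondiData.W, Pi.pow_apply]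
  field_simp
  ring

theorem par_guu_r : par 1 (guu S) u r θ =
    ((par 1 S.W u r θ - S.W u r θ / r) / r +
      (S.W u r θ / r - 1) * (2 * par 1 S.β u r θ)) * exp (2 * S.β u r θ) +
      exp (2 * S.γ u r θ) * (2 * r * S.U u r θ ^ 2 + r ^ 2 * (2 * par 1 S.γ u r θ *
        S.U u r θ ^ 2 + 2 * S.U u r θ * par 1 S.U u r θ)) := by
  have hr0 : r ≠ 0 := (hS.nonneg.trans_lt hr).ne'
  have hV : HasDerivAt (fun s => S.V u s θ) (par 1 S.W u r θ - 1) r := by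
    have h := (hS.W.hasDerivAt_r (u := u) hr hθ).sub (hasDerivAt_id r)
    exact h.congr_of_eventuallyEq (Eventually.of_forall fun s => by simp [BondiData.W])
  have h := ((hV.div (hasDerivAt_id r) hr0).mul
    ((hS.β.hasDerivAt_r (u := u) hr hθ).const_mul 2).exp).add
    ((((hasDerivAt_id r).pow 2).mul ((hS.γ.hasDerivAt_r (u := u) hr hθ).const_mul 2).exp).mul
      ((hS.U.hasDerivAt_r (u := u) hr hθ).pow 2))
  refine h.deriv.trans ?_
  simp only [BondiData.W, Pi.pow_apply, Pi.mul_apply, Pi.div_apply, id]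
  field_simp
  ring

theorem par_guu_θ : par 2 (guu S) u r θ =
    (par 2 S.W u r θ / r + (S.W u r θ / r - 1) * (2 * par 2 S.β u r θ)) * exp (2 * S.β u r θ) +
      r ^ 2 * exp (2 * S.γ u r θ) * (2 * par 2 S.γ u r θ * S.U u r θ ^ 2 +
        2 * S.U u r θ * par 2 S.U u r θ) := by
  have hr0 : r ≠ 0 := (hS.nonneg.trans_lt hr).ne'
  have hV : HasDerivAt (fun s => S.V u r s) (par 2 S.W u r θ) θ := by
    simpa [BondiData.W] using (hS.W.hasDerivAt_θ (u := u) hr hθ).sub_const r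
  have h := ((hV.div_const r).mul ((hS.β.hasDerivAt_θ (u := u) hr hθ).const_mul 2).exp).add
    ((((hS.γ.hasDerivAt_θ (u := u) hr hθ).const_mul 2).exp.const_mul (r ^ 2)).mul
      ((hS.U.hasDerivAt_θ (u := u) hr hθ).pow 2))
  refine h.deriv.trans ?_
  simp only [BondiData.W, Pi.pow_apply]
  field_simp
  ring

theorem par_gur_u : par 0 (gur S) u r θ = -(2 * par 0 S.β u r θ * exp (2 * S.β u r θ)) :=
  ((hS.β.hasDerivAt_u (u := u) hr hθ).const_mul 2).exp.neg.deriv.trans (by ring)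

theorem par_gur_r : par 1 (gur S) u r θ = -(2 * par 1 S.β u r θ * exp (2 * S.β u r θ)) :=
  ((hS.β.hasDerivAt_r (u := u) hr hθ).const_mul 2).exp.neg.deriv.trans (by ring)

theorem par_gur_θ : par 2 (gur S) u r θ = -(2 * par 2 S.β u r θ * exp (2 * S.β u r θ)) :=
  ((hS.β.hasDerivAt_θ (u := u) hr hθ).const_mul 2).exp.neg.deriv.trans (by ring)

theorem par_gθθ_u : par 0 (gθθ S) u r θ =
    r ^ 2 * (2 * par 0 S.γ u r θ) * exp (2 * S.γ u r θ) :=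
  (((hS.γ.hasDerivAt_u (u := u) hr hθ).const_mul 2).exp.const_mul (r ^ 2)).deriv.trans (by ring)

theorem par_gθθ_r : par 1 (gθθ S) u r θ =
    (2 * r + r ^ 2 * (2 * par 1 S.γ u r θ)) * exp (2 * S.γ u r θ) :=
  (((hasDerivAt_id r).pow 2).mul
    ((hS.γ.hasDerivAt_r (u := u) hr hθ).const_mul 2).exp).deriv.trans (by
    simp only [Pi.pow_apply, id]; ring)

theorem par_gθθ_θ : par 2 (gθθ S) u r θ =
    r ^ 2 * (2 * par 2 S.γ u r θ) * exp (2 * S.γ u r θ) :=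
  (((hS.γ.hasDerivAt_θ (u := u) hr hθ).const_mul 2).exp.const_mul (r ^ 2)).deriv.trans (by ring)

theorem par_guθ_u : par 0 (guθ S) u r θ =
    -(r ^ 2 * exp (2 * S.γ u r θ) * (2 * par 0 S.γ u r θ * S.U u r θ + par 0 S.U u r θ)) :=
  ((((hS.γ.hasDerivAt_u (u := u) hr hθ).const_mul 2).exp.const_mul (r ^ 2)).mul
    (hS.U.hasDerivAt_u (u := u) hr hθ)).neg.deriv.trans (by ring)

theorem par_guθ_r : par 1 (guθ S) u r θ =
    -(exp (2 * S.γ u r θ) * (2 * r * S.U u r θ +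
      r ^ 2 * (2 * par 1 S.γ u r θ * S.U u r θ + par 1 S.U u r θ))) :=
  ((((hasDerivAt_id r).pow 2).mul ((hS.γ.hasDerivAt_r (u := u) hr hθ).const_mul 2).exp).mul
    (hS.U.hasDerivAt_r (u := u) hr hθ)).neg.deriv.trans (by
    simp only [Pi.pow_apply, Pi.mul_apply, id]; ring)

theorem par_guθ_θ : par 2 (guθ S) u r θ =
    -(r ^ 2 * exp (2 * S.γ u r θ) * (2 * par 2 S.γ u r θ * S.U u r θ + par 2 S.U u r θ)) :=
  ((((hS.γ.hasDerivAt_θ (u := u) hr hθ).const_mul 2).exp.const_mul (r ^ 2)).mul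
    (hS.U.hasDerivAt_θ (u := u) hr hθ)).neg.deriv.trans (by ring)

theorem par_gψψ_u : par 0 (gψψ S) u r θ =
    -(r ^ 2 * (2 * par 0 S.γ u r θ) * exp (-2 * S.γ u r θ) * sin θ ^ 2) :=
  ((((hS.γ.hasDerivAt_u (u := u) hr hθ).const_mul (-2)).exp.const_mul (r ^ 2)).mul_const
    (sin θ ^ 2)).deriv.trans (by ring)

theorem par_gψψ_r : par 1 (gψψ S) u r θ =
    (2 * r - r ^ 2 * (2 * par 1 S.γ u r θ)) * exp (-2 * S.γ u r θ) * sin θ ^ 2 :=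
  ((((hasDerivAt_id r).pow 2).mul
    ((hS.γ.hasDerivAt_r (u := u) hr hθ).const_mul (-2)).exp).mul_const
    (sin θ ^ 2)).deriv.trans (by
    simp only [Pi.pow_apply, id]; ring)

theorem par_gψψ_θ : par 2 (gψψ S) u r θ =
    r ^ 2 * exp (-2 * S.γ u r θ) * (2 * sin θ * cos θ - 2 * par 2 S.γ u r θ * sin θ ^ 2) :=
  ((((hS.γ.hasDerivAt_θ (u := u) hr hθ).const_mul (-2)).exp.const_mul (r ^ 2)).mul
    ((hasDerivAt_sin θ).pow 2)).deriv.trans (by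
    simp only [Pi.pow_apply]; ring)

end Derivatives

/-- The matrices `∂_i g` of the Bondi metric. -/
noncomputable def dMetric (S : BondiData) (u r θ : ℝ) : Fin 4 → Matrix (Fin 4) (Fin 4) ℝ :=
  let m (i : Fin 3) : Matrix (Fin 4) (Fin 4) ℝ :=
    !![par i (guu S) u r θ, par i (gur S) u r θ, par i (guθ S) u r θ, 0;
       par i (gur S) u r θ, 0, 0, 0;
       par i (guθ S) u r θ, 0, par i (gθθ S) u r θ, 0;
       0, 0, 0, par i (gψψ S) u r θ]
  ![m 0, m 1, m 2, 0]

theorem pd_bondiMetric (S : BondiData) (u r θ ψ : ℝ) (i j l : Fin 4) :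
    pd i (fun y => bondiMetric S y j l) ![u, r, θ, ψ] = dMetric S u r θ i j l := by
  have h : ∀ f : ℝ → ℝ → ℝ → ℝ, pd i (lift f) ![u, r, θ, ψ] =
      ![par 0 f u r θ, par 1 f u r θ, par 2 f u r θ, 0] i := by
    intro f
    fin_cases i
    · exact congrFun (pd_lift_u f) _
    · exact congrFun (pd_lift_r f) _
    · exact congrFun (pd_lift_θ f) _
    · exact congrFun (pd_lift_ψ f) _
  let z : ℝ → ℝ → ℝ → ℝ := fun _ _ _ => 0
  have hz : ∀ i, par i z u r θ = 0 := by
    intro i; fin_cases i <;> simp [par, z]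
  have e : (fun y => bondiMetric S y j l) = lift (![![guu S, gur S, guθ S, z],
      ![gur S, z, z, z], ![guθ S, z, gθθ S, z], ![z, z, z, gψψ S]] j l) := by
    funext y
    fin_cases j <;> fin_cases l <;> rfl
  rw [e, h]
  fin_cases j <;> fin_cases l <;> fin_cases i <;> first | rfl | exact hz 0 | exact hz 1 | exact hz 2

theorem dMetric_symm (S : BondiData) (u r θ : ℝ) (i j l : Fin 4) :
    dMetric S u r θ i j l = dMetric S u r θ i l j := by
  fin_cases i <;> fin_cases j <;> fin_cases l <;> rfl

set_option maxHeartbeats 1000000 in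
theorem christoffel_bondiMetric (hS : S.Regular r₀) (hr : r₀ < r) (hθ : θ ∈ Ioo 0 π) (ψ : ℝ)
    (k i j : Fin 4) :
    christoffel (bondiMetric S) k i j ![u, r, θ, ψ] = bondiΓ S u r θ k i j := by
  have hr0 : 0 < r := hS.nonneg.trans_lt hr
  have hr0' := hr0.ne'
  have hs : sin θ ≠ 0 := (sin_pos_of_pos_of_lt_pi hθ.1 hθ.2).ne'
  have hE := (exp_pos (2 * S.β u r θ)).ne'
  have hG := (exp_pos (2 * S.γ u r θ)).ne'
  have hV : S.V u r θ / r = S.W u r θ / r - 1 := by simp [BondiData.W]; field_simp; ring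
  simp only [christoffel, bondiMetric_inv S ψ hr0 hθ, pd_bondiMetric]
  have main : ∀ k i j : Fin 4, i ≤ j → 1 / 2 * ∑ l,
      (!![0, -(exp (2 * S.β u r θ))⁻¹, 0, 0;
         -(exp (2 * S.β u r θ))⁻¹, -(S.V u r θ / r * (exp (2 * S.β u r θ))⁻¹),
            -(S.U u r θ * (exp (2 * S.β u r θ))⁻¹), 0;
         0, -(S.U u r θ * (exp (2 * S.β u r θ))⁻¹), (r ^ 2 * exp (2 * S.γ u r θ))⁻¹, 0;
         0, 0, 0, exp (2 * S.γ u r θ) * (r ^ 2 * sin θ ^ 2)⁻¹] : Matrix (Fin 4) (Fin 4) ℝ) k l *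
      (dMetric S u r θ i j l + dMetric S u r θ j i l - dMetric S u r θ l i j) =
      bondiΓ S u r θ k i j := by
    simp only [dMetric, bondiΓ, Fin.sum_univ_four, hV,
        par_guu_u hS hr hθ, par_guu_r hS hr hθ, par_guu_θ hS hr hθ, par_gur_u hS hr hθ,
        par_gur_r hS hr hθ, par_gur_θ hS hr hθ, par_gθθ_u hS hr hθ, par_gθθ_r hS hr hθ,
        par_gθθ_θ hS hr hθ, par_guθ_u hS hr hθ, par_guθ_r hS hr hθ, par_guθ_θ hS hr hθ,
        par_gψψ_u hS hr hθ, par_gψψ_r hS hr hθ, par_gψψ_θ hS hr hθ, neg_mul, exp_neg]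
    generalize exp (2 * S.β u r θ) = E at *
    generalize exp (2 * S.γ u r θ) = G at *
    generalize sin θ = s at *
    generalize cos θ = c at *
    generalize S.U u r θ = U at *
    generalize S.W u r θ = W at *
    generalize par 0 S.β u r θ = β0
    generalize par 1 S.β u r θ = β1
    generalize par 2 S.β u r θ = β2
    generalize par 0 S.γ u r θ = γ0
    generalize par 1 S.γ u r θ = γ1
    generalize par 2 S.γ u r θ = γ2
    generalize par 0 S.U u r θ = U0
    generalize par 1 S.U u r θ = U1
    generalize par 2 S.U u r θ = U2
    generalize par 0 S.W u r θ = W0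
    generalize par 1 S.W u r θ = W1
    generalize par 2 S.W u r θ = W2
    clear hV hS hr hθ
    intro k i j hij
    fin_cases i <;> fin_cases j <;> first | exact absurd hij (by decide) | skip
    all_goals
      clear hij
      fin_cases k <;>
      simp only [Fin.zero_eta, Fin.mk_one, Fin.reduceFinMk, Fin.isValue, Matrix.of_apply,
        Matrix.cons_val', Matrix.cons_val_zero, Matrix.cons_val_one, Matrix.cons_val_fin_one,
        Matrix.cons_val, Matrix.zero_apply, zero_mul, mul_zero, add_zero, zero_add, sub_zero,
        sub_self] <;>
      (try field_simp) <;> (try ring)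
  rcases le_total i j with h | h
  · exact main k i j h
  · have e := main k j i h
    simp only [add_comm (dMetric S u r θ j i _)] at e
    rw [show bondiΓ S u r θ k i j = bondiΓ S u r θ k j i by
      fin_cases k <;> fin_cases i <;> fin_cases j <;> rfl, ← e]
    simp only [dMetric_symm S u r θ _ i j]

end

/-! ### The components `R_{rθ}` and `R_{uu}` -/

section

variable {S : BondiData} {r₀ u r θ : ℝ}

theorem pd_christoffel (hS : S.Regular r₀) (hr : r₀ < r) (hθ : θ ∈ Ioo 0 π) (ψ : ℝ)
    (m k i j : Fin 4) :
    pd m (christoffel (bondiMetric S) k i j) ![u, r, θ, ψ] =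
      ![par 0 (fun u r θ => bondiΓ S u r θ k i j) u r θ,
        par 1 (fun u r θ => bondiΓ S u r θ k i j) u r θ,
        par 2 (fun u r θ => bondiΓ S u r θ k i j) u r θ, 0] m := by
  fin_cases m
  · simp only [pd, par, Fin.zero_eta, update_u]
    exact congrArg (fun F => deriv F u)
      (funext fun s => christoffel_bondiMetric hS hr hθ ψ k i j)
  · simp only [pd, par, Fin.mk_one, update_r]
    exact Filter.EventuallyEq.deriv_eq ((eventually_gt_nhds hr).mono fun s hs =>
      christoffel_bondiMetric hS hs hθ ψ k i j)
  · simp only [pd, par, Fin.reduceFinMk, update_θ]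
    exact Filter.EventuallyEq.deriv_eq (Filter.mem_of_superset (Ioo_mem_nhds hθ.1 hθ.2)
      fun s hs => christoffel_bondiMetric hS hr hs ψ k i j)
  · simp only [pd, Fin.reduceFinMk, update_ψ]
    rw [funext fun s => christoffel_bondiMetric hS hr hθ s k i j]
    simp

/-- Only the derivatives of `U` occur here, and `W` drops out, so that this component is a linear
relation between `U` and `γ` at leading order. -/
theorem ricci_rθ (hS : S.Regular r₀) (hr : r₀ < r) (hθ : θ ∈ Ioo 0 π) (ψ : ℝ) :
    ricci (bondiMetric S) 1 2 ![u, r, θ, ψ] =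
      (exp (2 * S.β u r θ))⁻¹ * exp (2 * S.γ u r θ) * (r ^ 2 * par 1 (par 1 S.U) u r θ / 2 +
        par 1 S.U u r θ * (r ^ 2 * (par 1 S.γ u r θ - par 1 S.β u r θ) + 2 * r)) -
      par 2 (par 1 S.β) u r θ + 2 * par 2 S.β u r θ / r +
      2 * (cos θ / sin θ) * par 1 S.γ u r θ - 2 * par 1 S.γ u r θ * par 2 S.γ u r θ +
      par 2 (par 1 S.γ) u r θ := by
  have hr0 : 0 < r := hS.nonneg.trans_lt hr
  have hs : sin θ ≠ 0 := (sin_pos_of_pos_of_lt_pi hθ.1 hθ.2).ne'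
  have hE := (exp_pos (2 * S.β u r θ)).ne'
  have hG := (exp_pos (2 * S.γ u r θ)).ne'
  have d112 : par 1 (fun u r θ => bondiΓ S u r θ 1 1 2) u r θ =
      (exp (2 * S.β u r θ))⁻¹ * exp (2 * S.γ u r θ) * (r ^ 2 * par 1 (par 1 S.U) u r θ / 2 +
        r * par 1 S.U u r θ + r ^ 2 * par 1 S.U u r θ * (par 1 S.γ u r θ - par 1 S.β u r θ)) +
      par 2 (par 1 S.β) u r θ := by
    rw [hS.β.par_comm 2 1 hr hθ]
    have h := ((((((hS.β.hasDerivAt_r (u := u) hr hθ).const_mul 2).exp.fun_inv hE).mul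
      ((hS.γ.hasDerivAt_r (u := u) hr hθ).const_mul 2).exp).mul ((hasDerivAt_id r).pow 2)).mul
      ((hS.U.par 1).hasDerivAt_r (u := u) hr hθ)).div_const 2 |>.add
      ((hS.β.par 2).hasDerivAt_r (u := u) hr hθ)
    refine h.deriv.trans ?_
    simp only [Pi.mul_apply, Pi.pow_apply, id]
    field_simp
    ring
  have d111 : par 2 (fun u r θ => bondiΓ S u r θ 1 1 1) u r θ = 2 * par 2 (par 1 S.β) u r θ :=
    (((hS.β.par 1).hasDerivAt_θ (u := u) hr hθ).const_mul 2).deriv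
  have d313 : par 2 (fun u r θ => bondiΓ S u r θ 3 1 3) u r θ = -par 2 (par 1 S.γ) u r θ :=
    (((hS.γ.par 1).hasDerivAt_θ (u := u) hr hθ).const_sub (1 / r)).deriv
  have d012 : par 0 (fun u r θ => bondiΓ S u r θ 0 1 2) u r θ = 0 := deriv_const _ _
  have d010 : par 2 (fun u r θ => bondiΓ S u r θ 0 1 0) u r θ = 0 := deriv_const _ _
  simp only [ricci, pd_christoffel hS hr hθ, christoffel_bondiMetric hS hr hθ,
    Fin.sum_univ_four, Matrix.cons_val_zero, Matrix.cons_val_one, Matrix.cons_val, d112, d111,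
    d313, d012, d010]
  simp only [bondiΓ, Matrix.of_apply, Matrix.cons_val',
    Matrix.cons_val_zero, Matrix.cons_val_one, Matrix.cons_val_fin_one,
    Matrix.cons_val, zero_mul, mul_zero, add_zero, zero_add, sub_zero, sub_self]
  field_simp
  ring

/-- The derivatives of the Christoffel symbols are left unexpanded; the traces
`Γ^k_{kl} = ∂_l log √|g|` are explicit. -/
theorem ricci_uu (hS : S.Regular r₀) (hr : r₀ < r) (hθ : θ ∈ Ioo 0 π) (ψ : ℝ) :
    ricci (bondiMetric S) 0 0 ![u, r, θ, ψ] =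
      par 1 (fun u r θ => bondiΓ S u r θ 1 0 0) u r θ +
      par 2 (fun u r θ => bondiΓ S u r θ 2 0 0) u r θ -
      par 0 (fun u r θ => bondiΓ S u r θ 1 0 1) u r θ -
      (par 0 (fun u r θ => bondiΓ S u r θ 2 0 2) u r θ +
        par 0 (fun u r θ => bondiΓ S u r θ 3 0 3) u r θ) +
      (2 * par 0 S.β u r θ * bondiΓ S u r θ 0 0 0 +
        (2 * par 1 S.β u r θ + 2 / r) * bondiΓ S u r θ 1 0 0 +
        (2 * par 2 S.β u r θ + cos θ / sin θ) * bondiΓ S u r θ 2 0 0) -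
      (bondiΓ S u r θ 0 0 0 ^ 2 + bondiΓ S u r θ 1 0 1 ^ 2 + bondiΓ S u r θ 2 0 2 ^ 2 +
        par 0 S.γ u r θ ^ 2 + 2 * bondiΓ S u r θ 0 0 2 * bondiΓ S u r θ 2 0 0 +
        2 * bondiΓ S u r θ 1 0 2 * bondiΓ S u r θ 2 0 1) := by
  have hr0 : r ≠ 0 := (hS.nonneg.trans_lt hr).ne'
  have hs : sin θ ≠ 0 := (sin_pos_of_pos_of_lt_pi hθ.1 hθ.2).ne'
  simp only [ricci, pd_christoffel hS hr hθ, christoffel_bondiMetric hS hr hθ,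
    Fin.sum_univ_four, Matrix.cons_val_zero, Matrix.cons_val_one, Matrix.cons_val]
  have d3 : bondiΓ S u r θ 3 0 0 = 0 := rfl
  have t0 : bondiΓ S u r θ 0 0 0 + bondiΓ S u r θ 1 1 0 + bondiΓ S u r θ 2 2 0 +
      bondiΓ S u r θ 3 3 0 = 2 * par 0 S.β u r θ := by
    simp only [bondiΓ, Matrix.of_apply, Matrix.cons_val',
      Matrix.cons_val_zero, Matrix.cons_val_one, Matrix.cons_val_fin_one,
      Matrix.cons_val]
    field_simp
    ring
  have t1 : bondiΓ S u r θ 0 0 1 + bondiΓ S u r θ 1 1 1 + bondiΓ S u r θ 2 2 1 +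
      bondiΓ S u r θ 3 3 1 = 2 * par 1 S.β u r θ + 2 / r := by
    simp only [bondiΓ, Matrix.of_apply, Matrix.cons_val',
      Matrix.cons_val_zero, Matrix.cons_val_one, Matrix.cons_val_fin_one,
      Matrix.cons_val]
    field_simp
    ring
  have t2 : bondiΓ S u r θ 0 0 2 + bondiΓ S u r θ 1 1 2 + bondiΓ S u r θ 2 2 2 +
      bondiΓ S u r θ 3 3 2 = 2 * par 2 S.β u r θ + cos θ / sin θ := by
    simp only [bondiΓ, Matrix.of_apply, Matrix.cons_val',
      Matrix.cons_val_zero, Matrix.cons_val_one, Matrix.cons_val_fin_one,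
      Matrix.cons_val]
    field_simp
    ring
  -- Replace the explicit traces by the sums over Christoffel symbols occurring in `ricci`.
  rw [← t0, ← t1, ← t2]
  have z1 : bondiΓ S u r θ 0 0 1 = 0 := rfl
  have z2 : bondiΓ S u r θ 0 0 3 = 0 := rfl
  have z3 : bondiΓ S u r θ 1 0 3 = 0 := rfl
  have z4 : bondiΓ S u r θ 2 0 3 = 0 := rfl
  have z5 : bondiΓ S u r θ 3 0 1 = 0 := rfl
  have z6 : bondiΓ S u r θ 3 0 2 = 0 := rfl
  have e3 : bondiΓ S u r θ 3 0 3 = -par 0 S.γ u r θ := rfl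
  rw [z1, z2, z3, z4, z5, z6, e3, d3]
  ring

end

/-! ### Leading behaviour along a ray -/

section

/-- `F = L(u, θ) r⁻ᵏ + o(r⁻ᵏ)` as `r → ∞` at a fixed `(u, θ)`, where the expansion may be
differentiated once; `Lu` and `Lθ` are the derivatives of `L`. -/
structure Asym (u θ : ℝ) (F : ℝ → ℝ → ℝ → ℝ) (k : ℤ) (L Lu Lθ : ℝ) : Prop where
  diff_u : ∀ᶠ r in atTop, DifferentiableAt ℝ (fun s => F s r θ) u
  diff_r : ∀ᶠ r in atTop, DifferentiableAt ℝ (fun s => F u s θ) r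
  diff_θ : ∀ᶠ r in atTop, DifferentiableAt ℝ (fun s => F u r s) θ
  lim : Tendsto (fun r => r ^ k * F u r θ) atTop (𝓝 L)
  lim_u : Tendsto (fun r => r ^ k * par 0 F u r θ) atTop (𝓝 Lu)
  lim_r : Tendsto (fun r => r ^ (k + 1) * par 1 F u r θ) atTop (𝓝 (-k * L))
  lim_θ : Tendsto (fun r => r ^ k * par 2 F u r θ) atTop (𝓝 Lθ)

/-- An `Asym` with unspecified leading coefficient. -/
def Homog (u θ : ℝ) (F : ℝ → ℝ → ℝ → ℝ) (k : ℤ) : Prop := ∃ L Lu Lθ, Asym u θ F k L Lu Lθ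

variable {u θ : ℝ} {F G : ℝ → ℝ → ℝ → ℝ} {k l : ℤ} {L Lu Lθ L' Lu' Lθ' : ℝ}

theorem Asym.homog (h : Asym u θ F k L Lu Lθ) : Homog u θ F k := ⟨L, Lu, Lθ, h⟩

theorem Asym.cast (h : Asym u θ F k L Lu Lθ) (e : L = L') (eu : Lu = Lu') (eθ : Lθ = Lθ') :
    Asym u θ F k L' Lu' Lθ' := by subst e eu eθ; exact h

theorem Homog.cast (h : Homog u θ F k) (e : k = l) : Homog u θ F l := e ▸ h

theorem Asym.mul (hF : Asym u θ F k L Lu Lθ) (hG : Asym u θ G l L' Lu' Lθ') :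
    Asym u θ (fun u r θ => F u r θ * G u r θ) (k + l) (L * L') (Lu * L' + L * Lu')
      (Lθ * L' + L * Lθ') where
  diff_u := (hF.diff_u.and hG.diff_u).mono fun _ h => h.1.mul h.2
  diff_r := (hF.diff_r.and hG.diff_r).mono fun _ h => h.1.mul h.2
  diff_θ := (hF.diff_θ.and hG.diff_θ).mono fun _ h => h.1.mul h.2
  lim := by
    refine (hF.lim.mul hG.lim).congr' ?_
    filter_upwards [eventually_ne_atTop 0] with r hr
    rw [zpow_add₀ hr]; ring
  lim_u := by
    refine ((hF.lim_u.mul hG.lim).add (hF.lim.mul hG.lim_u)).congr' ?_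
    filter_upwards [eventually_ne_atTop 0, hF.diff_u, hG.diff_u] with r hr h1 h2
    rw [show par 0 (fun u r θ => F u r θ * G u r θ) u r θ =
      par 0 F u r θ * G u r θ + F u r θ * par 0 G u r θ from deriv_fun_mul h1 h2, zpow_add₀ hr]
    ring
  lim_r := by
    have := (hF.lim_r.mul hG.lim).add (hF.lim.mul hG.lim_r)
    refine (this.congr' ?_).trans (le_of_eq ?_)
    · filter_upwards [eventually_ne_atTop 0, hF.diff_r, hG.diff_r] with r hr h1 h2
      rw [show par 1 (fun u r θ => F u r θ * G u r θ) u r θ =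
        par 1 F u r θ * G u r θ + F u r θ * par 1 G u r θ from deriv_fun_mul h1 h2,
        zpow_add₀ hr, zpow_add₀ hr, zpow_add₀ hr, zpow_add₀ hr]
      ring
    · congr 1; push_cast; ring
  lim_θ := by
    refine ((hF.lim_θ.mul hG.lim).add (hF.lim.mul hG.lim_θ)).congr' ?_
    filter_upwards [eventually_ne_atTop 0, hF.diff_θ, hG.diff_θ] with r hr h1 h2
    rw [show par 2 (fun u r θ => F u r θ * G u r θ) u r θ =
      par 2 F u r θ * G u r θ + F u r θ * par 2 G u r θ from deriv_fun_mul h1 h2, zpow_add₀ hr]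
    ring

theorem Asym.add (hF : Asym u θ F k L Lu Lθ) (hG : Asym u θ G k L' Lu' Lθ') :
    Asym u θ (fun u r θ => F u r θ + G u r θ) k (L + L') (Lu + Lu') (Lθ + Lθ') where
  diff_u := (hF.diff_u.and hG.diff_u).mono fun _ h => h.1.add h.2
  diff_r := (hF.diff_r.and hG.diff_r).mono fun _ h => h.1.add h.2
  diff_θ := (hF.diff_θ.and hG.diff_θ).mono fun _ h => h.1.add h.2
  lim := (hF.lim.add hG.lim).congr fun _ => by ring
  lim_u := by
    refine (hF.lim_u.add hG.lim_u).congr' ?_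
    filter_upwards [hF.diff_u, hG.diff_u] with r h1 h2
    rw [show par 0 (fun u r θ => F u r θ + G u r θ) u r θ =
      par 0 F u r θ + par 0 G u r θ from deriv_fun_add h1 h2]
    ring
  lim_r := by
    rw [mul_add]
    refine (hF.lim_r.add hG.lim_r).congr' ?_
    filter_upwards [hF.diff_r, hG.diff_r] with r h1 h2
    rw [show par 1 (fun u r θ => F u r θ + G u r θ) u r θ =
      par 1 F u r θ + par 1 G u r θ from deriv_fun_add h1 h2]
    ring
  lim_θ := by
    refine (hF.lim_θ.add hG.lim_θ).congr' ?_
    filter_upwards [hF.diff_θ, hG.diff_θ] with r h1 h2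
    rw [show par 2 (fun u r θ => F u r θ + G u r θ) u r θ =
      par 2 F u r θ + par 2 G u r θ from deriv_fun_add h1 h2]
    ring

theorem tendsto_zpow_neg {n : ℤ} (hn : n < 0) : Tendsto (fun r : ℝ => r ^ n) atTop (𝓝 0) := by
  obtain ⟨m, rfl⟩ : ∃ m : ℕ, n = -((m + 1 : ℕ) : ℤ) := ⟨(-n - 1).toNat, by omega⟩
  simp only [zpow_neg, zpow_natCast]
  exact (tendsto_pow_atTop (Nat.succ_ne_zero m)).inv_tendsto_atTop

theorem Asym.weaken (h : Asym u θ F k L Lu Lθ) (hl : l < k) : Asym u θ F l 0 0 0 := by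
  have key : ∀ {φ : ℝ → ℝ} {m n : ℤ} {c : ℝ}, n < m →
      Tendsto (fun r => r ^ m * φ r) atTop (𝓝 c) → Tendsto (fun r => r ^ n * φ r) atTop (𝓝 0) := by
    intro φ m n c hmn ht
    have := (tendsto_zpow_neg (sub_neg.2 hmn)).mul ht
    rw [zero_mul] at this
    refine this.congr' ?_
    filter_upwards [eventually_ne_atTop 0] with r hr
    rw [← mul_assoc, ← zpow_add₀ hr, sub_add_cancel]
  exact ⟨h.diff_u, h.diff_r, h.diff_θ, key hl h.lim, key hl h.lim_u,
    by simpa using key (by omega) h.lim_r, key hl h.lim_θ⟩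

theorem asym_const (c : ℝ) : Asym u θ (fun _ _ _ => c) 0 c 0 0 where
  diff_u := Eventually.of_forall fun _ => differentiableAt_const _
  diff_r := Eventually.of_forall fun _ => differentiableAt_const _
  diff_θ := Eventually.of_forall fun _ => differentiableAt_const _
  lim := by simp
  lim_u := by simp [par]
  lim_r := by simp [par]
  lim_θ := by simp [par]

theorem asym_zpow (n : ℤ) : Asym u θ (fun _ r _ => r ^ n) (-n) 1 0 0 where
  diff_u := Eventually.of_forall fun _ => differentiableAt_const _
  diff_r := (eventually_ne_atTop 0).mono fun r hr => differentiableAt_zpow.2 (Or.inl hr)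
  diff_θ := Eventually.of_forall fun _ => differentiableAt_const _
  lim := by
    refine tendsto_const_nhds.congr' ?_
    filter_upwards [eventually_ne_atTop 0] with r hr
    rw [← zpow_add₀ hr]; simp
  lim_u := by simp [par]
  lim_r := by
    refine tendsto_const_nhds.congr' ?_
    filter_upwards [eventually_ne_atTop 0] with r hr
    simp only [par, deriv_zpow]
    rw [mul_left_comm, ← zpow_add₀ hr]; simp
  lim_θ := by simp [par]

theorem asym_pow (n : ℕ) : Asym u θ (fun _ r _ => r ^ n) (-n) 1 0 0 := by
  simpa using asym_zpow (u := u) (θ := θ) n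

theorem asym_inv : Asym u θ (fun _ r _ => r⁻¹) 1 1 0 0 := by
  simpa using asym_zpow (u := u) (θ := θ) (-1)

theorem Asym.const_mul (c : ℝ) (h : Asym u θ F k L Lu Lθ) :
    Asym u θ (fun u r θ => c * F u r θ) k (c * L) (c * Lu) (c * Lθ) := by
  have := (asym_const (u := u) (θ := θ) c).mul h
  rw [zero_add] at this
  exact this.cast rfl (by ring) (by ring)

theorem Asym.neg (h : Asym u θ F k L Lu Lθ) :
    Asym u θ (fun u r θ => -F u r θ) k (-L) (-Lu) (-Lθ) := by
  simpa using h.const_mul (-1)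

theorem Asym.sub (hF : Asym u θ F k L Lu Lθ) (hG : Asym u θ G k L' Lu' Lθ') :
    Asym u θ (fun u r θ => F u r θ - G u r θ) k (L - L') (Lu - Lu') (Lθ - Lθ') := by
  simpa only [sub_eq_add_neg] using hF.add hG.neg

theorem Asym.div_const (h : Asym u θ F k L Lu Lθ) (c : ℝ) :
    Asym u θ (fun u r θ => F u r θ / c) k (L / c) (Lu / c) (Lθ / c) := by
  simpa only [div_eq_inv_mul] using h.const_mul c⁻¹

theorem Asym.div_r (h : Asym u θ F k L Lu Lθ) :
    Asym u θ (fun u r θ => F u r θ / r) (k + 1) L Lu Lθ := by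
  have := h.mul asym_inv
  simpa [div_eq_mul_inv] using this

/-- `e^{a F} → 1` when `F` decays. -/
theorem Asym.exp (h : Asym u θ F k L Lu Lθ) (hk : 0 < k) (a : ℝ) :
    Asym u θ (fun u r θ => Real.exp (a * F u r θ)) 0 1 0 0 := by
  have h0 := h.weaken hk
  have hl : Tendsto (fun r => Real.exp (a * F u r θ)) atTop (𝓝 1) := by
    have : Tendsto (fun r => a * F u r θ) atTop (𝓝 0) := by simpa using h0.lim.const_mul a
    simpa [Function.comp_def] using (continuous_exp.tendsto 0).comp this
  refine ⟨h.diff_u.mono fun r h => (h.const_mul a).exp,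
    h.diff_r.mono fun r h => (h.const_mul a).exp, h.diff_θ.mono fun r h => (h.const_mul a).exp,
    by simpa using hl, ?_, ?_, ?_⟩
  · have := (h0.lim_u.const_mul a).mul hl
    rw [mul_zero, zero_mul] at this
    refine this.congr' ?_
    filter_upwards [h.diff_u] with r hd
    rw [show par 0 (fun u r θ => Real.exp (a * F u r θ)) u r θ =
      Real.exp (a * F u r θ) * (a * par 0 F u r θ) from (hd.hasDerivAt.const_mul a).exp.deriv]
    ring
  · have := (h0.lim_r.const_mul a).mul hl
    simp only [mul_zero, zero_mul] at this
    simp only [Int.cast_zero, neg_zero, zero_mul]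
    refine this.congr' ?_
    filter_upwards [h.diff_r] with r hd
    rw [show par 1 (fun u r θ => Real.exp (a * F u r θ)) u r θ =
      Real.exp (a * F u r θ) * (a * par 1 F u r θ) from (hd.hasDerivAt.const_mul a).exp.deriv]
    ring
  · have := (h0.lim_θ.const_mul a).mul hl
    rw [mul_zero, zero_mul] at this
    refine this.congr' ?_
    filter_upwards [h.diff_θ] with r hd
    rw [show par 2 (fun u r θ => Real.exp (a * F u r θ)) u r θ =
      Real.exp (a * F u r θ) * (a * par 2 F u r θ) from (hd.hasDerivAt.const_mul a).exp.deriv]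
    ring

theorem Homog.mul (hF : Homog u θ F k) (hG : Homog u θ G l) :
    Homog u θ (fun u r θ => F u r θ * G u r θ) (k + l) := by
  obtain ⟨_, _, _, h⟩ := hF; obtain ⟨_, _, _, h'⟩ := hG; exact (h.mul h').homog

theorem Homog.weaken (hF : Homog u θ F k) (hl : l ≤ k) : Homog u θ F l := by
  obtain ⟨_, _, _, h⟩ := hF
  rcases hl.eq_or_lt with rfl | hl
  · exact h.homog
  · exact (h.weaken hl).homog

/-- Sum of two terms, at the slower of the two rates. -/
theorem Homog.add (hF : Homog u θ F k) (hG : Homog u θ G l) :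
    Homog u θ (fun u r θ => F u r θ + G u r θ) (min k l) := by
  obtain ⟨_, _, _, h⟩ := hF.weaken (min_le_left k l)
  obtain ⟨_, _, _, h'⟩ := hG.weaken (min_le_right k l)
  exact (h.add h').homog

theorem Homog.sub (hF : Homog u θ F k) (hG : Homog u θ G l) :
    Homog u θ (fun u r θ => F u r θ - G u r θ) (min k l) := by
  obtain ⟨_, _, _, h⟩ := hF.weaken (min_le_left k l)
  obtain ⟨_, _, _, h'⟩ := hG.weaken (min_le_right k l)
  exact (h.sub h').homog

theorem Homog.neg (hF : Homog u θ F k) : Homog u θ (fun u r θ => -F u r θ) k := by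
  obtain ⟨_, _, _, h⟩ := hF; exact h.neg.homog

theorem Homog.const_mul (c : ℝ) (hF : Homog u θ F k) :
    Homog u θ (fun u r θ => c * F u r θ) k := by
  obtain ⟨_, _, _, h⟩ := hF; exact (h.const_mul c).homog

theorem Homog.div_const (hF : Homog u θ F k) (c : ℝ) :
    Homog u θ (fun u r θ => F u r θ / c) k := by
  obtain ⟨_, _, _, h⟩ := hF; exact (h.div_const c).homog

theorem Homog.div_r (hF : Homog u θ F k) : Homog u θ (fun u r θ => F u r θ / r) (k + 1) := by
  obtain ⟨_, _, _, h⟩ := hF; exact h.div_r.homog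

theorem Homog.sq (hF : Homog u θ F k) : Homog u θ (fun u r θ => F u r θ ^ 2) (k + k) := by
  simpa only [pow_two] using hF.mul hF

/-- Addition of a term of faster decay. -/
theorem Asym.add_homog (hF : Asym u θ F k L Lu Lθ) (hG : Homog u θ G l) (hl : k < l) :
    Asym u θ (fun u r θ => F u r θ + G u r θ) k L Lu Lθ := by
  obtain ⟨_, _, _, h⟩ := hG
  simpa using hF.add (h.weaken hl)

/-- The expansions of `f` and its first derivatives at a fixed `(u, θ)`. -/
structure JetAsym (u θ : ℝ) (f : ℝ → ℝ → ℝ → ℝ) (p : ℕ) (a : ℝ → ℝ → ℝ) : Prop where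
  f0 : Asym u θ f p (a u θ) (cjet 1 0 a u θ) (cjet 0 1 a u θ)
  fu : Asym u θ (par 0 f) p (cjet 1 0 a u θ) (cjet 2 0 a u θ) (cjet 1 1 a u θ)
  fr : Asym u θ (par 1 f) (p + 1) (-p * a u θ) (-p * cjet 1 0 a u θ) (-p * cjet 0 1 a u θ)
  fθ : Asym u θ (par 2 f) p (cjet 0 1 a u θ) (cjet 1 1 a u θ) (cjet 0 2 a u θ)

/-- An expansion which is uniform as `u → -∞` holds along each ray with `u` small enough. -/
theorem LeadingTerm.jetAsym {f : ℝ → ℝ → ℝ → ℝ} {p : ℕ} {a : ℝ → ℝ → ℝ} {r₀ : ℝ}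
    (h : LeadingTerm f p a) (hf : Smth r₀ f) :
    ∀ᶠ u in atBot, ∀ θ ∈ Ioo 0 π, JetAsym u θ f p a := by
  obtain ⟨K, hK⟩ := h
  filter_upwards [hK.curry] with u hu θ hθ
  have lim : ∀ i j l : ℕ, i + j + l ≤ 2 → Tendsto (fun r => r ^ (p + j) * jet i j l f u r θ)
      atTop (𝓝 (fallingFactor (-p) j * cjet i l a u θ)) := by
    intro i j l hijl
    rw [tendsto_iff_norm_sub_tendsto_zero]
    refine squeeze_zero' (Eventually.of_forall fun _ => norm_nonneg _)
      (hu.mono fun r hr => (hr θ hθ i j l hijl).2) (tendsto_const_nhds.div_atTop tendsto_id)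
  have ff0 : fallingFactor (-p) 0 = 1 := by simp [fallingFactor]
  have ff1 : fallingFactor (-p) 1 = -p := by simp [fallingFactor]
  have ff2 : fallingFactor (-p) 2 = -(p + 1) * (-p) := by
    simp [fallingFactor, Finset.prod_range_succ]; ring
  have hgt := eventually_gt_atTop r₀
  have du : ∀ {g}, Smth r₀ g → ∀ᶠ r in atTop, DifferentiableAt ℝ (fun s => g s r θ) u :=
    fun hg => hgt.mono fun r hr => (hg.hasDerivAt_u hr hθ).differentiableAt
  have dr : ∀ {g}, Smth r₀ g → ∀ᶠ r in atTop, DifferentiableAt ℝ (fun s => g u s θ) r :=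
    fun hg => hgt.mono fun r hr => (hg.hasDerivAt_r hr hθ).differentiableAt
  have dθ : ∀ {g}, Smth r₀ g → ∀ᶠ r in atTop, DifferentiableAt ℝ (fun s => g u r s) θ :=
    fun hg => hgt.mono fun r hr => (hg.hasDerivAt_θ hr hθ).differentiableAt
  have l0 : ∀ i l, i + l ≤ 2 → Tendsto (fun r => r ^ (p : ℤ) * jet i 0 l f u r θ)
      atTop (𝓝 (cjet i l a u θ)) := by
    intro i l hil
    simpa [ff0] using lim i 0 l (by omega)
  have l1 : ∀ i l, i + l ≤ 1 → Tendsto (fun r => r ^ ((p : ℤ) + 1) * jet i 1 l f u r θ)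
      atTop (𝓝 (-p * cjet i l a u θ)) := by
    intro i l hil
    have := lim i 1 l (by omega)
    rw [ff1] at this
    exact_mod_cast this
  have l2 : Tendsto (fun r => r ^ ((p : ℤ) + 1 + 1) * jet 0 2 0 f u r θ)
      atTop (𝓝 (-(p + 1) * (-p * a u θ))) := by
    have := lim 0 2 0 (by omega)
    rw [ff2, mul_assoc] at this
    exact_mod_cast this
  refine ⟨⟨du hf, dr hf, dθ hf, l0 0 0 (by omega), l0 1 0 (by omega), ?_, l0 0 1 (by omega)⟩,
    ⟨du (hf.par 0), dr (hf.par 0), dθ (hf.par 0), l0 1 0 (by omega), l0 2 0 (by omega), ?_, ?_⟩,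
    ⟨du (hf.par 1), dr (hf.par 1), dθ (hf.par 1), l1 0 0 (by omega), l1 1 0 (by omega), ?_, ?_⟩,
    ⟨du (hf.par 2), dr (hf.par 2), dθ (hf.par 2), l0 0 1 (by omega), l0 1 1 (by omega), ?_,
      l0 0 2 (by omega)⟩⟩
  · exact (l1 0 0 (by omega)).trans (by simp [cjet])
  · exact ((l1 1 0 (by omega)).congr' (hgt.mono fun r hr =>
      congrArg _ (hf.par_comm 0 1 hr hθ))).trans (by simp)
  · exact (l0 1 1 (by omega)).congr' (hgt.mono fun r hr =>
      congrArg _ (hf.par_comm 0 2 hr hθ))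
  · refine l2.trans (by simp)
  · exact (l1 0 1 (by omega)).congr' (hgt.mono fun r hr =>
      congrArg _ (hf.par_comm 1 2 hr hθ))
  · refine (l1 0 1 (by omega)).trans (by simp)

end

/-! ### Consequences of the vacuum equations -/

section

variable {S : BondiData} {r₀ u θ : ℝ} {F G : ℝ → ℝ → ℝ → ℝ} {k l : ℤ} {L Lu Lθ : ℝ}

theorem Asym.div_two_r (h : Asym u θ F k L Lu Lθ) :
    Asym u θ (fun u r θ => F u r θ / (2 * r)) (k + 1) (L / 2) (Lu / 2) (Lθ / 2) := by
  simpa only [div_div] using (h.div_const 2).div_r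

theorem Homog.div_two_r (h : Homog u θ F k) :
    Homog u θ (fun u r θ => F u r θ / (2 * r)) (k + 1) := by
  obtain ⟨_, _, _, h⟩ := h; exact h.div_two_r.homog

theorem Homog.add_asym (hG : Homog u θ G l) (hF : Asym u θ F k L Lu Lθ) (hl : k < l) :
    Asym u θ (fun u r θ => G u r θ + F u r θ) k L Lu Lθ := by
  simpa only [add_comm] using hF.add_homog hG hl

theorem Homog.sub_asym (hG : Homog u θ G l) (hF : Asym u θ F k L Lu Lθ) (hl : k < l) :
    Asym u θ (fun u r θ => G u r θ - F u r θ) k (-L) (-Lu) (-Lθ) := by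
  simpa only [sub_eq_add_neg] using hG.add_asym hF.neg hl

theorem Homog.tendsto_zero (h : Homog u θ F k) {n : ℕ} (hn : (n : ℤ) < k) :
    Tendsto (fun r => r ^ n * F u r θ) atTop (𝓝 0) := by
  obtain ⟨_, _, _, h⟩ := h
  simpa using (h.weaken hn).lim

theorem homog_r : Homog u θ (fun _ r _ => r) (-1) := by
  simpa using (asym_pow (u := u) (θ := θ) 1).homog

theorem homog_r_sq : Homog u θ (fun _ r _ => r ^ 2) (-2) := by
  simpa using (asym_pow (u := u) (θ := θ) 2).homog

/-- The four metric functions at a fixed `(u, θ)`, with `c`, `b`, `U₂`, `m` the leading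
coefficients of `γ`, `β`, `U`, `V + r`. -/
structure BondiData.Expansion (S : BondiData) (c b U₂ m : ℝ → ℝ → ℝ) (u θ : ℝ) : Prop where
  γ : JetAsym u θ S.γ 1 c
  β : JetAsym u θ S.β 2 b
  U : JetAsym u θ S.U 2 U₂
  W : JetAsym u θ S.W 0 m

variable {c b U₂ m : ℝ → ℝ → ℝ}

/-- The equation `R_{rθ} = 0` at order `r⁻²`. -/
theorem vacuum_rθ (hS : S.Regular r₀) (hvac : S.IsVacuum r₀) (h : S.Expansion c b U₂ m u θ)
    (hθ : θ ∈ Ioo 0 π) :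
    U₂ u θ + cjet 0 1 c u θ + 2 * (cos θ / sin θ) * c u θ = 0 := by
  have hE : Tendsto (fun r => exp (2 * S.β u r θ)) atTop (𝓝 1) := by
    simpa using (h.β.f0.exp (by norm_num) 2).lim
  have hG : Tendsto (fun r => exp (2 * S.γ u r θ)) atTop (𝓝 1) := by
    simpa using (h.γ.f0.exp (by norm_num) 2).lim
  have hi : Tendsto (fun r : ℝ => r⁻¹) atTop (𝓝 0) := tendsto_inv_atTop_zero
  have U11 : Tendsto (fun r => r ^ 4 * par 1 (par 1 S.U) u r θ) atTop (𝓝 (6 * U₂ u θ)) := by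
    refine h.U.fr.lim_r.trans (le_of_eq ?_); congr 1; push_cast; ring
  have U1 : Tendsto (fun r => r ^ 3 * par 1 S.U u r θ) atTop (𝓝 (-2 * U₂ u θ)) :=
    h.U.fr.lim
  have γ1 : Tendsto (fun r => r ^ 2 * par 1 S.γ u r θ) atTop (𝓝 (-c u θ)) := by
    refine h.γ.fr.lim.trans (le_of_eq ?_); congr 1; push_cast; ring
  have γ2 : Tendsto (fun r => r ^ 1 * par 2 S.γ u r θ) atTop (𝓝 (cjet 0 1 c u θ)) :=
    h.γ.fθ.lim
  have γ12 : Tendsto (fun r => r ^ 2 * par 2 (par 1 S.γ) u r θ) atTop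
      (𝓝 (-cjet 0 1 c u θ)) := by
    refine h.γ.fr.lim_θ.trans (le_of_eq ?_); congr 1; push_cast; ring
  have β1 : Tendsto (fun r => r ^ 3 * par 1 S.β u r θ) atTop (𝓝 (-2 * b u θ)) :=
    h.β.fr.lim
  have β2 : Tendsto (fun r => r ^ 2 * par 2 S.β u r θ) atTop (𝓝 (cjet 0 1 b u θ)) :=
    h.β.fθ.lim
  have β12 : Tendsto (fun r => r ^ 3 * par 2 (par 1 S.β) u r θ) atTop
      (𝓝 (-2 * cjet 0 1 b u θ)) := h.β.fr.lim_θ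
  have key := ((((((hE.inv₀ one_ne_zero).mul hG).mul ((U11.div_const 2).add (U1.mul
    (((γ1.mul hi).sub (β1.mul (hi.pow 2))).add_const 2)))).sub (β12.mul hi)).add
    ((β2.const_mul 2).mul hi)).add (γ1.const_mul (2 * (cos θ / sin θ)))).sub
    (((γ1.const_mul 2).mul γ2).mul hi) |>.add γ12
  have zero : Tendsto (fun _ : ℝ => (0 : ℝ)) atTop (𝓝 0) := tendsto_const_nhds
  have := tendsto_nhds_unique (zero.congr' ?_) key
  · linarith
  · filter_upwards [eventually_gt_atTop r₀] with r hr
    have hr0 : r ≠ 0 := (hS.nonneg.trans_lt hr).ne'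
    have e := (ricci_rθ hS hr hθ (u := u) 0).symm.trans
      (hvac ![u, r, θ, 0] (by simpa using hr) (by simpa using hθ) 1 2)
    rw [← mul_zero (r ^ 2), ← e]
    field_simp

set_option maxHeartbeats 1000000 in
/-- The equation `R_{uu} = 0` at order `r⁻²`: the loss of mass by radiation. -/
theorem vacuum_uu (hS : S.Regular r₀) (hvac : S.IsVacuum r₀) (h : S.Expansion c b U₂ m u θ)
    (hθ : θ ∈ Ioo 0 π) :
    cjet 1 0 m u θ + cjet 1 1 U₂ u θ + cos θ / sin θ * cjet 1 0 U₂ u θ +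
      2 * cjet 1 0 c u θ ^ 2 = 0 := by
  have hE := (h.β.f0.exp (by norm_num) 2).homog
  have hG := (h.γ.f0.exp (by norm_num) 2).homog
  have hE' : Homog u θ (fun u r θ => (exp (2 * S.β u r θ))⁻¹) 0 := by
    simpa only [neg_mul, Real.exp_neg] using (h.β.f0.exp (by norm_num) (-2)).homog
  have hG' : Homog u θ (fun u r θ => (exp (2 * S.γ u r θ))⁻¹) 0 := by
    simpa only [neg_mul, Real.exp_neg] using (h.γ.f0.exp (by norm_num) (-2)).homog
  have v : Homog u θ (fun u r θ => S.W u r θ / r - 1) 0 :=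
    (h.W.f0.homog.div_r.sub (asym_const 1).homog).cast (by simp)
  have r1 : Homog u θ (fun _ r _ => r) (-1) := homog_r
  have r2 : Homog u θ (fun _ r _ => r ^ 2) (-2) := homog_r_sq
  have β0 := h.β.fu.homog
  have β1 := h.β.fr.homog
  have β2 := h.β.fθ.homog
  have γ0 := h.γ.fu.homog
  have γ1 := h.γ.fr.homog
  have γ2 := h.γ.fθ.homog
  have U := h.U.f0.homog
  have U0 := h.U.fu.homog
  have U1 := h.U.fr.homog
  have U2 := h.U.fθ.homog
  have W := h.W.f0.homog
  have W1 : Homog u θ (par 1 S.W) 1 := h.W.fr.homog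
  have W2 := h.W.fθ.homog
  -- the combination in which the leading terms of `V` cancel
  have w := (W1.sub W.div_r).div_two_r
  have g000 : Homog u θ (fun u r θ => bondiΓ S u r θ 0 0 0) 2 :=
    (((((hE'.mul hG).mul ((((r2.mul U).mul U1).add ((r2.mul U.sq).mul γ1)).add
      (r1.mul U.sq))).add (v.mul β1)).add w).add (β0.const_mul 2)).cast (by decide)
  have g002 : Homog u θ (fun u r θ => bondiΓ S u r θ 0 0 2) 1 :=
    (((hE'.mul hG).mul ((((r2.mul U).mul γ1).add (r1.mul U)).add
      ((r2.mul U1).div_const 2))).neg.add β2).cast (by decide)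
  have g102 : Homog u θ (fun u r θ => bondiΓ S u r θ 1 0 2) 1 :=
    (((hE'.mul hG).mul (((((((r2.mul U).mul U2).add ((r1.mul U).mul v)).add
      (((r2.mul U).mul v).mul γ1)).add ((r2.mul U).mul γ0)).add
      ((r2.mul U.sq).mul γ2)).add (((r2.mul U1).mul v).div_const 2))).neg.sub
      W2.div_two_r).cast (by decide)
  have g201 : Homog u θ (fun u r θ => bondiΓ S u r θ 2 0 1) 2 := by
    have j := ((hE.mul hG').mul β2).div_r.div_r
    simp only [div_div, ← pow_two] at j
    exact Homog.weaken (((j.sub (U.mul γ1)).sub U.div_r).sub (U1.div_const 2)) (by decide)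
  have a100 : Asym u θ (fun u r θ => bondiΓ S u r θ 1 0 0) 1 (-(cjet 1 0 m u θ / 2))
      (-(cjet 2 0 m u θ / 2)) (-(cjet 1 1 m u θ / 2)) := by
    have j1 := ((hE'.mul hG).mul U).mul (((((((r2.mul U1).mul v).add ((r2.mul U).mul U2)).add
      ((r1.mul U).mul v)).add (((r2.mul U).mul v).mul γ1)).add ((r2.mul U).mul γ0)).add
      ((r2.mul U.sq).mul γ2))
    have j2 := U.mul ((v.mul β2).add W2.div_two_r)
    have j := (((j1.add j2).add (v.mul β0)).add (v.sq.mul β1)).add (v.mul w)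
    exact j.sub_asym h.W.fu.div_two_r (by decide)
  have a200 : Asym u θ (fun u r θ => bondiΓ S u r θ 2 0 0) 2 (-cjet 1 0 U₂ u θ)
      (-cjet 2 0 U₂ u θ) (-cjet 1 1 U₂ u θ) := by
    have j1 := ((hE'.mul hG).mul U.sq).mul (((r2.mul U1).add ((r2.mul U).mul γ1)).add
      (r1.mul U))
    have j2 := ((hE.mul hG').mul ((v.mul β2).add W2.div_two_r)).div_r.div_r
    simp only [div_div, ← pow_two] at j2
    have j3 := U.mul (((((U2.neg.add (v.mul β1)).add w).add (β0.const_mul 2)).sub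
      (γ0.const_mul 2)).sub (U.mul γ2))
    exact ((j1.sub j2).add j3).sub_asym h.U.fu (by decide)
  have a101 : Asym u θ (fun u r θ => bondiΓ S u r θ 1 0 1) 2 (m u θ / 2) (cjet 1 0 m u θ / 2)
      (cjet 0 1 m u θ / 2) := by
    have W1' : Asym u θ (par 1 S.W) (((0 : ℕ) : ℤ) + 1) 0 0 0 :=
      h.W.fr.cast (by simp) (by simp) (by simp)
    have e := (h.W.f0.div_r.sub W1').div_two_r
    simp only [sub_zero] at e
    have j := ((((((hE'.mul hG).mul r2).mul U).mul U1).div_const 2).neg.sub (U.mul β2)).sub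
      (v.mul β1)
    exact j.add_asym e (by decide)
  -- the angular part of `Γ^k_{uk}`, in which `∂_u γ` cancels
  have hrest : Homog u θ (fun u r θ => -((exp (2 * S.β u r θ))⁻¹ * exp (2 * S.γ u r θ) *
      (r ^ 2 * S.U u r θ * par 1 S.U u r θ / 2 + r ^ 2 * S.U u r θ ^ 2 * par 1 S.γ u r θ +
        r * S.U u r θ ^ 2)) + S.U u r θ * par 2 S.β u r θ) 3 :=
    Homog.cast (((hE'.mul hG).mul (((((r2.mul U).mul U1).div_const 2).add
      ((r2.mul U.sq).mul γ1)).add (r1.mul U.sq))).neg.add (U.mul β2)) (by decide)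
  have a202 : Asym u θ (fun u r θ => bondiΓ S u r θ 2 0 2) 1 (cjet 1 0 c u θ)
      (cjet 2 0 c u θ) (cjet 1 1 c u θ) := by
    exact hrest.add_asym h.γ.fu (by decide)
  have ang : Tendsto (fun r => r ^ 2 * (par 0 (fun u r θ => bondiΓ S u r θ 2 0 2) u r θ +
      par 0 (fun u r θ => bondiΓ S u r θ 3 0 3) u r θ)) atTop (𝓝 0) := by
    obtain ⟨_, _, _, hr⟩ := hrest
    refine (hr.weaken (by decide : (2 : ℤ) < 3)).lim_u.congr' ?_
    filter_upwards [hr.diff_u, h.γ.fu.diff_u] with r h1 h2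
    have e1 : par 0 (fun u r θ => bondiΓ S u r θ 2 0 2) u r θ = _ := deriv_fun_add h1 h2
    have e2 : par 0 (fun u r θ => bondiΓ S u r θ 3 0 3) u r θ = _ := deriv.fun_neg
    rw [e1, e2]
    simp only [par]
    norm_cast
    ring
  have zero : Tendsto (fun _ : ℝ => (0 : ℝ)) atTop (𝓝 0) := tendsto_const_nhds
  have hβ1 : Tendsto (fun r => r ^ 1 * par 1 S.β u r θ) atTop (𝓝 0) :=
    β1.tendsto_zero (by decide)
  have hβ2 : Tendsto (fun r => r ^ 0 * par 2 S.β u r θ) atTop (𝓝 0) :=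
    β2.tendsto_zero (by decide)
  have t100 : Tendsto (fun r => r ^ 1 * bondiΓ S u r θ 1 0 0) atTop _ := a100.lim
  have t100r : Tendsto (fun r => r ^ 2 * par 1 (fun u r θ => bondiΓ S u r θ 1 0 0) u r θ)
    atTop _ := a100.lim_r
  have t200 : Tendsto (fun r => r ^ 2 * bondiΓ S u r θ 2 0 0) atTop _ := a200.lim
  have t200θ : Tendsto (fun r => r ^ 2 * par 2 (fun u r θ => bondiΓ S u r θ 2 0 0) u r θ)
    atTop _ := a200.lim_θ
  have t101 : Tendsto (fun r => r ^ 2 * par 0 (fun u r θ => bondiΓ S u r θ 1 0 1) u r θ)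
    atTop _ := a101.lim_u
  have t202 : Tendsto (fun r => r ^ 1 * bondiΓ S u r θ 2 0 2) atTop _ := a202.lim
  have tγ0 : Tendsto (fun r => r ^ 1 * par 0 S.γ u r θ) atTop _ := h.γ.fu.lim
  -- The products which decay faster than `r⁻²`.
  have s1 := ((β0.const_mul 2).mul g000).tendsto_zero (n := 2) (by decide)
  have s2 := g000.sq.tendsto_zero (n := 2) (by decide)
  have s3 := a101.homog.sq.tendsto_zero (n := 2) (by decide)
  have s4 := ((g002.const_mul 2).mul a200.homog).tendsto_zero (n := 2) (by decide)
  have s5 := ((g102.const_mul 2).mul g201).tendsto_zero (n := 2) (by decide)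
  have key := ((((t100r.add t200θ).sub t101).sub ang).add ((s1.add
    (((hβ1.const_mul 2).add_const 2).mul t100)).add
    (((hβ2.const_mul 2).add_const (cos θ / sin θ)).mul t200))).sub
    (((((s2.add s3).add (t202.pow 2)).add (tγ0.pow 2)).add s4).add s5)
  have := tendsto_nhds_unique (zero.congr' ?_) key
  · push_cast at this
    linarith
  · filter_upwards [eventually_gt_atTop r₀] with r hr
    have hr0 : r ≠ 0 := (hS.nonneg.trans_lt hr).ne'
    have e := (ricci_uu hS hr hθ (u := u) 0).symm.trans
      (hvac ![u, r, θ, 0] (by simpa using hr) (by simpa using hθ) 0 0)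
    rw [← mul_zero (r ^ 2), ← e]
    field_simp

end

/-! ### Functions of `(u, θ)` -/

section

/-- Smoothness of a function of `(u, θ)` away from the poles. -/
def Sc (a : ℝ → ℝ → ℝ) : Prop := Smth 0 (mono a 0)

section Sc

variable {a : ℝ → ℝ → ℝ} {u θ : ℝ}

theorem SmoothCoeff.sc (h : SmoothCoeff a) : Sc a := smth_mono le_rfl h 0

theorem Sc.d0 (h : Sc a) : Sc (d0 a) := by
  have := h.par 0
  rwa [par_mono_u] at this

theorem Sc.d2 (h : Sc a) : Sc (d2 a) := by
  have := h.par 2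
  rwa [par_mono_θ] at this

theorem Sc.hasDerivAt_u (h : Sc a) (hθ : θ ∈ Ioo 0 π) :
    HasDerivAt (fun s => a s θ) (AxiBondi.d0 a u θ) u := by
  have := Smth.hasDerivAt_u (u := u) h zero_lt_one hθ
  simpa [par_mono_u, mono] using this

theorem Sc.hasDerivAt_θ (h : Sc a) (hθ : θ ∈ Ioo 0 π) :
    HasDerivAt (fun s => a u s) (AxiBondi.d2 a u θ) θ := by
  have := Smth.hasDerivAt_θ (u := u) h zero_lt_one hθ
  simpa [par_mono_θ, mono] using this

theorem Sc.comm (h : Sc a) (hθ : θ ∈ Ioo 0 π) :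
    AxiBondi.d2 (AxiBondi.d0 a) u θ = AxiBondi.d0 (AxiBondi.d2 a) u θ := by
  have := Smth.par_comm (u := u) h 2 0 zero_lt_one hθ
  simpa [par_mono_θ, par_mono_u, mono] using this

theorem Sc.continuousOn (h : Sc a) (u : ℝ) : ContinuousOn (a u) (Ioo 0 π) := fun _ hθ =>
  (h.hasDerivAt_θ hθ).continuousAt.continuousWithinAt

theorem Sc.aesm (h : Sc a) (u : ℝ) :
    AEStronglyMeasurable (a u) (volume.restrict (Ioo 0 π)) :=
  (h.continuousOn u).aestronglyMeasurable measurableSet_Ioo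

theorem SmoothCoeff.continuousOn (h : SmoothCoeff a) (u : ℝ) :
    ContinuousOn (a u) (Icc 0 π) := by
  have h1 : ContinuousOn (fun p : ℝ × ℝ => a p.1 p.2) {p | p.2 ∈ Icc 0 π} :=
    ContDiffOn.continuousOn h
  exact h1.comp (f := fun θ => (u, θ)) (by fun_prop) fun θ hθ => hθ

end Sc

/-! ### Integrals over `(0, π)` -/

theorem integral_Ioo_eq (f : ℝ → ℝ) : ∫ θ in (0 : ℝ)..π, f θ = ∫ θ in Ioo 0 π, f θ := by
  rw [intervalIntegral.integral_of_le pi_pos.le, integral_Ioc_eq_integral_Ioo]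

theorem integrableOn_of_bounded {f : ℝ → ℝ} {K : ℝ}
    (hm : AEStronglyMeasurable f (volume.restrict (Ioo 0 π))) (hb : ∀ θ ∈ Ioo 0 π, |f θ| ≤ K) :
    IntegrableOn f (Ioo 0 π) :=
  Integrable.of_bound hm K
    ((ae_restrict_iff' measurableSet_Ioo).2 (Eventually.of_forall hb))

/-- Bounded convergence on `(0, π)`. -/
theorem tendsto_integral_Ioo {ι : Type*} {l : Filter ι} [l.IsCountablyGenerated]
    {F : ι → ℝ → ℝ} {G : ℝ → ℝ} {K : ℝ}
    (hm : ∀ᶠ i in l, AEStronglyMeasurable (F i) (volume.restrict (Ioo 0 π)))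
    (hb : ∀ᶠ i in l, ∀ θ ∈ Ioo 0 π, |F i θ| ≤ K)
    (hl : ∀ θ ∈ Ioo 0 π, Tendsto (fun i => F i θ) l (𝓝 (G θ))) :
    Tendsto (fun i => ∫ θ in Ioo 0 π, F i θ) l (𝓝 (∫ θ in Ioo 0 π, G θ)) :=
  tendsto_integral_filter_of_dominated_convergence (fun _ => K) hm
    (hb.mono fun i hi => (ae_restrict_iff' measurableSet_Ioo).2 (Eventually.of_forall hi))
    (by simp) ((ae_restrict_iff' measurableSet_Ioo).2 (Eventually.of_forall hl))

theorem tendsto_integral_Ioo_zero {ι : Type*} {l : Filter ι} [l.IsCountablyGenerated]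
    {F : ι → ℝ → ℝ} {K : ℝ}
    (hm : ∀ᶠ i in l, AEStronglyMeasurable (F i) (volume.restrict (Ioo 0 π)))
    (hb : ∀ᶠ i in l, ∀ θ ∈ Ioo 0 π, |F i θ| ≤ K)
    (hl : ∀ θ ∈ Ioo 0 π, Tendsto (fun i => F i θ) l (𝓝 0)) :
    Tendsto (fun i => ∫ θ in Ioo 0 π, F i θ) l (𝓝 0) := by
  simpa using tendsto_integral_Ioo hm hb hl

/-- A total `θ`-derivative of `a φ` integrates to zero if `φ` vanishes at the poles. -/
theorem integral_total_derivative {a : ℝ → ℝ → ℝ} {u K : ℝ} (ha : SmoothCoeff a)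
    (hb : ∀ θ ∈ Ioo 0 π, |d2 a u θ| ≤ K) {φ φ' : ℝ → ℝ} (hφ : ∀ θ, HasDerivAt φ (φ' θ) θ)
    (hφ' : Continuous φ') (h0 : φ 0 = 0) (h1 : φ π = 0) :
    ∫ θ in Ioo 0 π, (d2 a u θ * φ θ + a u θ * φ' θ) = 0 := by
  have hφc : Continuous φ := continuous_iff_continuousAt.2 fun θ => (hφ θ).continuousAt
  rw [← integral_Ioo_eq, intervalIntegral.integral_eq_sub_of_hasDerivAt_of_le pi_pos.le
    ((ha.continuousOn u).mul hφc.continuousOn)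
    (fun θ hθ => (ha.sc.hasDerivAt_θ hθ).mul (hφ θ))]
  · simp [h0, h1]
  · have hI : IntegrableOn (d2 a u) (Ioo 0 π) := integrableOn_of_bounded (ha.sc.d2.aesm u) hb
    rw [intervalIntegrable_iff_integrableOn_Ioo_of_le pi_pos.le]
    refine Integrable.add ?_ ?_
    · obtain ⟨C, hC⟩ := isCompact_Icc.exists_bound_of_continuousOn
        (hφc.continuousOn (s := Icc 0 π))
      exact Integrable.mul_bdd (c := C) hI hφc.aestronglyMeasurable
        ((ae_restrict_iff' measurableSet_Ioo).2 (Eventually.of_forall fun θ hθ =>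
          hC θ (Ioo_subset_Icc_self hθ)))
    · exact (((ha.continuousOn u).mul hφ'.continuousOn).integrableOn_Icc).mono_set
        Ioo_subset_Icc_self

/-- If `f_i(x + h) - f_i(x) → 0` for small `h > 0` and the second derivatives of the `f_i` are
bounded near `x`, then `f_i'(x) → 0`. -/
theorem tendsto_deriv_zero {ι : Type*} {l : Filter ι} {f g g' : ι → ℝ → ℝ} {x δ K : ℝ}
    (hδ : 0 < δ)
    (hd : ∀ᶠ i in l, ∀ y ∈ Icc x (x + δ), HasDerivAt (f i) (g i y) y ∧
      HasDerivAt (g i) (g' i y) y ∧ |g' i y| ≤ K)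
    (hf : ∀ h, 0 < h → h ≤ δ → Tendsto (fun i => f i (x + h) - f i x) l (𝓝 0)) :
    Tendsto (fun i => g i x) l (𝓝 0) := by
  rw [Metric.tendsto_nhds]
  intro ε hε
  set h := min δ (ε / (2 * (|K| + 1))) with hh
  have hK : 0 < |K| + 1 := by positivity
  have hh0 : 0 < h := lt_min hδ (by positivity)
  have hhK : |K| * h ≤ ε / 2 := by
    have h1 : h ≤ ε / (2 * (|K| + 1)) := min_le_right _ _
    calc |K| * h ≤ (|K| + 1) * (ε / (2 * (|K| + 1))) :=
          mul_le_mul (by linarith) h1 hh0.le hK.le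
      _ = ε / 2 := by field_simp
  filter_upwards [hd, (Metric.tendsto_nhds.1 (hf h hh0 (min_le_left _ _))) (ε / 2 * h)
    (by positivity)] with i hi hi'
  have hsub : Icc x (x + h) ⊆ Icc x (x + δ) :=
    Icc_subset_Icc_right (by linarith [min_le_left δ (ε / (2 * (|K| + 1)))])
  -- The slope over `[x, x + h]` is small, and `g` differs from it by at most `|K| h ≤ ε / 2`.
  obtain ⟨ξ, hξ, e⟩ := exists_hasDerivAt_eq_slope (f i) (g i) (by linarith : x < x + h)
    (fun y hy => (hi y (hsub hy)).1.continuousAt.continuousWithinAt)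
    (fun y hy => (hi y (hsub (Ioo_subset_Icc_self hy))).1)
  have hL : |g i ξ - g i x| ≤ |K| * h := by
    have := norm_image_sub_le_of_norm_deriv_le_segment' (f := g i) (f' := g' i) (a := x)
      (b := x + h) (C := |K|) (fun y hy => (hi y (hsub hy)).2.1.hasDerivWithinAt)
      (fun y hy => ((hi y (hsub (Ico_subset_Icc_self hy))).2.2).trans (le_abs_self K)) ξ
      (Ioo_subset_Icc_self hξ)
    exact this.trans (mul_le_mul_of_nonneg_left (by linarith [hξ.2]) (abs_nonneg _))
  rw [Real.dist_eq, sub_zero] at hi' ⊢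
  rw [add_sub_cancel_left] at e
  have e2 : |g i ξ| < ε / 2 := by
    rw [e, abs_div, abs_of_pos hh0, div_lt_iff₀ hh0]; exact hi'
  calc |g i x| = |g i ξ - (g i ξ - g i x)| := by ring_nf
    _ ≤ |g i ξ| + |g i ξ - g i x| := abs_sub _ _
    _ < ε := by linarith

/-- A version of `tendsto_deriv_zero` for functions on `(0, π)`, where the bound on the second
derivative may degenerate at the poles. -/
theorem tendsto_d2_zero {F G G' : ℝ → ℝ → ℝ} {K : ℝ}
    (hd : ∀ᶠ u in atBot, ∀ θ ∈ Ioo 0 π, HasDerivAt (F u) (G u θ) θ ∧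
      HasDerivAt (G u) (G' u θ) θ ∧ |G' u θ| ≤ K / sin θ ^ 2)
    (hF : ∀ θ ∈ Ioo 0 π, Tendsto (fun u => F u θ) atBot (𝓝 0)) :
    ∀ θ ∈ Ioo 0 π, Tendsto (fun u => G u θ) atBot (𝓝 0) := by
  intro θ hθ
  have hδ : 0 < (π - θ) / 2 := by linarith [hθ.2]
  have hsub : Icc θ (θ + (π - θ) / 2) ⊆ Ioo 0 π := fun y hy =>
    ⟨hθ.1.trans_le hy.1, by linarith [hy.2, hθ.2]⟩
  have hc : ContinuousOn (fun y => K / sin y ^ 2) (Icc θ (θ + (π - θ) / 2)) := by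
    refine continuousOn_const.div (by fun_prop) fun y hy => ?_
    have := sin_pos_of_pos_of_lt_pi (hsub hy).1 (hsub hy).2
    positivity
  obtain ⟨C, hC⟩ := isCompact_Icc.exists_bound_of_continuousOn hc
  refine tendsto_deriv_zero (f := F) (g' := G') (K := C) hδ ?_ ?_
  · filter_upwards [hd] with u hu y hy
    obtain ⟨h1, h2, h3⟩ := hu y (hsub hy)
    exact ⟨h1, h2, h3.trans ((le_abs_self _).trans (hC y hy))⟩
  · intro h h0 hh
    simpa using (hF _ (hsub ⟨by linarith, by linarith⟩)).sub (hF θ hθ)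

end

/-! ### The limit `u → -∞` -/

section

/-- The leading coefficients `c`, `U₂` and `m = 2 M` for `u ≤ u₁`: bounds on the derivatives up to
second order and the two relations which follow from the vacuum equations. -/
structure ScriData (c U₂ m : ℝ → ℝ → ℝ) (K u₁ : ℝ) : Prop where
  smooth_c : SmoothCoeff c
  smooth_U : SmoothCoeff U₂
  smooth_m : SmoothCoeff m
  bd_c : ∀ u ≤ u₁, ∀ θ ∈ Ioo 0 π, ∀ i l : ℕ, i + l ≤ 2 → |cjet i l c u θ| ≤ K
  bd_U : ∀ u ≤ u₁, ∀ θ ∈ Ioo 0 π, ∀ i l : ℕ, i + l ≤ 2 → |cjet i l U₂ u θ| ≤ K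
  bd_m : ∀ u ≤ u₁, ∀ θ ∈ Ioo 0 π, ∀ i l : ℕ, i + l ≤ 2 → |cjet i l m u θ| ≤ K
  eq_U : ∀ u ≤ u₁, ∀ θ ∈ Ioo 0 π, U₂ u θ + d2 c u θ + 2 * (cos θ / sin θ) * c u θ = 0
  eq_m : ∀ u ≤ u₁, ∀ θ ∈ Ioo 0 π, d0 m u θ + d0 (d2 U₂) u θ +
    cos θ / sin θ * d0 U₂ u θ + 2 * d0 c u θ ^ 2 = 0

namespace ScriData

variable {c U₂ m : ℝ → ℝ → ℝ} {K u₁ u θ : ℝ} (D : ScriData c U₂ m K u₁)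

theorem hasDerivAt_cot (hθ : θ ∈ Ioo 0 π) :
    HasDerivAt (fun s => cos s / sin s) (-(1 / sin θ ^ 2)) θ := by
  have hs : sin θ ≠ 0 := (sin_pos_of_pos_of_lt_pi hθ.1 hθ.2).ne'
  have := (hasDerivAt_cos θ).div (hasDerivAt_sin θ) hs
  refine this.congr_deriv ?_
  field_simp
  linarith [sin_sq_add_cos_sq θ]

theorem abs_cot_le (hθ : θ ∈ Ioo 0 π) : |cos θ / sin θ| ≤ 1 / sin θ ^ 2 := by
  have hs : 0 < sin θ := sin_pos_of_pos_of_lt_pi hθ.1 hθ.2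
  rw [abs_div, abs_of_pos hs, div_le_div_iff₀ hs (by positivity)]
  have h1 := abs_cos_le_one θ
  have h2 := sin_le_one θ
  nlinarith [abs_nonneg (cos θ), mul_pos hs hs]

theorem one_le_inv_sin_sq (hθ : θ ∈ Ioo 0 π) : 1 ≤ 1 / sin θ ^ 2 := by
  have hs : 0 < sin θ := sin_pos_of_pos_of_lt_pi hθ.1 hθ.2
  rw [le_div_iff₀ (by positivity)]
  nlinarith [sin_le_one θ]

include D

theorem K_nonneg : 0 ≤ K := (abs_nonneg _).trans
  (D.bd_c u₁ le_rfl (π / 2) ⟨by positivity, by linarith [pi_pos]⟩ 0 0 (by omega))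

/-- The combination of mass aspect and shear whose `u`-derivative is `-2 (∂_u c)²`. -/
theorem hasDerivAt_mass (hu : u ≤ u₁) (hθ : θ ∈ Ioo 0 π) :
    HasDerivAt (fun s => m s θ + d2 U₂ s θ + cos θ / sin θ * U₂ s θ) (-2 * d0 c u θ ^ 2) u := by
  refine (((D.smooth_m.sc.hasDerivAt_u (u := u) hθ).add
    (D.smooth_U.sc.d2.hasDerivAt_u (u := u) hθ)).add
    ((D.smooth_U.sc.hasDerivAt_u (u := u) hθ).const_mul (cos θ / sin θ))).congr_deriv ?_
  linarith [D.eq_m u hu θ hθ]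

/-- The combination of mass aspect and shear is bounded and decreasing in `u`. -/
theorem exists_mass_limit (hθ : θ ∈ Ioo 0 π) :
    ∃ L, Tendsto (fun u => m u θ + d2 U₂ u θ + cos θ / sin θ * U₂ u θ) atBot (𝓝 L) := by
  set A := fun u => m u θ + d2 U₂ u θ + cos θ / sin θ * U₂ u θ with hA
  have hanti : AntitoneOn A (Iic u₁) := by
    refine antitoneOn_of_deriv_nonpos (convex_Iic u₁)
      (fun u hu => (D.hasDerivAt_mass hu hθ).continuousAt.continuousWithinAt) ?_ ?_
    · intro u hu
      have := D.hasDerivAt_mass (mem_Iic.1 (interior_subset hu)) hθ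
      exact this.differentiableAt.differentiableWithinAt
    · intro u hu
      rw [(D.hasDerivAt_mass (mem_Iic.1 (interior_subset hu)) hθ).deriv]
      nlinarith [sq_nonneg (d0 c u θ)]
  -- Monotonicity is known for `u ≤ u₁` only; freezing `A` beyond `u₁` does not affect the limit.
  have hanti' : Antitone fun u => A (min u u₁) := fun x y hxy =>
    hanti (mem_Iic.2 (min_le_right _ _)) (mem_Iic.2 (min_le_right _ _))
      (min_le_min_right _ hxy)
  have hbdd : BddAbove (range fun u => A (min u u₁)) := by
    refine ⟨K + K + |cos θ / sin θ| * K, ?_⟩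
    rintro _ ⟨u, rfl⟩
    have hu : min u u₁ ≤ u₁ := min_le_right _ _
    have h1 := D.bd_m _ hu θ hθ 0 0 (by omega)
    have h2 := D.bd_U _ hu θ hθ 0 1 (by omega)
    have h3 := D.bd_U _ hu θ hθ 0 0 (by omega)
    refine add_le_add (add_le_add ((le_abs_self _).trans h1) ((le_abs_self _).trans h2)) ?_
    refine (le_abs_self _).trans ?_
    rw [abs_mul]
    exact mul_le_mul_of_nonneg_left h3 (abs_nonneg _)
  refine ⟨_, (tendsto_atBot_ciSup hanti' hbdd).congr' ?_⟩
  filter_upwards [eventually_le_atBot u₁] with u hu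
  rw [min_eq_left hu]

/-- The news function `∂_u c` tends to zero: its square is the derivative of a convergent function
and has bounded derivative. -/
theorem tendsto_d0_c (hθ : θ ∈ Ioo 0 π) : Tendsto (fun u => d0 c u θ) atBot (𝓝 0) := by
  obtain ⟨L, hL⟩ := D.exists_mass_limit hθ
  set A := fun u => m u θ + d2 U₂ u θ + cos θ / sin θ * U₂ u θ with hA
  have key := tendsto_deriv_zero (l := atBot) (f := fun u s => A (u + s))
    (g := fun u s => -2 * d0 c (u + s) θ ^ 2)
    (g' := fun u s => -2 * (2 * d0 c (u + s) θ * d0 (d0 c) (u + s) θ)) (x := 0) (δ := 1)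
    (K := 4 * (K * K)) one_pos ?_ ?_
  · have h2 : Tendsto (fun u => d0 c u θ ^ 2) atBot (𝓝 0) := by
      have := key.const_mul (-1 / 2)
      simp only [add_zero, mul_zero] at this
      exact this.congr fun u => by ring
    have := h2.sqrt
    simp only [sqrt_sq_eq_abs, sqrt_zero] at this
    exact (tendsto_zero_iff_abs_tendsto_zero _).2 this
  · filter_upwards [eventually_le_atBot (u₁ - 1)] with u hu y hy
    have hy' : u + y ≤ u₁ := by linarith [hy.2]
    refine ⟨(D.hasDerivAt_mass hy' hθ).comp_const_add u y, ?_, ?_⟩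
    · have h := ((D.smooth_c.sc.d0.hasDerivAt_u (u := u + y) hθ).comp_const_add u y).pow 2
        |>.const_mul (-2)
      exact h.congr_deriv (by simp)
    · have h1 := D.bd_c _ hy' θ hθ 1 0 (by omega)
      have h2 := D.bd_c _ hy' θ hθ 2 0 (by omega)
      have h3 : |d0 c (u + y) θ| * |d0 (d0 c) (u + y) θ| ≤ K * K :=
        mul_le_mul h1 h2 (abs_nonneg _) D.K_nonneg
      rw [abs_mul, abs_mul, abs_mul]
      norm_num
      linarith
  · intro h _ _
    have h1 : Tendsto (fun u => A (u + h)) atBot (𝓝 L) :=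
      hL.comp (tendsto_atBot_add_const_right _ h tendsto_id)
    simpa using h1.sub hL

/-- The `u`-derivative of the relation between `U₂` and `c`. -/
theorem d0_eq_U (hu : u < u₁) (hθ : θ ∈ Ioo 0 π) :
    d0 U₂ u θ + d0 (d2 c) u θ + 2 * (cos θ / sin θ) * d0 c u θ = 0 := by
  have h := ((D.smooth_U.sc.hasDerivAt_u (u := u) hθ).add
    (D.smooth_c.sc.d2.hasDerivAt_u (u := u) hθ)).add
    ((D.smooth_c.sc.hasDerivAt_u (u := u) hθ).const_mul (2 * (cos θ / sin θ)))
  refine h.unique ((hasDerivAt_const u (0 : ℝ)).congr_of_eventuallyEq ?_)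
  filter_upwards [eventually_lt_nhds hu] with s hs
  exact D.eq_U s hs.le θ hθ

/-- The `θ`-derivative of the relation between `U₂` and `c`, solved for `∂_θ² c`. -/
theorem d2_d2_c (hu : u ≤ u₁) (hθ : θ ∈ Ioo 0 π) :
    d2 (d2 c) u θ = -d2 U₂ u θ - 2 * (cos θ / sin θ) * d2 c u θ + 2 / sin θ ^ 2 * c u θ := by
  have h := ((D.smooth_U.sc.hasDerivAt_θ (u := u) hθ).add
    (D.smooth_c.sc.d2.hasDerivAt_θ (u := u) hθ)).add
    (((hasDerivAt_cot hθ).const_mul 2).mul (D.smooth_c.sc.hasDerivAt_θ (u := u) hθ))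
  have := h.unique ((hasDerivAt_const θ (0 : ℝ)).congr_of_eventuallyEq
    (Filter.mem_of_superset (Ioo_mem_nhds hθ.1 hθ.2) fun s hs => D.eq_U u hu s hs))
  have e : 2 / sin θ ^ 2 * c u θ = 2 * (1 / sin θ ^ 2) * c u θ := by ring
  rw [e]
  linarith

/-- A third derivative of `c`, which is not covered by the bounds on the jets, expressed by
lower ones at the price of a factor singular at the poles. -/
theorem d0_d2_d2_c (hu : u < u₁) (hθ : θ ∈ Ioo 0 π) :
    d0 (d2 (d2 c)) u θ = -d0 (d2 U₂) u θ - 2 * (cos θ / sin θ) * d0 (d2 c) u θ +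
      2 / sin θ ^ 2 * d0 c u θ := by
  have h := ((D.smooth_U.sc.d2.hasDerivAt_u (u := u) hθ).neg.sub
    ((D.smooth_c.sc.d2.hasDerivAt_u (u := u) hθ).const_mul (2 * (cos θ / sin θ)))).add
    ((D.smooth_c.sc.hasDerivAt_u (u := u) hθ).const_mul (2 / sin θ ^ 2))
  refine (h.congr_of_eventuallyEq ?_).deriv
  filter_upwards [eventually_lt_nhds hu] with s hs
  exact D.d2_d2_c hs.le hθ

/-- `∂_u ∂_θ c → 0`. -/
theorem tendsto_d0_d2_c : ∀ θ ∈ Ioo 0 π, Tendsto (fun u => d0 (d2 c) u θ) atBot (𝓝 0) := by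
  refine tendsto_d2_zero (F := d0 c) (G' := fun u θ => d0 (d2 (d2 c)) u θ) (K := 5 * K) ?_
    fun θ hθ => D.tendsto_d0_c hθ
  filter_upwards [eventually_lt_atBot u₁] with u hu θ hθ
  refine ⟨?_, ?_, ?_⟩
  · rw [← D.smooth_c.sc.comm hθ]
    exact D.smooth_c.sc.d0.hasDerivAt_θ (u := u) hθ
  · rw [← D.smooth_c.sc.d2.comm hθ]
    exact D.smooth_c.sc.d2.d0.hasDerivAt_θ (u := u) hθ
  · rw [D.d0_d2_d2_c hu hθ]
    have h1 := D.bd_U u hu.le θ hθ 1 1 (by omega)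
    have h2 := D.bd_c u hu.le θ hθ 1 1 (by omega)
    have h3 := D.bd_c u hu.le θ hθ 1 0 (by omega)
    have hK := D.K_nonneg
    have hc := abs_cot_le hθ
    have h4 := one_le_inv_sin_sq hθ
    have e1 : |2 * (cos θ / sin θ) * d0 (d2 c) u θ| ≤ 2 * (1 / sin θ ^ 2) * K := by
      rw [abs_mul, abs_mul, abs_two]
      exact mul_le_mul (by linarith) h2 (abs_nonneg _) (by positivity)
    have e2 : |2 / sin θ ^ 2 * d0 c u θ| ≤ 2 * (1 / sin θ ^ 2) * K := by
      rw [abs_mul, abs_of_nonneg (by positivity), ← mul_one_div]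
      exact mul_le_mul_of_nonneg_left h3 (by positivity)
    have e3 : |d0 (d2 U₂) u θ| ≤ 1 / sin θ ^ 2 * K :=
      h1.trans (le_mul_of_one_le_left hK h4)
    calc _ ≤ |d0 (d2 U₂) u θ| + |2 * (cos θ / sin θ) * d0 (d2 c) u θ| +
          |2 / sin θ ^ 2 * d0 c u θ| := by
          refine (abs_add_le _ _).trans (add_le_add_left ((abs_sub _ _).trans ?_) _)
          rw [abs_neg]
      _ ≤ 1 / sin θ ^ 2 * K + 2 * (1 / sin θ ^ 2) * K + 2 * (1 / sin θ ^ 2) * K := by linarith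
      _ = 5 * K / sin θ ^ 2 := by ring

theorem tendsto_d0_U (hθ : θ ∈ Ioo 0 π) : Tendsto (fun u => d0 U₂ u θ) atBot (𝓝 0) := by
  have := ((D.tendsto_d0_d2_c θ hθ).neg).sub
    ((D.tendsto_d0_c hθ).const_mul (2 * (cos θ / sin θ)))
  simp only [neg_zero, mul_zero, sub_zero] at this
  refine this.congr' ?_
  filter_upwards [eventually_lt_atBot u₁] with u hu
  linarith [D.d0_eq_U hu hθ]

/-- `∂_u ∂_θ U₂ → 0`. -/
theorem tendsto_d0_d2_U : ∀ θ ∈ Ioo 0 π, Tendsto (fun u => d0 (d2 U₂) u θ) atBot (𝓝 0) := by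
  -- The second `θ`-derivative of `∂_u U₂` comes from differentiating the mass loss formula.
  refine tendsto_d2_zero (F := d0 U₂) (G' := fun u θ => -d0 (d2 m) u θ +
    1 / sin θ ^ 2 * d0 U₂ u θ - cos θ / sin θ * d0 (d2 U₂) u θ -
    4 * d0 c u θ * d0 (d2 c) u θ) (K := 3 * K + 4 * (K * K)) ?_ fun θ hθ => D.tendsto_d0_U hθ
  filter_upwards [eventually_le_atBot u₁] with u hu θ hθ
  refine ⟨?_, ?_, ?_⟩
  · rw [← D.smooth_U.sc.comm hθ]
    exact D.smooth_U.sc.d0.hasDerivAt_θ (u := u) hθ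
  · have h := (((D.smooth_m.sc.d0.hasDerivAt_θ (u := u) hθ).neg.sub
      ((hasDerivAt_cot hθ).mul (D.smooth_U.sc.d0.hasDerivAt_θ (u := u) hθ))).sub
      (((D.smooth_c.sc.d0.hasDerivAt_θ (u := u) hθ).pow 2).const_mul 2))
    rw [D.smooth_m.sc.comm hθ, D.smooth_U.sc.comm hθ, D.smooth_c.sc.comm hθ] at h
    refine (h.congr_deriv (by simp; ring)).congr_of_eventuallyEq ?_
    refine Filter.mem_of_superset (Ioo_mem_nhds hθ.1 hθ.2) fun s hs => ?_
    have := D.eq_m u hu s hs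
    simp only [mem_ofPred_eq, Pi.sub_apply, Pi.neg_apply, Pi.mul_apply, Pi.pow_apply]
    linarith
  · have h1 := D.bd_m u hu θ hθ 1 1 (by omega)
    have h2 := D.bd_U u hu θ hθ 1 0 (by omega)
    have h3 := D.bd_U u hu θ hθ 1 1 (by omega)
    have h4 := D.bd_c u hu θ hθ 1 0 (by omega)
    have h5 := D.bd_c u hu θ hθ 1 1 (by omega)
    have hK := D.K_nonneg
    have h6 := one_le_inv_sin_sq hθ
    have e1 : |d0 (d2 m) u θ| ≤ 1 / sin θ ^ 2 * K := h1.trans (le_mul_of_one_le_left hK h6)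
    have e2 : |1 / sin θ ^ 2 * d0 U₂ u θ| ≤ 1 / sin θ ^ 2 * K := by
      rw [abs_mul, abs_of_nonneg (by positivity)]
      exact mul_le_mul_of_nonneg_left h2 (by positivity)
    have e3 : |cos θ / sin θ * d0 (d2 U₂) u θ| ≤ 1 / sin θ ^ 2 * K := by
      rw [abs_mul]
      exact mul_le_mul (abs_cot_le hθ) h3 (abs_nonneg _) (by positivity)
    have e4 : |4 * d0 c u θ * d0 (d2 c) u θ| ≤ 1 / sin θ ^ 2 * (4 * (K * K)) := by
      refine le_trans ?_ (le_mul_of_one_le_left (by positivity) h6)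
      rw [abs_mul, abs_mul, mul_assoc]
      have : |d0 c u θ| * |d0 (d2 c) u θ| ≤ K * K := mul_le_mul h4 h5 (abs_nonneg _) hK
      norm_num
      linarith
    calc _ ≤ |d0 (d2 m) u θ| + |1 / sin θ ^ 2 * d0 U₂ u θ| +
          |cos θ / sin θ * d0 (d2 U₂) u θ| + |4 * d0 c u θ * d0 (d2 c) u θ| := by
          refine (abs_sub _ _).trans (add_le_add_left ((abs_sub _ _).trans
            (add_le_add_left ((abs_add_le _ _).trans ?_) _)) _)
          rw [abs_neg]
      _ ≤ 1 / sin θ ^ 2 * K + 1 / sin θ ^ 2 * K + 1 / sin θ ^ 2 * K +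
          1 / sin θ ^ 2 * (4 * (K * K)) := by linarith
      _ = (3 * K + 4 * (K * K)) / sin θ ^ 2 := by ring

/-- The decay of `∂_u m` is read off from the mass loss formula. -/
theorem tendsto_d0_m (hθ : θ ∈ Ioo 0 π) : Tendsto (fun u => d0 m u θ) atBot (𝓝 0) := by
  have := ((D.tendsto_d0_d2_U θ hθ).neg.sub
    ((D.tendsto_d0_U hθ).const_mul (cos θ / sin θ))).sub
    (((D.tendsto_d0_c hθ).pow 2).const_mul 2)
  simp only [neg_zero, mul_zero, sub_zero, ne_eq, OfNat.ofNat_ne_zero, not_false_eq_true,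
    zero_pow] at this
  refine this.congr' ?_
  filter_upwards [eventually_le_atBot u₁] with u hu
  linarith [D.eq_m u hu θ hθ]

end ScriData

end

/-! ### Integrals over the sphere at null infinity -/

section

namespace ScriData

variable {c U₂ m : ℝ → ℝ → ℝ} {K u₁ u : ℝ} (D : ScriData c U₂ m K u₁)

include D

/-- By its relation to `c`, the function `U₂ sin²` is the total derivative `-∂_θ (c sin²)`. -/
theorem integral_U_sin_sq (hu : u ≤ u₁) : ∫ θ in Ioo 0 π, U₂ u θ * sin θ ^ 2 = 0 := by
  have h := integral_total_derivative D.smooth_c (fun θ hθ => D.bd_c u hu θ hθ 0 1 (by omega))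
    (φ := fun θ => sin θ ^ 2) (φ' := fun θ => 2 * sin θ * cos θ)
    (fun θ => ((hasDerivAt_sin θ).pow 2).congr_deriv (by simp)) (by fun_prop) (by simp) (by simp)
  rw [← neg_eq_zero, ← integral_neg]
  refine Eq.trans ?_ h
  refine setIntegral_congr_fun measurableSet_Ioo fun θ hθ => ?_
  have hs : sin θ ≠ 0 := (sin_pos_of_pos_of_lt_pi hθ.1 hθ.2).ne'
  have e : U₂ u θ = -d2 c u θ - 2 * (cos θ / sin θ) * c u θ := by linarith [D.eq_U u hu θ hθ]
  simp only [e]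
  field_simp
  ring

theorem integrable_U_sin_sq (hu : u ≤ u₁) :
    IntegrableOn (fun θ => U₂ u θ * sin θ ^ 2) (Ioo 0 π) := by
  refine integrableOn_of_bounded (K := K)
    ((D.smooth_U.sc.aesm u).mul (by fun_prop)) fun θ hθ => ?_
  rw [abs_mul]
  refine (mul_le_of_le_one_right (abs_nonneg _) ?_).trans (D.bd_U u hu θ hθ 0 0 (by omega))
  rw [abs_of_nonneg (sq_nonneg _)]
  exact sin_sq_le_one θ

theorem integral_div_U (hu : u ≤ u₁) :
    ∫ θ in Ioo 0 π, (d2 U₂ u θ * sin θ + U₂ u θ * cos θ) = 0 :=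
  integral_total_derivative D.smooth_U (fun θ hθ => D.bd_U u hu θ hθ 0 1 (by omega))
    hasDerivAt_sin (by fun_prop) (by simp) (by simp)

/-- The first moment of the divergence of `U₂`: it is the sum of a total derivative and of the
integral of `U₂ sin²`. -/
theorem integral_div_U_cos (hu : u ≤ u₁) :
    ∫ θ in Ioo 0 π, (d2 U₂ u θ * (sin θ * cos θ) + U₂ u θ * (cos θ * cos θ)) = 0 := by
  have h := integral_total_derivative D.smooth_U (fun θ hθ => D.bd_U u hu θ hθ 0 1 (by omega))
    (φ := fun θ => sin θ * cos θ) (φ' := fun θ => cos θ * cos θ + sin θ * -sin θ)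
    (fun θ => (hasDerivAt_sin θ).mul (hasDerivAt_cos θ)) (by fun_prop) (by simp) (by simp)
  have hU := D.integral_U_sin_sq hu
  have hi : IntegrableOn (fun θ => d2 U₂ u θ * (sin θ * cos θ) +
      U₂ u θ * (cos θ * cos θ + sin θ * -sin θ)) (Ioo 0 π) := by
    have i1 : IntegrableOn (d2 U₂ u) (Ioo 0 π) := integrableOn_of_bounded
      (D.smooth_U.sc.d2.aesm u) (fun θ hθ => D.bd_U u hu θ hθ 0 1 (by omega))
    have i2 : IntegrableOn (U₂ u) (Ioo 0 π) := integrableOn_of_bounded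
      (D.smooth_U.sc.aesm u) (fun θ hθ => D.bd_U u hu θ hθ 0 0 (by omega))
    refine Integrable.add (Integrable.mul_bdd (c := 1) i1 (by fun_prop) (ae_of_all _ fun θ => ?_))
      (Integrable.mul_bdd (c := 2) i2 (by fun_prop) (ae_of_all _ fun θ => ?_)) <;>
    · rw [norm_eq_abs, abs_le]
      constructor <;> nlinarith [sin_sq_add_cos_sq θ, sq_nonneg (sin θ + cos θ),
        sq_nonneg (sin θ - cos θ)]
  have hsum := integral_add hi (D.integrable_U_sin_sq hu)
  rw [h, hU, add_zero] at hsum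
  exact Eq.trans (integral_congr_ae (ae_of_all _ fun θ => by ring)) hsum

/-- The pointwise limits of the monotone mass integrate to a limit of its moments. -/
theorem tendsto_integral_mass {w : ℝ → ℝ} (hw : Continuous w) (hw1 : ∀ θ, |w θ| ≤ 1) :
    ∃ L, Tendsto (fun u => ∫ θ in Ioo 0 π, (m u θ + d2 U₂ u θ + cos θ / sin θ * U₂ u θ) *
      (sin θ * w θ)) atBot (𝓝 L) := by
  have := fun θ (hθ : θ ∈ Ioo 0 π) => D.exists_mass_limit hθ
  choose! A hA using this
  refine ⟨_, tendsto_integral_Ioo (K := 3 * K) ?_ ?_ fun θ hθ =>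
    (hA θ hθ).mul_const (sin θ * w θ)⟩
  · refine Eventually.of_forall fun u => ?_
    have : AEStronglyMeasurable (fun θ => cos θ / sin θ) (volume.restrict (Ioo 0 π)) := by
      refine ContinuousOn.aestronglyMeasurable (fun θ hθ => ?_) measurableSet_Ioo
      exact (hasDerivAt_cot hθ).continuousAt.continuousWithinAt
    exact (((D.smooth_m.sc.aesm u).add (D.smooth_U.sc.d2.aesm u)).add
      (this.mul (D.smooth_U.sc.aesm u))).mul (by fun_prop)
  · filter_upwards [eventually_le_atBot u₁] with u hu θ hθ
    have hs : 0 < sin θ := sin_pos_of_pos_of_lt_pi hθ.1 hθ.2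
    have h1 := D.bd_m u hu θ hθ 0 0 (by omega)
    have h2 := D.bd_U u hu θ hθ 0 1 (by omega)
    have h3 := D.bd_U u hu θ hθ 0 0 (by omega)
    have e : (m u θ + d2 U₂ u θ + cos θ / sin θ * U₂ u θ) * (sin θ * w θ) =
        (m u θ * sin θ + d2 U₂ u θ * sin θ + cos θ * U₂ u θ) * w θ := by field_simp
    have hs1 := abs_sin_le_one θ
    have hc1 := abs_cos_le_one θ
    rw [e, abs_mul]
    refine (mul_le_of_le_one_right (abs_nonneg _) (hw1 θ)).trans ?_
    refine (abs_add_three _ _ _).trans ?_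
    rw [abs_mul, abs_mul, abs_mul]
    have g1 := (mul_le_of_le_one_right (abs_nonneg (m u θ)) hs1).trans h1
    have g2 := (mul_le_of_le_one_right (abs_nonneg (d2 U₂ u θ)) hs1).trans h2
    have g3 := (mul_le_of_le_one_left (abs_nonneg (U₂ u θ)) hc1).trans h3
    linarith

theorem integrable_m {w : ℝ → ℝ} (hw : Continuous w) (hw1 : ∀ θ, |w θ| ≤ 1) (hu : u ≤ u₁) :
    IntegrableOn (fun θ => m u θ * (sin θ * w θ)) (Ioo 0 π) := by
  refine integrableOn_of_bounded (K := K)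
    ((D.smooth_m.sc.aesm u).mul (by fun_prop)) fun θ hθ => ?_
  rw [abs_mul, abs_mul]
  refine (mul_le_of_le_one_right (abs_nonneg _) ?_).trans (D.bd_m u hu θ hθ 0 0 (by omega))
  exact mul_le_one₀ (abs_sin_le_one θ) (abs_nonneg _) (hw1 θ)

theorem integrable_div_U {w : ℝ → ℝ} (hw : Continuous w) (hw1 : ∀ θ, |w θ| ≤ 1) (hu : u ≤ u₁) :
    IntegrableOn (fun θ => d2 U₂ u θ * (sin θ * w θ) + U₂ u θ * (cos θ * w θ)) (Ioo 0 π) := by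
  refine integrableOn_of_bounded (K := K + K) (((D.smooth_U.sc.d2.aesm u).mul (by fun_prop)).add
    ((D.smooth_U.sc.aesm u).mul (by fun_prop))) fun θ hθ => ?_
  refine (abs_add_le _ _).trans ?_
  rw [abs_mul, abs_mul, abs_mul, abs_mul]
  refine add_le_add
    ((mul_le_of_le_one_right (abs_nonneg _) ?_).trans (D.bd_U u hu θ hθ 0 1 (by omega)))
    ((mul_le_of_le_one_right (abs_nonneg _) ?_).trans (D.bd_U u hu θ hθ 0 0 (by omega)))
  · exact mul_le_one₀ (abs_sin_le_one θ) (abs_nonneg _) (hw1 θ)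
  · exact mul_le_one₀ (abs_cos_le_one θ) (abs_nonneg _) (hw1 θ)

/-- The integrals of `m` and `m cos θ` over the sphere agree with those of the monotone mass
function, hence converge. -/
theorem exists_tendsto_integral_m {w : ℝ → ℝ} (hw : Continuous w) (hw1 : ∀ θ, |w θ| ≤ 1)
    (h0 : ∀ u ≤ u₁,
      ∫ θ in Ioo 0 π, (d2 U₂ u θ * (sin θ * w θ) + U₂ u θ * (cos θ * w θ)) = 0) :
    ∃ L, Tendsto (fun u => ∫ θ in Ioo 0 π, m u θ * (sin θ * w θ)) atBot (𝓝 L) := by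
  obtain ⟨L, hL⟩ := D.tendsto_integral_mass hw hw1
  refine ⟨L, hL.congr' ?_⟩
  filter_upwards [eventually_le_atBot u₁] with u hu
  have hsum := integral_add (D.integrable_m hw hw1 hu) (D.integrable_div_U hw hw1 hu)
  rw [h0 u hu, add_zero] at hsum
  refine Eq.trans ?_ hsum
  refine setIntegral_congr_fun measurableSet_Ioo fun θ hθ => ?_
  have hs : sin θ ≠ 0 := (sin_pos_of_pos_of_lt_pi hθ.1 hθ.2).ne'
  field_simp
  ring

theorem exists_tendsto_integral_m_sin :
    ∃ L, Tendsto (fun u => ∫ θ in Ioo 0 π, m u θ * sin θ) atBot (𝓝 L) := by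
  simpa using D.exists_tendsto_integral_m (w := fun _ => 1) (by fun_prop) (by simp)
    (by simpa using fun u hu => D.integral_div_U hu)

theorem exists_tendsto_integral_m_sin_cos :
    ∃ L, Tendsto (fun u => ∫ θ in Ioo 0 π, m u θ * (sin θ * cos θ)) atBot (𝓝 L) :=
  D.exists_tendsto_integral_m continuous_cos abs_cos_le_one fun _ hu => D.integral_div_U_cos hu

/-- The flux integral of the energy. -/
theorem integral_energy (hu : u ≤ u₁) :
    ∫ θ in Ioo 0 π, (2 * (m u θ * sin θ) + (d2 U₂ u θ * sin θ + U₂ u θ * cos θ)) =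
      2 * ∫ θ in Ioo 0 π, m u θ * sin θ := by
  have i1 := D.integrable_m (w := fun _ => 1) (by fun_prop) (by simp) hu
  have i2 := D.integrable_div_U (w := fun _ => 1) (by fun_prop) (by simp) hu
  simp only [mul_one] at i1 i2
  refine (integral_add (i1.const_mul 2) i2).trans ?_
  rw [D.integral_div_U hu, add_zero, integral_const_mul]

/-- The flux integral of the third component of the momentum. -/
theorem integral_momentum (hu : u ≤ u₁) :
    ∫ θ in Ioo 0 π, (cos θ * (d2 U₂ u θ * sin θ + U₂ u θ * cos θ + 2 * (m u θ * sin θ)) -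
      sin θ * (U₂ u θ * sin θ - 1 / 2 * (d2 m u θ * sin θ))) =
      ∫ θ in Ioo 0 π, m u θ * (sin θ * cos θ) := by
  have h := integral_total_derivative D.smooth_m (fun θ hθ => D.bd_m u hu θ hθ 0 1 (by omega))
    (φ := fun θ => sin θ ^ 2) (φ' := fun θ => 2 * sin θ * cos θ)
    (fun θ => ((hasDerivAt_sin θ).pow 2).congr_deriv (by simp)) (by fun_prop) (by simp) (by simp)
  have i1 := D.integrable_m continuous_cos abs_cos_le_one hu
  have i2 := D.integrable_div_U continuous_cos abs_cos_le_one hu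
  have i3 := D.integrable_U_sin_sq hu
  have i4 : IntegrableOn (fun θ => d2 m u θ * sin θ ^ 2 + m u θ * (2 * sin θ * cos θ))
      (Ioo 0 π) := by
    have j : IntegrableOn (d2 m u) (Ioo 0 π) := integrableOn_of_bounded
      (D.smooth_m.sc.d2.aesm u) (fun θ hθ => D.bd_m u hu θ hθ 0 1 (by omega))
    refine Integrable.add (Integrable.mul_bdd (c := 1) j (by fun_prop) (ae_of_all _ fun θ => ?_))
      ((i1.const_mul 2).congr (ae_of_all _ fun θ => by ring))
    rw [norm_eq_abs, abs_of_nonneg (sq_nonneg _)]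
    exact sin_sq_le_one θ
  have e := integral_add ((i1.add i2).sub i3) (i4.const_mul (1 / 2))
  have e' := integral_sub (i1.add i2) i3
  have e'' := integral_add i1 i2
  simp only [Pi.add_apply, Pi.sub_apply] at e e' e''
  rw [integral_const_mul, h, e', e'', D.integral_div_U_cos hu, D.integral_U_sin_sq hu] at e
  simp only [mul_zero, add_zero, sub_zero] at e
  rw [← e]
  exact integral_congr_ae (ae_of_all _ fun θ => by ring)

theorem tendsto_integral_c_d0_c :
    Tendsto (fun u => ∫ θ in (0 : ℝ)..π, c u θ * d0 c u θ * sin θ) atBot (𝓝 0) := by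
  simp only [integral_Ioo_eq]
  have hK := D.K_nonneg
  refine tendsto_integral_Ioo_zero (K := K * K) (Eventually.of_forall fun u =>
    ((D.smooth_c.sc.aesm u).mul (D.smooth_c.sc.d0.aesm u)).mul (by fun_prop)) ?_ fun θ hθ => ?_
  · filter_upwards [eventually_le_atBot u₁] with u hu θ hθ
    rw [abs_mul, abs_mul]
    refine (mul_le_of_le_one_right (by positivity) (abs_sin_le_one θ)).trans ?_
    exact mul_le_mul (D.bd_c u hu θ hθ 0 0 (by omega)) (D.bd_c u hu θ hθ 1 0 (by omega))
      (abs_nonneg _) hK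
  · have : Tendsto (fun u => c u θ * d0 c u θ) atBot (𝓝 0) := by
      refine bdd_le_mul_tendsto_zero' K ?_ (D.tendsto_d0_c hθ)
      filter_upwards [eventually_le_atBot u₁] with u hu
      exact D.bd_c u hu θ hθ 0 0 (by omega)
    simpa using this.mul_const (sin θ)

/-- The integrand of the momentum correction in terms of functions bounded up to the poles. -/
theorem correction_integrand (κ : ℝ) (hu : u < u₁) {θ : ℝ} (hθ : θ ∈ Ioo 0 π) :
    (-(d0 c u θ) ^ 2 + d0 (d2 (d2 c)) u θ / 2 + κ * (d0 (d2 c) u θ * cot θ)) *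
      (d2 c u θ + 2 * c u θ * cot θ) * sin θ ^ 2 =
    U₂ u θ * (d0 c u θ * (d0 c u θ * sin θ ^ 2) + d0 (d2 U₂) u θ * (sin θ ^ 2 / 2) +
      d0 (d2 c) u θ * ((1 - κ) * (cos θ * sin θ)) - d0 c u θ) := by
  have hs : sin θ ≠ 0 := (sin_pos_of_pos_of_lt_pi hθ.1 hθ.2).ne'
  have e : U₂ u θ = -(d2 c u θ + 2 * c u θ * cot θ) := by
    rw [cot_eq_cos_div_sin]; linarith [D.eq_U u hu.le θ hθ]
  rw [e, D.d0_d2_d2_c hu hθ, cot_eq_cos_div_sin]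
  field_simp
  ring

/-- The value of `κ` is immaterial: it multiplies a term with a factor `∂_u ∂_θ c`. -/
theorem tendsto_momentumCorrection (κ : ℝ) :
    Tendsto (momentumCorrection c κ) atBot (𝓝 0) := by
  have hK := D.K_nonneg
  have key : Tendsto (fun u => ∫ θ in Ioo 0 π, U₂ u θ * (d0 c u θ * (d0 c u θ * sin θ ^ 2) +
      d0 (d2 U₂) u θ * (sin θ ^ 2 / 2) + d0 (d2 c) u θ * ((1 - κ) * (cos θ * sin θ)) -
      d0 c u θ)) atBot (𝓝 0) := by
    refine tendsto_integral_Ioo_zero (K := K * (K * K + K + K * |1 - κ| + K))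
      (Eventually.of_forall fun u => ?_) ?_ fun θ hθ => ?_
    · exact (D.smooth_U.sc.aesm u).mul (((((D.smooth_c.sc.d0.aesm u).mul
        ((D.smooth_c.sc.d0.aesm u).mul (by fun_prop))).add
        ((D.smooth_U.sc.d2.d0.aesm u).mul (by fun_prop))).add
        ((D.smooth_c.sc.d2.d0.aesm u).mul (by fun_prop))).sub (D.smooth_c.sc.d0.aesm u))
    · filter_upwards [eventually_le_atBot u₁] with u hu θ hθ
      have hs : |sin θ ^ 2| ≤ 1 := by
        rw [abs_of_nonneg (sq_nonneg _)]; exact sin_sq_le_one θ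
      have h1 := D.bd_c u hu θ hθ 1 0 (by omega)
      have h2 := D.bd_U u hu θ hθ 1 1 (by omega)
      have h3 := D.bd_c u hu θ hθ 1 1 (by omega)
      rw [abs_mul]
      refine mul_le_mul (D.bd_U u hu θ hθ 0 0 (by omega)) ?_ (abs_nonneg _) hK
      refine (abs_sub _ _).trans (add_le_add ((abs_add_three _ _ _).trans
        (add_le_add (add_le_add ?_ ?_) ?_)) h1)
      · rw [abs_mul, abs_mul]
        exact mul_le_mul h1 ((mul_le_of_le_one_right (abs_nonneg _) hs).trans h1)
          (by positivity) hK
      · rw [abs_mul]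
        refine (mul_le_of_le_one_right (abs_nonneg _) ?_).trans h2
        rw [abs_div, abs_two]; linarith
      · rw [abs_mul, abs_mul, abs_mul]
        refine mul_le_mul h3 (mul_le_of_le_one_right (abs_nonneg _) ?_) (by positivity) hK
        exact mul_le_one₀ (abs_cos_le_one θ) (abs_nonneg _) (abs_sin_le_one θ)
    · refine bdd_le_mul_tendsto_zero' K ?_ ?_
      · filter_upwards [eventually_le_atBot u₁] with u hu
        exact D.bd_U u hu θ hθ 0 0 (by omega)
      · have h1 := D.tendsto_d0_c hθ
        have h2 := D.tendsto_d0_d2_U θ hθ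
        have h3 := D.tendsto_d0_d2_c θ hθ
        simpa using ((((h1.mul (h1.mul_const (sin θ ^ 2))).add (h2.mul_const (sin θ ^ 2 / 2))).add
          (h3.mul_const ((1 - κ) * (cos θ * sin θ)))).sub h1)
  refine key.congr' ?_
  filter_upwards [eventually_lt_atBot u₁] with u hu
  rw [momentumCorrection, integral_Ioo_eq]
  exact setIntegral_congr_fun measurableSet_Ioo fun θ hθ =>
    (D.correction_integrand κ hu hθ).symm

end ScriData

end

/-! ### The leading coefficients of a radiating vacuum solution -/

section

/-- The metric functions have leading coefficients `c`, `b`, `U₂`, `m`, uniformly for `u → -∞` and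
`r → ∞`. -/
structure BondiData.Leading (S : BondiData) (c b U₂ m : ℝ → ℝ → ℝ) : Prop where
  γ : LeadingTerm S.γ 1 c
  β : LeadingTerm S.β 2 b
  U : LeadingTerm S.U 2 U₂
  W : LeadingTerm S.W 0 m

/-- The radiation condition provides the expansions, the decay conditions their uniformity as
`u → -∞`. -/
theorem exists_leading {S : BondiData} {r₀ : ℝ} (hr₀ : 0 ≤ r₀) (hsmooth : S.Smooth r₀)
    {c M : ℝ → ℝ → ℝ} (hrad : S.OutgoingRadiation c M) (hD : S.ConditionD) :
    ∃ b U₂, SmoothCoeff c ∧ SmoothCoeff b ∧ SmoothCoeff U₂ ∧ SmoothCoeff (fun u θ => 2 * M u θ) ∧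
      S.Leading c b U₂ fun u θ => 2 * M u θ := by
  obtain ⟨hc, hM, γ₃, β₂, U₂, U₃, V₁, h₁, h₂, h₃, h₄, h₅, eγ, eβ, eU, eV⟩ := hrad
  obtain ⟨Dγ, Dβ, DU, DV⟩ := hD
  have hS := hsmooth.regular hr₀
  have h2M : SmoothCoeff (fun u θ => 2 * M u θ) := contDiffOn_const.mul hM
  refine ⟨β₂, U₂, hc, h₂, h₃, h2M, ?_, ?_, ?_, ?_⟩
  · refine leadingTerm_of_decay hr₀ hS.γ hc h₁ (q := 3) (m := 4) (by norm_num) (by norm_num) ?_ Dγ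
    convert eγ using 4
    simp [mono, div_eq_mul_inv, sub_sub]
  · refine leadingTerm_of_decay hr₀ hS.β h₂ (b := fun _ _ => 0) contDiffOn_const
      (q := 3) (m := 4) (by norm_num) (by norm_num) ?_ Dβ
    convert eβ using 4
    simp [mono, div_eq_mul_inv]
  · refine leadingTerm_of_decay hr₀ hS.U h₃ h₄ (q := 3) (m := 4) (by norm_num) (by norm_num) ?_ DU
    convert eU using 4
    simp [mono, div_eq_mul_inv, sub_sub]
  · refine leadingTerm_of_decay hr₀ hS.W h2M h₅ (q := 1) (m := 2) (by norm_num) (by norm_num) ?_ DV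
    convert eV using 4
    simp [mono, div_eq_mul_inv, BondiData.W]
    ring

theorem LeadingTerm.cjet_bound {f : ℝ → ℝ → ℝ → ℝ} {p : ℕ} {a : ℝ → ℝ → ℝ}
    (h : LeadingTerm f p a) : ∃ K, ∀ᶠ u in atBot, ∀ θ ∈ Ioo 0 π, ∀ i l : ℕ, i + l ≤ 2 →
      |cjet i l a u θ| ≤ K := by
  obtain ⟨K, hK⟩ := h
  refine ⟨K, hK.curry.mono fun u hu θ hθ i l hil => ?_⟩
  obtain ⟨r, hr⟩ := hu.exists
  exact (hr θ hθ i 0 l (by omega)).1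

/-- Close to spatial infinity the leading coefficients are bounded and satisfy the two relations
implied by the vacuum equations. -/
theorem BondiData.Leading.scriData {S : BondiData} {r₀ : ℝ} (hS : S.Regular r₀)
    (hvac : S.IsVacuum r₀) {c b U₂ m : ℝ → ℝ → ℝ} (h : S.Leading c b U₂ m) (hc : SmoothCoeff c)
    (hU : SmoothCoeff U₂) (hm : SmoothCoeff m) : ∃ K u₁, ScriData c U₂ m K u₁ := by
  obtain ⟨K, hK⟩ := h.γ.cjet_bound
  obtain ⟨K', hK'⟩ := h.U.cjet_bound
  obtain ⟨K'', hK''⟩ := h.W.cjet_bound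
  obtain ⟨u₁, hu₁⟩ := eventually_atBot.1 <| ((hK.and hK').and hK'').and
    (((h.γ.jetAsym hS.γ).and (h.β.jetAsym hS.β)).and ((h.U.jetAsym hS.U).and (h.W.jetAsym hS.W)))
  have hE : ∀ u ≤ u₁, ∀ θ ∈ Ioo 0 π, S.Expansion c b U₂ m u θ := fun u hu θ hθ =>
    ⟨(hu₁ u hu).2.1.1 θ hθ, (hu₁ u hu).2.1.2 θ hθ, (hu₁ u hu).2.2.1 θ hθ, (hu₁ u hu).2.2.2 θ hθ⟩
  refine ⟨max K (max K' K''), u₁, hc, hU, hm, fun u hu θ hθ i l hil => ?_,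
    fun u hu θ hθ i l hil => ?_, fun u hu θ hθ i l hil => ?_, fun u hu θ hθ => ?_,
    fun u hu θ hθ => ?_⟩
  · exact ((hu₁ u hu).1.1.1 θ hθ i l hil).trans (le_max_left _ _)
  · exact ((hu₁ u hu).1.1.2 θ hθ i l hil).trans ((le_max_left _ _).trans (le_max_right _ _))
  · exact ((hu₁ u hu).1.2 θ hθ i l hil).trans ((le_max_right _ _).trans (le_max_right _ _))
  · exact vacuum_rθ hS hvac (hE u hu θ hθ) hθ
  · exact vacuum_uu hS hvac (hE u hu θ hθ) hθ

end

/-! ### The slices `u + r = t` -/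

section

/-- The restriction of a function of `(u, r, θ)` to the slice `u + r = t`. -/
def onSlice (t : ℝ) (F : ℝ → ℝ → ℝ → ℝ) (y : Fin 3 → ℝ) : ℝ := F (t - y 0) (y 0) (y 1)

variable {r₀ t r θ ψ : ℝ} {F : ℝ → ℝ → ℝ → ℝ} {S : BondiData}

/-- The differential of `onSlice t F`. -/
noncomputable def dSlice (F : ℝ → ℝ → ℝ → ℝ) (u r θ : ℝ) : Fin 3 → ℝ :=
  ![par 1 F u r θ - par 0 F u r θ, par 2 F u r θ, 0]

theorem pd_onSlice (hF : Smth r₀ F) (hr : r₀ < r) (hθ : θ ∈ Ioo 0 π) (i : Fin 3) :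
    pd i (onSlice t F) ![r, θ, ψ] = dSlice F (t - r) r θ i := by
  fin_cases i
  · simpa [pd, onSlice, dSlice] using (hF.hasDerivAt_slice (t := t) hr hθ).deriv
  · simp [pd, onSlice, dSlice, par]
  · simp [pd, onSlice, dSlice]

theorem deriv_onSlice (F : ℝ → ℝ → ℝ → ℝ) :
    deriv (fun s => onSlice s F ![r, θ, ψ]) t = par 0 F (t - r) r θ := by
  simp only [onSlice, par, Matrix.cons_val_zero, Matrix.cons_val_one]
  exact deriv_comp_sub_const (fun s => F s r θ) r t

/-- `g_{rr}` on the slices. -/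
noncomputable def sliceA (S : BondiData) : ℝ → ℝ → ℝ → ℝ := fun u r θ =>
  guu S u r θ - 2 * gur S u r θ

/-- `g_{rθ}` on the slices. -/
noncomputable def sliceB (S : BondiData) : ℝ → ℝ → ℝ → ℝ := fun u r θ => -guθ S u r θ

/-- The radial component of the shift covector. -/
noncomputable def sliceX (S : BondiData) : ℝ → ℝ → ℝ → ℝ := fun u r θ => gur S u r θ - guu S u r θ

/-- The coordinate change `u = t - r` has a constant Jacobian matrix `J`, and the metric becomes
`Jᵀ g J`. -/
theorem tMetric_eq (S : BondiData) (t : ℝ) (y : Fin 3 → ℝ) : tMetric S (Matrix.vecCons t y) =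
    !![onSlice t (guu S) y, onSlice t (sliceX S) y, onSlice t (guθ S) y, 0;
       onSlice t (sliceX S) y, onSlice t (sliceA S) y, onSlice t (sliceB S) y, 0;
       onSlice t (guθ S) y, onSlice t (sliceB S) y, onSlice t (gθθ S) y, 0;
       0, 0, 0, onSlice t (gψψ S) y] := by
  have h : tMetric S (Matrix.vecCons t y) =
      (!![1, -1, 0, 0; 0, 1, 0, 0; 0, 0, 1, 0; 0, 0, 0, 1] : Matrix (Fin 4) (Fin 4) ℝ).transpose *
      !![onSlice t (guu S) y, onSlice t (gur S) y, onSlice t (guθ S) y, 0;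
       onSlice t (gur S) y, 0, 0, 0;
       onSlice t (guθ S) y, 0, onSlice t (gθθ S) y, 0;
       0, 0, 0, onSlice t (gψψ S) y] *
      !![1, -1, 0, 0; 0, 1, 0, 0; 0, 0, 1, 0; 0, 0, 0, 1] := rfl
  have hX : onSlice t (sliceX S) y = onSlice t (gur S) y - onSlice t (guu S) y := rfl
  have hA : onSlice t (sliceA S) y = onSlice t (guu S) y - 2 * onSlice t (gur S) y := rfl
  have hB : onSlice t (sliceB S) y = -onSlice t (guθ S) y := rfl
  rw [h, hX, hA, hB]
  generalize onSlice t (guu S) y = a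
  generalize onSlice t (gur S) y = b
  generalize onSlice t (guθ S) y = c
  generalize onSlice t (gθθ S) y = d
  generalize onSlice t (gψψ S) y = e
  ext i j
  fin_cases i <;> fin_cases j <;>
    simp [Matrix.mul_apply, Fin.sum_univ_four] <;> ring

theorem inducedMetric_eq (S : BondiData) (t : ℝ) (y : Fin 3 → ℝ) : inducedMetric S t y =
    !![onSlice t (sliceA S) y, onSlice t (sliceB S) y, 0;
       onSlice t (sliceB S) y, onSlice t (gθθ S) y, 0;
       0, 0, onSlice t (gψψ S) y] := by
  rw [inducedMetric, tMetric_eq]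
  ext i j
  fin_cases i <;> fin_cases j <;> rfl

theorem shift_eq (S : BondiData) (t : ℝ) (i : Fin 3) :
    shift S t i = onSlice t (![sliceX S, guθ S, fun _ _ _ => 0] i) := by
  funext y
  rw [shift, tMetric_eq]
  fin_cases i <;> rfl

variable (hS : S.Regular r₀) (hr : r₀ < r) (hθ : θ ∈ Ioo 0 π)

include hS in
theorem smth_guu : Smth r₀ (guu S) := by
  have hr : ContDiffOn ℝ ∞ (fun p : ℝ × ℝ × ℝ => p.2.1) (region r₀) := by fun_prop
  have hV : ContDiffOn ℝ ∞ (fun p : ℝ × ℝ × ℝ => S.V p.1 p.2.1 p.2.2) (region r₀) := by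
    refine (ContDiffOn.sub hS.W hr).congr fun p _ => ?_
    simp [BondiData.W]
  have hβ : ContDiffOn ℝ ∞ (fun p : ℝ × ℝ × ℝ => S.β p.1 p.2.1 p.2.2) (region r₀) := hS.β
  have hγ : ContDiffOn ℝ ∞ (fun p : ℝ × ℝ × ℝ => S.γ p.1 p.2.1 p.2.2) (region r₀) := hS.γ
  have hU : ContDiffOn ℝ ∞ (fun p : ℝ × ℝ × ℝ => S.U p.1 p.2.1 p.2.2) (region r₀) := hS.U
  exact ((hV.div hr fun p hp => (hS.nonneg.trans_lt hp.1).ne').mul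
    (contDiffOn_const.mul hβ).exp).add (((hr.pow 2).mul (contDiffOn_const.mul hγ).exp).mul
    (hU.pow 2))

include hS in
theorem smth_gur : Smth r₀ (gur S) :=
  ContDiffOn.neg (ContDiffOn.exp (contDiffOn_const.mul hS.β))

include hS in
theorem smth_gθθ : Smth r₀ (gθθ S) := by
  have hr : ContDiffOn ℝ ∞ (fun p : ℝ × ℝ × ℝ => p.2.1) (region r₀) := by fun_prop
  exact (hr.pow 2).mul (contDiffOn_const.mul hS.γ).exp

include hS in
theorem smth_guθ : Smth r₀ (guθ S) := ContDiffOn.neg (ContDiffOn.mul (smth_gθθ hS) hS.U)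

include hS in
theorem smth_gψψ : Smth r₀ (gψψ S) := by
  have hr : ContDiffOn ℝ ∞ (fun p : ℝ × ℝ × ℝ => p.2.1) (region r₀) := by fun_prop
  have hs : ContDiffOn ℝ ∞ (fun p : ℝ × ℝ × ℝ => sin p.2.2) (region r₀) := by fun_prop
  exact ((hr.pow 2).mul (contDiffOn_const.mul hS.γ).exp).mul (hs.pow 2)

include hS in
theorem smth_sliceA : Smth r₀ (sliceA S) :=
  ContDiffOn.sub (smth_guu hS) (contDiffOn_const.mul (smth_gur hS))

include hS in
theorem smth_sliceX : Smth r₀ (sliceX S) := (smth_gur hS).sub (smth_guu hS)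

include hS in
theorem smth_sliceB : Smth r₀ (sliceB S) := ContDiffOn.neg (smth_guθ hS)

include hS hr hθ

/-- The inverse of the induced metric. -/
theorem inducedMetric_inv (hv : 0 < 1 + S.W (t - r) r θ / r) :
    (inducedMetric S t ![r, θ, ψ])⁻¹ =
      let E := exp (2 * S.β (t - r) r θ)
      let G := exp (2 * S.γ (t - r) r θ)
      let U := S.U (t - r) r θ
      let v := 1 + S.W (t - r) r θ / r
      !![(v * E)⁻¹, -(U * (v * E)⁻¹), 0;
         -(U * (v * E)⁻¹), (r ^ 2 * G)⁻¹ + U ^ 2 * (v * E)⁻¹, 0;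
         0, 0, G * (r ^ 2 * sin θ ^ 2)⁻¹] := by
  have hr0 : r ≠ 0 := (hS.nonneg.trans_lt hr).ne'
  have hs : sin θ ≠ 0 := (sin_pos_of_pos_of_lt_pi hθ.1 hθ.2).ne'
  have hE := (exp_pos (2 * S.β (t - r) r θ)).ne'
  have hG := (exp_pos (2 * S.γ (t - r) r θ)).ne'
  have hV : S.V (t - r) r θ = (1 + S.W (t - r) r θ / r - 2) * r := by
    simp only [BondiData.W]; field_simp; ring
  apply Matrix.inv_eq_left_inv
  rw [inducedMetric_eq]
  simp only [onSlice, sliceA, sliceB, guu, gur, guθ, gθθ, gψψ, Matrix.cons_val_zero,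
    Matrix.cons_val_one, neg_mul, exp_neg, hV]
  generalize exp (2 * S.β (t - r) r θ) = E at *
  generalize exp (2 * S.γ (t - r) r θ) = G at *
  generalize S.U (t - r) r θ = U at *
  generalize 1 + S.W (t - r) r θ / r = v at *
  have hv' := hv.ne'
  ext i j
  fin_cases i <;> fin_cases j <;> simp [Matrix.mul_apply, Fin.sum_univ_three] <;> field_simp <;>
    ring

/-- The component `g^{tt}` is the sum of the entries of the inverse Bondi metric in the
`u`, `r` block. -/
theorem lapse_eq : lapse S t ![r, θ, ψ] =
    (√((1 + S.W (t - r) r θ / r) * (exp (2 * S.β (t - r) r θ))⁻¹))⁻¹ := by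
  have hr0 : 0 < r := hS.nonneg.trans_lt hr
  have hJ : (!![1, -1, 0, 0; 0, 1, 0, 0; 0, 0, 1, 0; 0, 0, 0, 1] :
      Matrix (Fin 4) (Fin 4) ℝ)⁻¹ = !![1, 1, 0, 0; 0, 1, 0, 0; 0, 0, 1, 0; 0, 0, 0, 1] := by
    apply Matrix.inv_eq_left_inv
    ext i j
    fin_cases i <;> fin_cases j <;> simp [Matrix.mul_apply, Fin.sum_univ_four]
  have h : tMetric S (Matrix.vecCons t ![r, θ, ψ]) =
      (!![1, -1, 0, 0; 0, 1, 0, 0; 0, 0, 1, 0; 0, 0, 0, 1] : Matrix (Fin 4) (Fin 4) ℝ).transpose *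
      bondiMetric S ![t - r, r, θ, ψ] *
      !![1, -1, 0, 0; 0, 1, 0, 0; 0, 0, 1, 0; 0, 0, 0, 1] := rfl
  have hV : S.V (t - r) r θ / r = 1 + S.W (t - r) r θ / r - 2 := by
    simp only [BondiData.W]; field_simp; ring
  rw [lapse, h, Matrix.mul_inv_rev, Matrix.mul_inv_rev, ← Matrix.transpose_nonsing_inv, hJ,
    bondiMetric_inv S ψ hr0 hθ, hV]
  congr 2
  simp only [Matrix.mul_apply, Fin.sum_univ_four, Matrix.transpose_apply]
  simp
  ring

end

/-! ### The second fundamental form -/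

section

/-- The symmetrised covariant derivative of a covector field, with the derivatives of the metric
written out. -/
theorem covDCovector_add_swap {n : ℕ} (g : (Fin n → ℝ) → Matrix (Fin n) (Fin n) ℝ)
    (hg : ∀ y i j, g y i j = g y j i) (X : Fin n → (Fin n → ℝ) → ℝ) (i j : Fin n)
    (x : Fin n → ℝ) : covDCovector g X i j x + covDCovector g X j i x =
      pd i (X j) x + pd j (X i) x - ∑ l, (∑ k, (g x)⁻¹ k l * X k x) *
        (pd i (fun y => g y j l) x + pd j (fun y => g y i l) x - pd l (fun y => g y i j) x) := by
  have hs : ∀ k, christoffel g k j i x = christoffel g k i j x := by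
    intro k
    simp only [christoffel]
    congr 1
    refine Finset.sum_congr rfl fun l _ => ?_
    simp only [fun y => hg y j i]
    ring
  have e : 2 * ∑ k, christoffel g k i j x * X k x = ∑ l, (∑ k, (g x)⁻¹ k l * X k x) *
      (pd i (fun y => g y j l) x + pd j (fun y => g y i l) x - pd l (fun y => g y i j) x) := by
    simp only [christoffel, Finset.mul_sum, Finset.sum_mul]
    rw [Finset.sum_comm]
    refine Finset.sum_congr rfl fun l _ => Finset.sum_congr rfl fun k _ => ?_
    ring
  simp only [covDCovector, hs]
  rw [← e]
  ring

variable {r₀ t r θ ψ : ℝ} {S : BondiData}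

/-- The functions `2 𝒩 h_{ij}` as functions of `(u, r, θ)`. -/
noncomputable def extr (S : BondiData) (u r θ : ℝ) : Matrix (Fin 3) (Fin 3) ℝ :=
  let v := 1 + S.W u r θ / r
  -- the components of the shift vector
  let x := -(S.W u r θ / (r * v))
  let y := -(S.U u r θ / v)
  let dA := dSlice (sliceA S) u r θ
  let dB := dSlice (sliceB S) u r θ
  let dD := dSlice (gθθ S) u r θ
  let dE := dSlice (gψψ S) u r θ
  let Hrθ := -dB 0 + dSlice (sliceX S) u r θ 1 - x * dA 1 - y * dD 0 - par 0 (sliceB S) u r θ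
  !![2 * dSlice (sliceX S) u r θ 0 - x * dA 0 - y * (2 * dB 0 - dA 1) - par 0 (sliceA S) u r θ,
      Hrθ, 0;
    Hrθ, -2 * dB 1 - x * (2 * dB 1 - dD 0) - y * dD 1 - par 0 (gθθ S) u r θ, 0;
    0, 0, x * dE 0 + y * dE 1 - par 0 (gψψ S) u r θ]

variable (hS : S.Regular r₀) (hr : r₀ < r) (hθ : θ ∈ Ioo 0 π)
include hS hr hθ

/-- The components of the shift with raised index. -/
theorem shift_vector (hv : 0 < 1 + S.W (t - r) r θ / r) (l : Fin 3) :
    ∑ k, (inducedMetric S t ![r, θ, ψ])⁻¹ k l * shift S t k ![r, θ, ψ] =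
      ![-(S.W (t - r) r θ / (r * (1 + S.W (t - r) r θ / r))),
        -(S.U (t - r) r θ / (1 + S.W (t - r) r θ / r)), 0] l := by
  have hr0 : r ≠ 0 := (hS.nonneg.trans_lt hr).ne'
  have hE := (exp_pos (2 * S.β (t - r) r θ)).ne'
  have hG := (exp_pos (2 * S.γ (t - r) r θ)).ne'
  have hV : S.V (t - r) r θ = (1 + S.W (t - r) r θ / r - 2) * r := by
    simp only [BondiData.W]; field_simp; ring
  have hW : S.W (t - r) r θ = (1 + S.W (t - r) r θ / r - 1) * r := by field_simp; ring
  simp only [inducedMetric_inv hS hr hθ hv, shift_eq, Fin.sum_univ_three]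
  generalize 1 + S.W (t - r) r θ / r = v at *
  have e0 : onSlice t (sliceX S) ![r, θ, ψ] = -exp (2 * S.β (t - r) r θ) -
      (S.V (t - r) r θ / r * exp (2 * S.β (t - r) r θ) +
        r ^ 2 * exp (2 * S.γ (t - r) r θ) * S.U (t - r) r θ ^ 2) := rfl
  have e1 : onSlice t (guθ S) ![r, θ, ψ] =
      -(r ^ 2 * exp (2 * S.γ (t - r) r θ) * S.U (t - r) r θ) := rfl
  have e2 : onSlice t (fun _ _ _ => 0) ![r, θ, ψ] = 0 := rfl
  rw [hW]
  rw [hV] at e0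
  generalize exp (2 * S.β (t - r) r θ) = E at *
  generalize exp (2 * S.γ (t - r) r θ) = G at *
  generalize S.U (t - r) r θ = U at *
  have hv' := hv.ne'
  fin_cases l <;> simp [e0, e1, e2] <;> field_simp <;> ring

theorem pd_inducedMetric (i j l : Fin 3) :
    pd i (fun y => inducedMetric S t y j l) ![r, θ, ψ] =
      (!![dSlice (sliceA S) (t - r) r θ i, dSlice (sliceB S) (t - r) r θ i, 0;
        dSlice (sliceB S) (t - r) r θ i, dSlice (gθθ S) (t - r) r θ i, 0;
        0, 0, dSlice (gψψ S) (t - r) r θ i] : Matrix (Fin 3) (Fin 3) ℝ) j l := by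
  have h0 : pd i (fun _ => (0 : ℝ)) ![r, θ, ψ] = 0 := by simp [pd]
  simp only [inducedMetric_eq]
  fin_cases j <;> fin_cases l <;> first
    | exact pd_onSlice (smth_sliceA hS) hr hθ i
    | exact pd_onSlice (smth_sliceB hS) hr hθ i
    | exact pd_onSlice (smth_gθθ hS) hr hθ i
    | exact pd_onSlice (smth_gψψ hS) hr hθ i
    | exact h0

theorem secondFundamentalForm_eq (hv : 0 < 1 + S.W (t - r) r θ / r) (i j : Fin 3) :
    secondFundamentalForm S t i j ![r, θ, ψ] =
      1 / (2 * lapse S t ![r, θ, ψ]) * extr S (t - r) r θ i j := by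
  have hX : ∀ i j, pd i (shift S t j) ![r, θ, ψ] =
      ![dSlice (sliceX S) (t - r) r θ i, -dSlice (sliceB S) (t - r) r θ i, 0] j := by
    intro i j
    rw [shift_eq]
    fin_cases j
    · exact pd_onSlice (smth_sliceX hS) hr hθ i
    · refine (pd_onSlice (smth_guθ hS) hr hθ i).trans ?_
      fin_cases i <;> simp [dSlice, sliceB, par]
      ring
    · simp [pd, onSlice]
  have ht : deriv (fun s => inducedMetric S s ![r, θ, ψ] i j) t =
      (!![par 0 (sliceA S) (t - r) r θ, par 0 (sliceB S) (t - r) r θ, 0;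
        par 0 (sliceB S) (t - r) r θ, par 0 (gθθ S) (t - r) r θ, 0;
        0, 0, par 0 (gψψ S) (t - r) r θ] : Matrix (Fin 3) (Fin 3) ℝ) i j := by
    simp only [inducedMetric_eq]
    fin_cases i <;> fin_cases j <;> first
      | exact deriv_onSlice (sliceA S)
      | exact deriv_onSlice (sliceB S)
      | exact deriv_onSlice (gθθ S)
      | exact deriv_onSlice (gψψ S)
      | exact deriv_const t (0 : ℝ)
  rw [secondFundamentalForm, covDCovector_add_swap, ht]
  · congr 1
    simp only [hX, shift_vector hS hr hθ hv, pd_inducedMetric hS hr hθ, Fin.sum_univ_three, extr]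
    have d2 : ∀ F, dSlice F (t - r) r θ 2 = 0 := fun F => rfl
    fin_cases i <;> fin_cases j <;> simp [d2] <;> ring
  · intro y i j
    rw [inducedMetric_eq]
    fin_cases i <;> fin_cases j <;> rfl

/-- The trace of `2 𝒩 h` over the sphere directions, up to the factor `r²`. -/
noncomputable def angTrace (S : BondiData) (u r θ : ℝ) : ℝ :=
  (exp (-2 * S.γ u r θ) + r ^ 2 * S.U u r θ ^ 2 *
    ((1 + S.W u r θ / r) * exp (2 * S.β u r θ))⁻¹) * extr S u r θ 1 1 +
    exp (2 * S.γ u r θ) * (sin θ ^ 2)⁻¹ * extr S u r θ 2 2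

/-- `r² (h_{rr} - g_{rr} tr h)` -/
noncomputable def radialMomentum (S : BondiData) (u r θ : ℝ) : ℝ :=
  let w := ((1 + S.W u r θ / r) * exp (2 * S.β u r θ))⁻¹
  √((1 + S.W u r θ / r) * (exp (2 * S.β u r θ))⁻¹) / 2 *
    (r ^ 2 * (extr S u r θ 0 0 - sliceA S u r θ * (w * extr S u r θ 0 0 -
      2 * S.U u r θ * w * extr S u r θ 0 1)) - sliceA S u r θ * angTrace S u r θ)

/-- `r (h_{rθ} - g_{rθ} tr h)` -/
noncomputable def angularMomentum (S : BondiData) (u r θ : ℝ) : ℝ :=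
  let w := ((1 + S.W u r θ / r) * exp (2 * S.β u r θ))⁻¹
  √((1 + S.W u r θ / r) * (exp (2 * S.β u r θ))⁻¹) / 2 *
    (r * (extr S u r θ 0 1 - sliceB S u r θ * (w * extr S u r θ 0 0 -
      2 * S.U u r θ * w * extr S u r θ 0 1)) - sliceB S u r θ / r * angTrace S u r θ)

/-- The Cartesian fields split into a radial part and a part along the sphere; the two parts pair
with the radial and the angular momentum density. -/
theorem momentumIntegrand_eq (hv : 0 < 1 + S.W (t - r) r θ / r) (k : Fin 3) :
    momentumIntegrand S t k ![r, θ, ψ] * r ^ 2 =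
      ![sin θ * cos ψ, sin θ * sin ψ, cos θ] k * radialMomentum S (t - r) r θ +
      ![cos θ * cos ψ, cos θ * sin ψ, -sin θ] k * angularMomentum S (t - r) r θ := by
  have hr0 : r ≠ 0 := (hS.nonneg.trans_lt hr).ne'
  have hG := (exp_pos (2 * S.γ (t - r) r θ)).ne'
  have hs : sin θ ≠ 0 := (sin_pos_of_pos_of_lt_pi hθ.1 hθ.2).ne'
  have eA : onSlice t (sliceA S) ![r, θ, ψ] = sliceA S (t - r) r θ := rfl
  have eB : onSlice t (sliceB S) ![r, θ, ψ] = sliceB S (t - r) r θ := rfl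
  have e02 : extr S (t - r) r θ 0 2 = 0 := rfl
  have e12 : extr S (t - r) r θ 1 2 = 0 := rfl
  have e20 : extr S (t - r) r θ 2 0 = 0 := rfl
  have e21 : extr S (t - r) r θ 2 1 = 0 := rfl
  have e10 : extr S (t - r) r θ 1 0 = extr S (t - r) r θ 0 1 := rfl
  simp only [momentumIntegrand, secondFundamentalForm_eq hS hr hθ hv, radialMomentum,
    angularMomentum, angTrace, inducedMetric_inv hS hr hθ hv, lapse_eq hS hr hθ]
  simp only [inducedMetric_eq, eA, eB, Fin.sum_univ_three, e02, e12, e20, e21, e10,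
    neg_mul, exp_neg]
  have e (L : ℝ) : 1 / (2 * L⁻¹) = L / 2 := by simp [div_eq_mul_inv, mul_comm]
  rw [e]
  generalize √((1 + S.W (t - r) r θ / r) * (exp (2 * S.β (t - r) r θ))⁻¹) = L at *
  generalize ((1 + S.W (t - r) r θ / r) * exp (2 * S.β (t - r) r θ))⁻¹ = w at *
  generalize exp (2 * S.γ (t - r) r θ) = G at *
  generalize S.U (t - r) r θ = U at *
  generalize sliceA S (t - r) r θ = A at *
  generalize sliceB S (t - r) r θ = B at *
  generalize extr S (t - r) r θ 0 0 = a at *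
  generalize extr S (t - r) r θ 0 1 = b at *
  generalize extr S (t - r) r θ 1 1 = d at *
  generalize extr S (t - r) r θ 2 2 = f at *
  fin_cases k <;> simp [cartesianField] <;> field_simp <;> ring

end

/-! ### The flat background metric -/

section

variable {r₀ t r θ ψ : ℝ} {S : BondiData}

theorem flatMetric_inv (hr : r ≠ 0) (hs : sin θ ≠ 0) : (flatMetric ![r, θ, ψ])⁻¹ =
    !![1, 0, 0; 0, (r ^ 2)⁻¹, 0; 0, 0, (r ^ 2 * sin θ ^ 2)⁻¹] := by
  have e : !![1, 0, 0; 0, (r ^ 2)⁻¹, 0; 0, 0, (r ^ 2 * sin θ ^ 2)⁻¹] =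
      Matrix.diagonal ![1, (r ^ 2)⁻¹, (r ^ 2 * sin θ ^ 2)⁻¹] := by
    ext i j; fin_cases i <;> fin_cases j <;> rfl
  rw [e]
  apply Matrix.inv_eq_left_inv
  rw [flatMetric, Matrix.diagonal_mul_diagonal, ← Matrix.diagonal_one]
  congr 1
  funext i
  fin_cases i
  · simp
  · simp [hr]
  · exact inv_mul_cancel₀ (mul_ne_zero (pow_ne_zero 2 hr) (pow_ne_zero 2 hs))

theorem pd_flatMetric (i j l : Fin 3) : pd i (fun y => flatMetric y j l) ![r, θ, ψ] =
    (![!![0, 0, 0; 0, 2 * r, 0; 0, 0, 2 * r * sin θ ^ 2],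
      !![0, 0, 0; 0, 0, 0; 0, 0, r ^ 2 * (2 * sin θ * cos θ)], 0] i :
      Matrix (Fin 3) (Fin 3) ℝ) j l := by
  have h0 (a : ℝ) : pd i (fun _ => a) ![r, θ, ψ] = 0 := by simp [pd]
  have h1 : pd i (fun y => y 0 ^ 2) ![r, θ, ψ] = ![2 * r, 0, 0] i := by
    fin_cases i <;> simp [pd]
  have h2 : pd i (fun y => y 0 ^ 2 * sin (y 1) ^ 2) ![r, θ, ψ] =
      ![2 * r * sin θ ^ 2, r ^ 2 * (2 * sin θ * cos θ), 0] i := by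
    fin_cases i <;> simp [pd]
  fin_cases j <;> fin_cases l
  · exact (h0 1).trans (by fin_cases i <;> rfl)
  · exact (h0 0).trans (by fin_cases i <;> rfl)
  · exact (h0 0).trans (by fin_cases i <;> rfl)
  · exact (h0 0).trans (by fin_cases i <;> rfl)
  · exact h1.trans (by fin_cases i <;> rfl)
  · exact (h0 0).trans (by fin_cases i <;> rfl)
  · exact (h0 0).trans (by fin_cases i <;> rfl)
  · exact (h0 0).trans (by fin_cases i <;> rfl)
  · exact h2.trans (by fin_cases i <;> rfl)

/-- The Christoffel symbols of the flat metric in polar coordinates. -/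
theorem christoffel_flatMetric (hr : r ≠ 0) (hs : sin θ ≠ 0) (k i j : Fin 3) :
    christoffel flatMetric k i j ![r, θ, ψ] =
      (![!![0, 0, 0; 0, -r, 0; 0, 0, -(r * sin θ ^ 2)],
        !![0, r⁻¹, 0; r⁻¹, 0, 0; 0, 0, -(sin θ * cos θ)],
        !![0, 0, r⁻¹; 0, 0, cos θ / sin θ; r⁻¹, cos θ / sin θ, 0]] k :
        Matrix (Fin 3) (Fin 3) ℝ) i j := by
  simp only [christoffel, flatMetric_inv hr hs, pd_flatMetric, Fin.sum_univ_three]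
  generalize sin θ = s at *
  generalize cos θ = c
  fin_cases k <;> fin_cases i <;> fin_cases j <;>
    simp only [Fin.zero_eta, Fin.mk_one, Fin.reduceFinMk, Fin.isValue, Matrix.of_apply,
        Matrix.cons_val', Matrix.cons_val_zero, Matrix.cons_val_one, Matrix.cons_val_fin_one,
        Matrix.cons_val, Matrix.zero_apply, zero_mul, mul_zero, add_zero, zero_add, sub_zero,
        sub_self] <;>
    (try field_simp) <;> (try ring)

/-- For the flat metric the terms `2 r g_{rr}` and `r (e^{2γ} + e^{-2γ})` cancel. -/
theorem energyIntegrand_eq (hS : S.Regular r₀) (hr : r₀ < r) (hθ : θ ∈ Ioo 0 π) :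
    energyIntegrand S t ![r, θ, ψ] * r ^ 2 =
      2 * r * sliceA S (t - r) r θ + par 2 (sliceB S) (t - r) r θ +
        cos θ / sin θ * sliceB S (t - r) r θ -
        r * (exp (2 * S.γ (t - r) r θ) + exp (-2 * S.γ (t - r) r θ)) -
        r ^ 2 * (2 * (par 1 S.γ (t - r) r θ - par 0 S.γ (t - r) r θ)) *
          (exp (2 * S.γ (t - r) r θ) - exp (-2 * S.γ (t - r) r θ)) := by
  have hr0 : r ≠ 0 := (hS.nonneg.trans_lt hr).ne'
  have hs : sin θ ≠ 0 := (sin_pos_of_pos_of_lt_pi hθ.1 hθ.2).ne'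
  have htr : pd 0 (fun z => ∑ j, ∑ k, (flatMetric z)⁻¹ j k * inducedMetric S t z j k)
      ![r, θ, ψ] = dSlice (sliceA S) (t - r) r θ 0 +
        2 * (par 1 S.γ (t - r) r θ - par 0 S.γ (t - r) r θ) *
          (exp (2 * S.γ (t - r) r θ) - exp (-2 * S.γ (t - r) r θ)) := by
    have h1 := (smth_sliceA hS).hasDerivAt_slice (t := t) hr hθ
    have h2 := (hS.γ.hasDerivAt_slice (t := t) hr hθ)
    have h3 := (h1.add (h2.const_mul 2).exp).add (h2.const_mul (-2)).exp
    have e : (fun z => ∑ j, ∑ k, (flatMetric (Function.update ![r, θ, ψ] 0 z))⁻¹ j k *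
        inducedMetric S t (Function.update ![r, θ, ψ] 0 z) j k) =ᶠ[𝓝 r]
        fun z => sliceA S (t - z) z θ + exp (2 * S.γ (t - z) z θ) +
          exp (-2 * S.γ (t - z) z θ) := by
      filter_upwards [eventually_ne_nhds hr0] with z hz
      have : Function.update ![r, θ, ψ] 0 z = ![z, θ, ψ] := by
        funext i; fin_cases i <;> simp
      simp only [this, flatMetric_inv hz hs, inducedMetric_eq, Fin.sum_univ_three]
      have eD : onSlice t (gθθ S) ![z, θ, ψ] = z ^ 2 * exp (2 * S.γ (t - z) z θ) := rfl
      have eE : onSlice t (gψψ S) ![z, θ, ψ] =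
        z ^ 2 * exp (-2 * S.γ (t - z) z θ) * sin θ ^ 2 := rfl
      rw [eD, eE]
      simp only [Fin.isValue, Matrix.of_apply,
        Matrix.cons_val', Matrix.cons_val_zero, Matrix.cons_val_one, Matrix.cons_val_fin_one,
        Matrix.cons_val, zero_mul, mul_zero, add_zero, zero_add]
      simp only [onSlice, Matrix.cons_val_zero, Matrix.cons_val_one]
      field_simp
    refine (e.deriv_eq.trans h3.deriv).trans ?_
    simp only [dSlice, Matrix.cons_val_zero]
    ring
  rw [energyIntegrand, htr]
  simp only [covDTensor, christoffel_flatMetric hr0 hs, flatMetric_inv hr0 hs,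
    pd_inducedMetric hS hr hθ, Fin.sum_univ_three]
  simp only [inducedMetric_eq]
  have eA : onSlice t (sliceA S) ![r, θ, ψ] = sliceA S (t - r) r θ := rfl
  have eB : onSlice t (sliceB S) ![r, θ, ψ] = sliceB S (t - r) r θ := rfl
  have eD : onSlice t (gθθ S) ![r, θ, ψ] = r ^ 2 * exp (2 * S.γ (t - r) r θ) := rfl
  have eE : onSlice t (gψψ S) ![r, θ, ψ] =
    r ^ 2 * exp (-2 * S.γ (t - r) r θ) * sin θ ^ 2 := rfl
  have dB : dSlice (sliceB S) (t - r) r θ 1 = par 2 (sliceB S) (t - r) r θ := rfl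
  rw [eA, eB, eD, eE, dB]
  simp only [Fin.isValue, Matrix.of_apply,
    Matrix.cons_val', Matrix.cons_val_zero, Matrix.cons_val_one, Matrix.cons_val_fin_one,
    Matrix.cons_val, zero_mul, mul_zero, add_zero, zero_add, sub_zero,
    sub_self, one_mul]
  field_simp
  ring

end

/-! ### Asymptotic equality on large spheres -/

section

/-- Two functions of `(r, θ)` are asymptotically equal: both are bounded for large `r`, and their
difference tends to zero for every `θ`. This suffices for comparing their integrals over large
spheres. -/
structure Near (F G : ℝ → ℝ → ℝ) : Prop where
  bdd : ∃ K, ∀ᶠ r in atTop, ∀ θ ∈ Ioo 0 π, |F r θ| ≤ K ∧ |G r θ| ≤ K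
  meas : ∀ᶠ r in atTop, AEMeasurable (F r) (volume.restrict (Ioo 0 π)) ∧
    AEMeasurable (G r) (volume.restrict (Ioo 0 π))
  lim : ∀ θ ∈ Ioo 0 π, Tendsto (fun r => F r θ - G r θ) atTop (𝓝 0)

/-- Convergence to a constant, uniformly in `θ`. -/
structure UnifTo (F : ℝ → ℝ → ℝ) (a : ℝ) : Prop where
  meas : ∀ᶠ r in atTop, AEMeasurable (F r) (volume.restrict (Ioo 0 π))
  lim : ∀ ε > 0, ∀ᶠ r in atTop, ∀ θ ∈ Ioo 0 π, |F r θ - a| < ε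

variable {F F' G G' : ℝ → ℝ → ℝ} {a : ℝ}

theorem UnifTo.near (h : UnifTo F a) : Near F fun _ _ => a where
  bdd := by
    refine ⟨|a| + 1, (h.lim 1 one_pos).mono fun r hr θ hθ => ⟨?_, by linarith⟩⟩
    have := abs_sub_abs_le_abs_sub (F r θ) a
    linarith [hr θ hθ]
  meas := h.meas.mono fun r hr => ⟨hr, aemeasurable_const⟩
  lim θ hθ := by
    rw [Metric.tendsto_nhds]
    intro ε hε
    filter_upwards [h.lim ε hε] with r hr
    simpa [Real.dist_eq] using hr θ hθ

theorem UnifTo.comp (h : UnifTo F a) {φ : ℝ → ℝ} (hφ : ContinuousAt φ a) (hm : Measurable φ) :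
    UnifTo (fun r θ => φ (F r θ)) (φ a) where
  meas := h.meas.mono fun r hr => hm.comp_aemeasurable hr
  lim ε hε := by
    obtain ⟨δ, hδ, hd⟩ := Metric.continuousAt_iff.1 hφ ε hε
    filter_upwards [h.lim δ hδ] with r hr θ hθ
    exact hd (hr θ hθ)

theorem near_const (a : ℝ) : Near (fun _ _ => a) fun _ _ => a :=
  ⟨⟨|a|, by simp⟩, by simp, by simp⟩

/-- A function of the angle is asymptotically equal to itself; boundedness is part of the claim. -/
theorem near_angle {φ : ℝ → ℝ} (hφ : Continuous φ) (hb : ∀ θ, |φ θ| ≤ 1) :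
    Near (fun _ θ => φ θ) fun _ θ => φ θ :=
  ⟨⟨1, Eventually.of_forall fun _ θ _ => ⟨hb θ, hb θ⟩⟩,
    Eventually.of_forall fun _ => ⟨hφ.aemeasurable, hφ.aemeasurable⟩, by simp⟩

theorem near_sin : Near (fun _ θ => sin θ) fun _ θ => sin θ :=
  near_angle continuous_sin abs_sin_le_one

theorem near_cos : Near (fun _ θ => cos θ) fun _ θ => cos θ :=
  near_angle continuous_cos abs_cos_le_one

theorem near_inv_r : Near (fun r _ => 1 / r) fun _ _ => 0 where
  bdd := by
    refine ⟨1, (eventually_ge_atTop 1).mono fun r hr θ _ => ⟨?_, by simp⟩⟩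
    rw [abs_of_nonneg (by positivity), div_le_one (by linarith)]
    exact hr
  meas := by simp
  lim θ _ := by
    have : Tendsto (fun r : ℝ => 1 / r) atTop (𝓝 0) := by
      simpa only [one_div] using tendsto_inv_atTop_zero
    simpa using this

theorem Near.add (h : Near F G) (h' : Near F' G') :
    Near (fun r θ => F r θ + F' r θ) fun r θ => G r θ + G' r θ where
  bdd := by
    obtain ⟨K, hK⟩ := h.bdd
    obtain ⟨K', hK'⟩ := h'.bdd
    refine ⟨K + K', ?_⟩
    filter_upwards [hK, hK'] with r h1 h2 θ hθ
    exact ⟨(abs_add_le _ _).trans (add_le_add (h1 θ hθ).1 (h2 θ hθ).1),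
      (abs_add_le _ _).trans (add_le_add (h1 θ hθ).2 (h2 θ hθ).2)⟩
  meas := by
    filter_upwards [h.meas, h'.meas] with r h1 h2
    exact ⟨h1.1.add h2.1, h1.2.add h2.2⟩
  lim θ hθ := by
    have := (h.lim θ hθ).add (h'.lim θ hθ)
    rw [add_zero] at this
    exact this.congr fun r => by ring

theorem Near.mul (h : Near F G) (h' : Near F' G') :
    Near (fun r θ => F r θ * F' r θ) fun r θ => G r θ * G' r θ where
  bdd := by
    obtain ⟨K, hK⟩ := h.bdd
    obtain ⟨K', hK'⟩ := h'.bdd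
    refine ⟨K * K', ?_⟩
    filter_upwards [hK, hK'] with r h1 h2 θ hθ
    rw [abs_mul, abs_mul]
    have hK0 : 0 ≤ K := (abs_nonneg _).trans (h1 θ hθ).1
    exact ⟨mul_le_mul (h1 θ hθ).1 (h2 θ hθ).1 (abs_nonneg _) hK0,
      mul_le_mul (h1 θ hθ).2 (h2 θ hθ).2 (abs_nonneg _) hK0⟩
  meas := by
    filter_upwards [h.meas, h'.meas] with r h1 h2
    exact ⟨h1.1.mul h2.1, h1.2.mul h2.2⟩
  lim θ hθ := by
    obtain ⟨K, hK⟩ := h.bdd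
    obtain ⟨K', hK'⟩ := h'.bdd
    have e1 : Tendsto (fun r => F r θ * (F' r θ - G' r θ)) atTop (𝓝 0) :=
      bdd_le_mul_tendsto_zero' K (hK.mono fun r hr => (hr θ hθ).1) (h'.lim θ hθ)
    have e2 : Tendsto (fun r => G' r θ * (F r θ - G r θ)) atTop (𝓝 0) :=
      bdd_le_mul_tendsto_zero' K' (hK'.mono fun r hr => (hr θ hθ).2) (h.lim θ hθ)
    have := e1.add e2
    rw [add_zero] at this
    exact this.congr fun r => by ring

theorem Near.const_mul (h : Near F G) (a : ℝ) :
    Near (fun r θ => a * F r θ) fun r θ => a * G r θ := (near_const a).mul h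

theorem Near.neg (h : Near F G) : Near (fun r θ => -F r θ) fun r θ => -G r θ := by
  simpa using h.const_mul (-1)

theorem Near.sub (h : Near F G) (h' : Near F' G') :
    Near (fun r θ => F r θ - F' r θ) fun r θ => G r θ - G' r θ := by
  simpa only [sub_eq_add_neg] using h.add h'.neg

theorem Near.congr (h : Near F G) (hF : ∀ᶠ r in atTop, ∀ θ ∈ Ioo 0 π, F r θ = F' r θ)
    (hG : ∀ r, ∀ θ ∈ Ioo 0 π, G r θ = G' r θ) : Near F' G' where
  bdd := by
    obtain ⟨K, hK⟩ := h.bdd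
    refine ⟨K, ?_⟩
    filter_upwards [hK, hF] with r h1 h2 θ hθ
    rw [← h2 θ hθ, ← hG r θ hθ]
    exact h1 θ hθ
  meas := by
    filter_upwards [h.meas, hF] with r h1 h2
    exact ⟨h1.1.congr ((ae_restrict_iff' measurableSet_Ioo).2 (Eventually.of_forall h2)),
      h1.2.congr ((ae_restrict_iff' measurableSet_Ioo).2 (Eventually.of_forall (hG r)))⟩
  lim θ hθ := (h.lim θ hθ).congr' <| by
    filter_upwards [hF] with r hr
    rw [hr θ hθ, hG r θ hθ]

theorem Near.integrableOn (h : Near F G) : ∀ᶠ r in atTop, IntegrableOn (F r) (Ioo 0 π) := by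
  obtain ⟨K, hK⟩ := h.bdd
  filter_upwards [hK, h.meas] with r h1 h2
  exact integrableOn_of_bounded h2.1.aestronglyMeasurable fun θ hθ => (h1 θ hθ).1

theorem Near.tendsto_integral (h : Near F G) {L : ℝ}
    (hL : Tendsto (fun r => ∫ θ in Ioo 0 π, G r θ) atTop (𝓝 L)) :
    Tendsto (fun r => ∫ θ in Ioo 0 π, F r θ) atTop (𝓝 L) := by
  have hG : ∀ᶠ r in atTop, IntegrableOn (G r) (Ioo 0 π) := by
    obtain ⟨K, hK⟩ := h.bdd
    filter_upwards [hK, h.meas] with r h1 h2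
    exact integrableOn_of_bounded h2.2.aestronglyMeasurable fun θ hθ => (h1 θ hθ).2
  have h0 : Tendsto (fun r => ∫ θ in Ioo 0 π, (F r θ - G r θ)) atTop (𝓝 0) := by
    obtain ⟨K, hK⟩ := h.bdd
    refine tendsto_integral_Ioo_zero (K := K + K) (h.meas.mono fun r hr =>
      (hr.1.sub hr.2).aestronglyMeasurable) ?_ h.lim
    filter_upwards [hK] with r hr θ hθ
    exact (abs_sub _ _).trans (add_le_add (hr θ hθ).1 (hr θ hθ).2)
  have := hL.add h0
  rw [add_zero] at this
  refine this.congr' ?_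
  filter_upwards [h.integrableOn, hG] with r h1 h2
  rw [integral_sub h1 h2]
  ring

variable {r₀ t : ℝ} {f : ℝ → ℝ → ℝ → ℝ} {p : ℕ}

theorem Smth.aemeasurable (hf : Smth r₀ f) (u : ℝ) {r : ℝ} (hr : r₀ < r) :
    AEMeasurable (f u r) (volume.restrict (Ioo 0 π)) :=
  ContinuousOn.aemeasurable (fun _ hθ =>
    (hf.hasDerivAt_θ hr hθ).continuousAt.continuousWithinAt) measurableSet_Ioo

/-- The jets of a metric function along the slice `u + r = t`. -/
theorem LeadingTerm.near {b : ℝ → ℝ → ℝ} (h : LeadingTerm f p b) (hf : Smth r₀ f)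
    (hb : Sc b) (t : ℝ) (i j l : ℕ) (hijl : i + j + l ≤ 2) :
    Near (fun r θ => r ^ (p + j) * jet i j l f (t - r) r θ)
      fun r θ => fallingFactor (-p) j * cjet i l b (t - r) θ := by
  have hbs : ∀ n, ∀ {b}, Sc b → Sc (d0^[n] b) := by
    intro n
    induction n with
    | zero => exact fun h => h
    | succ n ih => intro b h; rw [Function.iterate_succ_apply']; exact (ih h).d0
  have hbs' : ∀ n, ∀ {b}, Sc b → Sc (d2^[n] b) := by
    intro n
    induction n with
    | zero => exact fun h => h
    | succ n ih => intro b h; rw [Function.iterate_succ_apply']; exact (ih h).d2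
  obtain ⟨K, hK⟩ := h
  have hT : Tendsto (fun r : ℝ => (t - r, r)) atTop (atBot ×ˢ atTop) :=
    (tendsto_const_nhds.add_atBot tendsto_neg_atTop_atBot).prodMk tendsto_id
  have hK' := hT.eventually hK
  refine ⟨⟨|fallingFactor (-p) j| * |K| + |K|, ?_⟩, ?_, fun θ hθ => ?_⟩
  · filter_upwards [hK', eventually_ge_atTop 1] with r hr h1 θ hθ
    obtain ⟨e1, e2⟩ := hr θ hθ i j l hijl
    have e3 : K / r ≤ |K| := (le_abs_self _).trans (by
      rw [abs_div]; exact div_le_self (abs_nonneg _) (h1.trans (le_abs_self r)))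
    have e4 : |fallingFactor (-p) j * cjet i l b (t - r) θ| ≤ |fallingFactor (-p) j| * |K| := by
      rw [abs_mul]
      exact mul_le_mul_of_nonneg_left (e1.trans (le_abs_self K)) (abs_nonneg _)
    refine ⟨?_, by linarith [abs_nonneg K]⟩
    have := abs_sub_abs_le_abs_sub (r ^ (p + j) * jet i j l f (t - r) r θ)
      (fallingFactor (-p) j * cjet i l b (t - r) θ)
    linarith
  · filter_upwards [eventually_gt_atTop r₀] with r hr
    exact ⟨((hf.jet i j l).aemeasurable _ hr).const_mul _,
      ((hbs i (hbs' l hb)).aesm _).aemeasurable.const_mul _⟩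
  · have : Tendsto (fun r => K / r) atTop (𝓝 0) := tendsto_const_nhds.div_atTop tendsto_id
    refine squeeze_zero_norm' ?_ this
    filter_upwards [hK'] with r hr
    exact (hr θ hθ i j l hijl).2

theorem UnifTo.of_near_mul {H : ℝ → ℝ → ℝ} (h : Near (fun r θ => r * F r θ) H) :
    UnifTo F 0 where
  meas := by
    filter_upwards [h.meas, eventually_ne_atTop 0] with r hr h0
    have := hr.1.const_mul r⁻¹
    simpa only [inv_mul_cancel_left₀ h0] using this
  lim ε hε := by
    obtain ⟨K, hK⟩ := h.bdd
    filter_upwards [hK, eventually_gt_atTop 0, eventually_gt_atTop (K / ε)] with r h1 h2 h3 θ hθ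
    have := (h1 θ hθ).1
    rw [abs_mul, abs_of_pos h2] at this
    rw [div_lt_iff₀ hε] at h3
    rw [sub_zero]
    nlinarith

/-- First-order expansion of `exp`, for a function of order `1 / r`. -/
theorem Near.exp_sub_one {H : ℝ → ℝ → ℝ} (h : Near (fun r θ => r * F r θ) H) :
    Near (fun r θ => r * (exp (2 * F r θ) - 1)) fun r θ => 2 * H r θ := by
  have hF := UnifTo.of_near_mul h
  have h0 : UnifTo (fun r θ => r * (exp (2 * F r θ) - 1 - 2 * F r θ)) 0 := by
    refine ⟨hF.meas.mono fun r hr => by fun_prop, fun ε hε => ?_⟩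
    obtain ⟨K, hK⟩ := h.bdd
    filter_upwards [hK, hF.lim (1 / 2) (by norm_num), eventually_gt_atTop 0,
      eventually_gt_atTop (4 * (K * K) / ε)] with r h1 h2 h3 h4 θ hθ
    have e1 := (h1 θ hθ).1
    have e2 := h2 θ hθ
    rw [sub_zero] at e2 ⊢
    have e3 : |2 * F r θ| ≤ 1 := by rw [abs_mul, abs_two]; linarith
    have e4 := Real.abs_exp_sub_one_sub_id_le e3
    rw [div_lt_iff₀ hε] at h4
    rw [abs_mul, abs_of_pos h3]
    have e5 : (r * F r θ) ^ 2 ≤ K * K := by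
      rw [← sq_abs, sq]; exact mul_le_mul e1 e1 (abs_nonneg _) ((abs_nonneg _).trans e1)
    refine lt_of_mul_lt_mul_left ?_ h3.le
    calc r * (r * |exp (2 * F r θ) - 1 - 2 * F r θ|) ≤ r * (r * (2 * F r θ) ^ 2) := by gcongr
      _ = 4 * (r * F r θ) ^ 2 := by ring
      _ ≤ 4 * (K * K) := by linarith
      _ < r * ε := h4
  exact (h0.near.add (h.const_mul 2)).congr
    (Eventually.of_forall fun r θ _ => by ring) fun r θ _ => by ring

end

/-! ### The metric functions along a slice -/

section

/-- Replacement of the limit function by zero; the bound on `F` is kept. -/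
theorem Near.to_zero {F G : ℝ → ℝ → ℝ} (h : Near F G)
    (hG : ∀ θ ∈ Ioo 0 π, Tendsto (fun r => G r θ) atTop (𝓝 0)) : Near F fun _ _ => 0 where
  bdd := by
    obtain ⟨K, hK⟩ := h.bdd
    exact ⟨K, hK.mono fun r hr θ hθ => ⟨(hr θ hθ).1, by
      simpa using (abs_nonneg _).trans (hr θ hθ).1⟩⟩
  meas := h.meas.mono fun r hr => ⟨hr.1, aemeasurable_const⟩
  lim θ hθ := by
    have := (h.lim θ hθ).add (hG θ hθ)
    rw [add_zero] at this
    exact this.congr fun r => by ring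

/-- The first derivatives of the metric functions along the slice `u + r = t`, rescaled by powers
of `r`; the `u`-derivatives of the leading coefficients vanish in the limit. -/
structure SliceAsymptotics (S : BondiData) (U₂ m d2m d2U : ℝ → ℝ → ℝ) (t : ℝ) : Prop where
  β : Near (fun r θ => r * S.β (t - r) r θ) fun _ _ => 0
  β0 : Near (fun r θ => r * par 0 S.β (t - r) r θ) fun _ _ => 0
  β1 : Near (fun r θ => r * par 1 S.β (t - r) r θ) fun _ _ => 0
  β2 : Near (fun r θ => r * par 2 S.β (t - r) r θ) fun _ _ => 0
  γ : ∃ C, Near (fun r θ => r * S.γ (t - r) r θ) C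
  γ0 : Near (fun r θ => r * par 0 S.γ (t - r) r θ) fun _ _ => 0
  γ1 : Near (fun r θ => r * par 1 S.γ (t - r) r θ) fun _ _ => 0
  γ2 : Near (fun r θ => par 2 S.γ (t - r) r θ) fun _ _ => 0
  U : Near (fun r θ => r ^ 2 * S.U (t - r) r θ) U₂
  U0 : Near (fun r θ => r ^ 2 * par 0 S.U (t - r) r θ) fun _ _ => 0
  U1 : Near (fun r θ => r ^ 3 * par 1 S.U (t - r) r θ) fun r θ => -2 * U₂ r θ
  U2 : Near (fun r θ => r ^ 2 * par 2 S.U (t - r) r θ) d2U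
  W : Near (fun r θ => S.W (t - r) r θ) m
  W0 : Near (fun r θ => par 0 S.W (t - r) r θ) fun _ _ => 0
  W1 : Near (fun r θ => par 1 S.W (t - r) r θ) fun _ _ => 0
  W2 : Near (fun r θ => par 2 S.W (t - r) r θ) d2m

/-- Trading one power of `r` for decay. -/
theorem near_pow_mul_zero {F G : ℝ → ℝ → ℝ} (k : ℕ)
    (h : Near (fun r θ => r ^ (k + 1) * F r θ) G) : Near (fun r θ => r ^ k * F r θ) fun _ _ => 0 :=
  (near_inv_r.mul h).congr ((eventually_ne_atTop 0).mono fun r hr θ _ => by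
    rw [pow_succ]
    field_simp) fun r θ _ => by simp

theorem ScriData.sliceAsymptotics {S : BondiData} {r₀ : ℝ} (hS : S.Regular r₀)
    {c b U₂ m : ℝ → ℝ → ℝ} (h : S.Leading c b U₂ m) (hb : SmoothCoeff b) {K u₁ : ℝ}
    (D : ScriData c U₂ m K u₁) (t : ℝ) :
    SliceAsymptotics S (fun r θ => U₂ (t - r) θ) (fun r θ => m (t - r) θ)
      (fun r θ => d2 m (t - r) θ) (fun r θ => d2 U₂ (t - r) θ) t := by
  have hT : Tendsto (fun r : ℝ => t - r) atTop atBot :=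
    tendsto_const_nhds.add_atBot tendsto_neg_atTop_atBot
  have f0 (n : ℤ) : fallingFactor n 0 = 1 := by simp [fallingFactor]
  have f1 (n : ℤ) : fallingFactor n 1 = n := by simp [fallingFactor]
  have B := h.β.near hS.β hb.sc t
  have C := h.γ.near hS.γ D.smooth_c.sc t
  have V := h.U.near hS.U D.smooth_U.sc t
  have W := h.W.near hS.W D.smooth_m.sc t
  constructor
  · simpa [jet] using near_pow_mul_zero 1 (B 0 0 0 (by omega))
  · simpa [jet] using near_pow_mul_zero 1 (B 1 0 0 (by omega))
  · have := near_pow_mul_zero 2 (B 0 1 0 (by omega))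
    simpa [jet] using near_pow_mul_zero 1 this
  · simpa [jet] using near_pow_mul_zero 1 (B 0 0 1 (by omega))
  · exact ⟨_, by simpa [jet] using (C 0 0 0 (by omega))⟩
  · have := (C 1 0 0 (by omega)).to_zero fun θ hθ => by
      simp only [f0, one_mul]
      exact (D.tendsto_d0_c hθ).comp hT
    simpa [jet] using this
  · simpa [jet] using near_pow_mul_zero 1 (C 0 1 0 (by omega))
  · simpa [jet] using near_pow_mul_zero 0 (C 0 0 1 (by omega))
  · simpa [jet, f0, cjet] using (V 0 0 0 (by omega))
  · have := (V 1 0 0 (by omega)).to_zero fun θ hθ => by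
      simp only [f0, one_mul]
      exact (D.tendsto_d0_U hθ).comp hT
    simpa [jet] using this
  · simpa [jet, f1, cjet] using (V 0 1 0 (by omega))
  · simpa [jet, f0, cjet] using (V 0 0 1 (by omega))
  · simpa [jet, f0, cjet] using (W 0 0 0 (by omega))
  · have := (W 1 0 0 (by omega)).to_zero fun θ hθ => by
      simp only [f0, one_mul]
      exact (D.tendsto_d0_m hθ).comp hT
    simpa [jet] using this
  · simpa [jet] using near_pow_mul_zero 0 (W 0 1 0 (by omega))
  · simpa [jet, f0, cjet] using (W 0 0 1 (by omega))

end

/-! ### The metric on large spheres -/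

section

section SliceDerivatives

variable {S : BondiData} {r₀ u r θ : ℝ} (hS : S.Regular r₀) (hr : r₀ < r) (hθ : θ ∈ Ioo 0 π)

include hS hr hθ in
theorem par_sliceA (i : Fin 3) : par i (sliceA S) u r θ =
    par i (guu S) u r θ - 2 * par i (gur S) u r θ := by
  have e : sliceA S = fun u r θ => guu S u r θ - gur S u r θ - gur S u r θ := by
    funext u r θ; simp only [sliceA]; ring
  rw [e, par_sub ((smth_guu hS).sub (smth_gur hS)) (smth_gur hS) i hr hθ,
    par_sub (smth_guu hS) (smth_gur hS) i hr hθ]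
  ring

include hS hr hθ in
theorem par_sliceX (i : Fin 3) : par i (sliceX S) u r θ =
    par i (gur S) u r θ - par i (guu S) u r θ :=
  par_sub (smth_gur hS) (smth_guu hS) i hr hθ

theorem par_sliceB (i : Fin 3) : par i (sliceB S) u r θ = -par i (guθ S) u r θ := by
  fin_cases i <;> exact deriv.fun_neg

end SliceDerivatives

theorem BondiData.Regular.eventually_gt {S : BondiData} {r₀ : ℝ} (hS : S.Regular r₀) :
    ∀ᶠ r : ℝ in atTop, r₀ < r ∧ r ≠ 0 :=
  (eventually_gt_atTop r₀).mono fun _ hr => ⟨hr, (hS.nonneg.trans_lt hr).ne'⟩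

namespace SliceAsymptotics

variable {S : BondiData} {U₂ m d2m d2U : ℝ → ℝ → ℝ} {t r₀ : ℝ}
  (A : SliceAsymptotics S U₂ m d2m d2U t)

include A

theorem exp_β : Near (fun r θ => exp (2 * S.β (t - r) r θ)) fun _ _ => 1 := by
  simpa using ((UnifTo.of_near_mul A.β).comp (φ := fun x => exp (2 * x)) (by fun_prop)
    (by fun_prop)).near

theorem exp_γ : Near (fun r θ => exp (2 * S.γ (t - r) r θ)) fun _ _ => 1 := by
  obtain ⟨C, hC⟩ := A.γ
  simpa using ((UnifTo.of_near_mul hC).comp (φ := fun x => exp (2 * x)) (by fun_prop)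
    (by fun_prop)).near

theorem exp_neg_γ : Near (fun r θ => exp (-2 * S.γ (t - r) r θ)) fun _ _ => 1 := by
  obtain ⟨C, hC⟩ := A.γ
  simpa using ((UnifTo.of_near_mul hC).comp (φ := fun x => exp (-2 * x)) (by fun_prop)
    (by fun_prop)).near

theorem W_div : UnifTo (fun r θ => S.W (t - r) r θ / r) 0 :=
  UnifTo.of_near_mul (A.W.congr ((eventually_ne_atTop 0).mono fun r hr θ _ => by field_simp)
    fun _ _ _ => rfl)

theorem inv_v : Near (fun r θ => (1 + S.W (t - r) r θ / r)⁻¹) fun _ _ => 1 := by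
  simpa using (A.W_div.comp (φ := fun x => (1 + x)⁻¹)
    (ContinuousAt.inv₀ (by fun_prop) (by norm_num)) (by fun_prop)).near

theorem inv_vE : Near (fun r θ => ((1 + S.W (t - r) r θ / r) * exp (2 * S.β (t - r) r θ))⁻¹)
    fun _ _ => 1 := by
  have h : Near (fun r θ => exp (-(2 * S.β (t - r) r θ))) fun _ _ => 1 := by
    simpa using ((UnifTo.of_near_mul A.β).comp (φ := fun x => exp (-(2 * x))) (by fun_prop)
      (by fun_prop)).near
  simpa [mul_inv, exp_neg] using h.mul A.inv_v

/-- The inverse of the lapse tends to one. -/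
theorem sqrt_lapse : Near (fun r θ =>
    √((1 + S.W (t - r) r θ / r) * (exp (2 * S.β (t - r) r θ))⁻¹)) fun _ _ => 1 := by
  have h : Near (fun r θ => √(exp (2 * S.β (t - r) r θ))⁻¹) fun _ _ => 1 := by
    simpa using ((UnifTo.of_near_mul A.β).comp (φ := fun x => √(exp (2 * x))⁻¹)
      (ContinuousAt.sqrt (ContinuousAt.inv₀ (by fun_prop) (by positivity))) (by fun_prop)).near
  have h' : Near (fun r θ => √(1 + S.W (t - r) r θ / r)) fun _ _ => 1 := by
    simpa using (A.W_div.comp (φ := fun x => √(1 + x)) (by fun_prop) (by fun_prop)).near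
  refine (h'.mul h).congr (Eventually.of_forall fun r θ _ => ?_) fun r θ _ => one_mul 1
  rw [sqrt_mul' _ (by positivity)]

theorem near_sliceB : Near (fun r θ => sliceB S (t - r) r θ) U₂ :=
  (A.exp_γ.mul A.U).congr (Eventually.of_forall fun r θ _ => by
    simp only [sliceB, guθ]; ring) fun r θ _ => one_mul _

theorem near_sliceA : Near (fun r θ => sliceA S (t - r) r θ) fun _ _ => 1 :=
  (((near_const 1).add (near_inv_r.mul A.W)).mul A.exp_β |>.add
    ((near_inv_r.mul near_inv_r).mul (A.exp_γ.mul (A.U.mul A.U)))).congr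
    ((eventually_ne_atTop 0).mono fun r hr θ _ => by
      simp only [sliceA, guu, gur, BondiData.W]; field_simp; ring) fun r θ _ => by ring

/-- `g_{rr} = 1 + m / r + o(1 / r)` -/
theorem near_r_sliceA : Near (fun r θ => r * (sliceA S (t - r) r θ - 1)) m :=
  ((A.β.exp_sub_one.add (A.exp_β.mul A.W)).add
    (near_inv_r.mul (A.exp_γ.mul (A.U.mul A.U)))).congr
    ((eventually_ne_atTop 0).mono fun r hr θ _ => by
      simp only [sliceA, guu, gur, BondiData.W]; field_simp; ring) fun r θ _ => by ring

section

variable (hS : S.Regular r₀)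
include hS

theorem near_guu_u : Near (fun r θ => r * par 0 (guu S) (t - r) r θ) fun _ _ => 0 :=
  (((A.W0.add (((near_inv_r.mul A.W).sub (near_const 1)).mul (A.β0.const_mul 2))).mul A.exp_β).add
    (A.exp_γ.mul (((near_inv_r.mul near_inv_r).mul ((A.γ0.mul (A.U.mul A.U)).const_mul 2)).add
      (near_inv_r.mul ((A.U.mul A.U0).const_mul 2))))).congr
    (hS.eventually_gt.mono fun r hr θ hθ => by
      have hr0 := hr.2
      rw [par_guu_u hS hr.1 hθ]; field_simp) fun r θ _ => by ring

theorem near_guu_r : Near (fun r θ => r * par 1 (guu S) (t - r) r θ) fun _ _ => 0 :=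
  ((((A.W1.sub (near_inv_r.mul A.W)).add
    (((near_inv_r.mul A.W).sub (near_const 1)).mul (A.β1.const_mul 2))).mul A.exp_β).add
    (A.exp_γ.mul ((near_inv_r.mul near_inv_r).mul
      ((((A.U.mul A.U).const_mul 2).add ((A.γ1.mul (A.U.mul A.U)).const_mul 2)).add
      ((A.U.mul A.U1).const_mul 2))))).congr
    (hS.eventually_gt.mono fun r hr θ hθ => by
      have hr0 := hr.2
      rw [par_guu_r hS hr.1 hθ]; field_simp; ring) fun r θ _ => by ring

theorem near_guu_θ : Near (fun r θ => r * par 2 (guu S) (t - r) r θ) d2m :=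
  (((A.W2.add (((near_inv_r.mul A.W).sub (near_const 1)).mul (A.β2.const_mul 2))).mul A.exp_β).add
    (A.exp_γ.mul ((near_inv_r.mul ((A.γ2.mul (A.U.mul A.U)).const_mul 2)).add
      (near_inv_r.mul ((A.U.mul A.U2).const_mul 2))))).congr
    (hS.eventually_gt.mono fun r hr θ hθ => by
      have hr0 := hr.2
      rw [par_guu_θ hS hr.1 hθ]; field_simp) fun r θ _ => by ring

theorem near_gur (i : Fin 3) : Near (fun r θ => r * par i (gur S) (t - r) r θ) fun _ _ => 0 := by
  fin_cases i
  · exact ((A.β0.mul A.exp_β).const_mul (-2)).congr (hS.eventually_gt.mono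
      fun r hr θ hθ => by simp [par_gur_u hS hr.1 hθ]; ring) fun r θ _ => by ring
  · exact ((A.β1.mul A.exp_β).const_mul (-2)).congr (hS.eventually_gt.mono
      fun r hr θ hθ => by simp [par_gur_r hS hr.1 hθ]; ring) fun r θ _ => by ring
  · exact ((A.β2.mul A.exp_β).const_mul (-2)).congr (hS.eventually_gt.mono
      fun r hr θ hθ => by simp [par_gur_θ hS hr.1 hθ]; ring) fun r θ _ => by ring

theorem near_guu (i : Fin 3) : Near (fun r θ => r * par i (guu S) (t - r) r θ)
    (![fun _ _ => 0, fun _ _ => 0, d2m] i) := by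
  fin_cases i
  · exact A.near_guu_u hS
  · exact A.near_guu_r hS
  · exact A.near_guu_θ hS

theorem near_par_sliceA (i : Fin 3) : Near (fun r θ => r * par i (sliceA S) (t - r) r θ)
    (![fun _ _ => 0, fun _ _ => 0, d2m] i) :=
  ((A.near_guu hS i).sub ((A.near_gur hS i).const_mul 2)).congr
    (hS.eventually_gt.mono fun r hr θ hθ => by
      rw [par_sliceA hS hr.1 hθ]; ring) fun r θ _ => by ring

theorem near_par_sliceX (i : Fin 3) : Near (fun r θ => r * par i (sliceX S) (t - r) r θ)
    fun r θ => -(![fun _ _ => 0, fun _ _ => 0, d2m] i : ℝ → ℝ → ℝ) r θ :=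
  ((A.near_gur hS i).sub (A.near_guu hS i)).congr
    (hS.eventually_gt.mono fun r hr θ hθ => by
      rw [par_sliceX hS hr.1 hθ]; ring) fun r θ _ => by ring

theorem near_sliceB_u : Near (fun r θ => par 0 (sliceB S) (t - r) r θ) fun _ _ => 0 :=
  (A.exp_γ.mul ((near_inv_r.mul ((A.γ0.mul A.U).const_mul 2)).add A.U0)).congr
    (hS.eventually_gt.mono fun r hr θ hθ => by
      have hr0 := hr.2
      rw [par_sliceB, par_guθ_u hS hr.1 hθ]; field_simp) fun r θ _ => by ring

theorem near_sliceB_r : Near (fun r θ => r * par 1 (sliceB S) (t - r) r θ) fun _ _ => 0 :=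
  (A.exp_γ.mul (((A.U.const_mul 2).add ((A.γ1.mul A.U).const_mul 2)).add A.U1)).congr
    (hS.eventually_gt.mono fun r hr θ hθ => by
      rw [par_sliceB, par_guθ_r hS hr.1 hθ]; ring) fun r θ _ => by ring

theorem near_sliceB_θ : Near (fun r θ => par 2 (sliceB S) (t - r) r θ) d2U :=
  (A.exp_γ.mul (((A.γ2.mul A.U).const_mul 2).add A.U2)).congr
    (hS.eventually_gt.mono fun r hr θ hθ => by
      rw [par_sliceB, par_guθ_θ hS hr.1 hθ]; ring) fun r θ _ => by ring

theorem near_gθθ_u : Near (fun r θ => par 0 (gθθ S) (t - r) r θ / r) fun _ _ => 0 :=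
  ((A.γ0.mul A.exp_γ).const_mul 2).congr
    (hS.eventually_gt.mono fun r hr θ hθ => by
      have hr0 := hr.2
      rw [par_gθθ_u hS hr.1 hθ]; field_simp) fun r θ _ => by ring

theorem near_gθθ_r : Near (fun r θ => par 1 (gθθ S) (t - r) r θ / r) fun _ _ => 2 :=
  (((near_const 2).add (A.γ1.const_mul 2)).mul A.exp_γ).congr
    (hS.eventually_gt.mono fun r hr θ hθ => by
      have hr0 := hr.2
      rw [par_gθθ_r hS hr.1 hθ]; field_simp) fun r θ _ => by ring

theorem near_gθθ_θ : Near (fun r θ => par 2 (gθθ S) (t - r) r θ / r ^ 2) fun _ _ => 0 :=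
  ((A.γ2.mul A.exp_γ).const_mul 2).congr
    (hS.eventually_gt.mono fun r hr θ hθ => by
      have hr0 := hr.2
      rw [par_gθθ_θ hS hr.1 hθ]; field_simp) fun r θ _ => by ring

end

end SliceAsymptotics

end

/-! ### Asymptotics of the ADM integrands -/

section

namespace SliceAsymptotics

variable {S : BondiData} {U₂ m d2m d2U : ℝ → ℝ → ℝ} {t r₀ : ℝ}
  (A : SliceAsymptotics S U₂ m d2m d2U t) (hS : S.Regular r₀)

include A

theorem eventually_pos : ∀ᶠ r in atTop, ∀ θ ∈ Ioo 0 π, 0 < 1 + S.W (t - r) r θ / r := by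
  filter_upwards [A.W_div.lim 1 one_pos] with r hr θ hθ
  have := (abs_lt.1 (hr θ hθ)).1
  linarith

include hS

/-- `h_{rr}` decays faster than `1 / r`: its leading part consists of `u`-derivatives. -/
theorem near_extr_rr : Near (fun r θ => r * extr S (t - r) r θ 0 0) fun _ _ => 0 := by
  have X0 := A.near_par_sliceX hS 0
  have X1 := A.near_par_sliceX hS 1
  have A0 := A.near_par_sliceA hS 0
  have A1 := A.near_par_sliceA hS 1
  have A2 := A.near_par_sliceA hS 2
  have B0 := A.near_sliceB_u hS
  have B1 := A.near_sliceB_r hS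
  refine (((((X1.sub X0).const_mul 2).add ((near_inv_r.mul (A.W.mul A.inv_v)).mul (A1.sub A0))).add
    ((near_inv_r.mul (A.U.mul A.inv_v)).mul ((((near_inv_r.mul B1).sub B0).const_mul 2).sub
      (near_inv_r.mul A2)))).sub A0).congr ?_ fun r θ _ => ?_
  · filter_upwards [hS.eventually_gt, A.eventually_pos] with r hr hv θ hθ
    have hr0 := hr.2
    have hv' := (hv θ hθ).ne'
    have e : extr S (t - r) r θ 0 0 = 2 * (par 1 (sliceX S) (t - r) r θ -
        par 0 (sliceX S) (t - r) r θ) - -(S.W (t - r) r θ / (r * (1 + S.W (t - r) r θ / r))) *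
        (par 1 (sliceA S) (t - r) r θ - par 0 (sliceA S) (t - r) r θ) -
        -(S.U (t - r) r θ / (1 + S.W (t - r) r θ / r)) *
          (2 * (par 1 (sliceB S) (t - r) r θ - par 0 (sliceB S) (t - r) r θ) -
            par 2 (sliceA S) (t - r) r θ) - par 0 (sliceA S) (t - r) r θ := rfl
    rw [e]
    generalize 1 + S.W (t - r) r θ / r = v at *
    field_simp
    ring
  · simp

theorem near_extr_rθ : Near (fun r θ => r * extr S (t - r) r θ 0 1)
    fun r θ => 2 * U₂ r θ - d2m r θ := by
  have X2 := A.near_par_sliceX hS 2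
  have A2 := A.near_par_sliceA hS 2
  have B1 := A.near_sliceB_r hS
  have D0 := A.near_gθθ_u hS
  have D1 := A.near_gθθ_r hS
  refine (((X2.sub B1).add ((near_inv_r.mul (A.W.mul A.inv_v)).mul A2)).add
    ((A.U.mul A.inv_v).mul (D1.sub D0))).congr ?_ fun r θ _ => ?_
  · filter_upwards [hS.eventually_gt, A.eventually_pos] with r hr hv θ hθ
    have hr0 := hr.2
    have hv' := (hv θ hθ).ne'
    have e : extr S (t - r) r θ 0 1 = -(par 1 (sliceB S) (t - r) r θ -
        par 0 (sliceB S) (t - r) r θ) + par 2 (sliceX S) (t - r) r θ -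
        -(S.W (t - r) r θ / (r * (1 + S.W (t - r) r θ / r))) * par 2 (sliceA S) (t - r) r θ -
        -(S.U (t - r) r θ / (1 + S.W (t - r) r θ / r)) *
          (par 1 (gθθ S) (t - r) r θ - par 0 (gθθ S) (t - r) r θ) -
        par 0 (sliceB S) (t - r) r θ := rfl
    rw [e]
    generalize 1 + S.W (t - r) r θ / r = v at *
    field_simp
    ring
  · simp; ring

/-- The time derivatives of `g_{θθ}` and `g_{ψψ}`, which are of order `r`, cancel in the trace. -/
theorem near_angTrace : Near (fun r θ => sin θ * angTrace S (t - r) r θ)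
    fun r θ => -2 * (d2U r θ * sin θ + U₂ r θ * cos θ) - 4 * (m r θ * sin θ) := by
  have B2 := A.near_sliceB_θ hS
  have D0 := A.near_gθθ_u hS
  have D1 := A.near_gθθ_r hS
  have D2 := A.near_gθθ_θ hS
  have Wv := A.W.mul A.inv_v
  have Uv := A.U.mul A.inv_v
  have UUw := (A.U.mul A.U).mul A.inv_vE
  refine (((((((A.exp_neg_γ.add ((near_inv_r.mul near_inv_r).mul UUw)).mul
    ((((B2.const_mul (-2)).add ((near_inv_r.mul Wv).mul (B2.const_mul 2))).sub
      (Wv.mul (D1.sub D0))).add (Uv.mul D2))).sub ((near_inv_r.mul UUw).mul D0)).sub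
    (Wv.mul (((near_const 2).sub (A.γ1.const_mul 2)).add (A.γ0.const_mul 2)))).add
    (Uv.mul (A.γ2.const_mul 2))).mul near_sin).sub
    (Uv.mul (near_cos.const_mul 2))).congr ?_ fun r θ _ => ?_
  · filter_upwards [hS.eventually_gt, A.eventually_pos] with r hr hv θ hθ
    have hr0 := hr.2
    have hs := (sin_pos_of_pos_of_lt_pi hθ.1 hθ.2).ne'
    have hv' := (hv θ hθ).ne'
    have hG := (exp_pos (2 * S.γ (t - r) r θ)).ne'
    have hE := (exp_pos (2 * S.β (t - r) r θ)).ne'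
    have e1 : extr S (t - r) r θ 1 1 = -2 * par 2 (sliceB S) (t - r) r θ -
        -(S.W (t - r) r θ / (r * (1 + S.W (t - r) r θ / r))) * (2 * par 2 (sliceB S) (t - r) r θ -
          (par 1 (gθθ S) (t - r) r θ - par 0 (gθθ S) (t - r) r θ)) -
        -(S.U (t - r) r θ / (1 + S.W (t - r) r θ / r)) * par 2 (gθθ S) (t - r) r θ -
        par 0 (gθθ S) (t - r) r θ := rfl
    have e2 : extr S (t - r) r θ 2 2 =
        -(S.W (t - r) r θ / (r * (1 + S.W (t - r) r θ / r))) *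
          (par 1 (gψψ S) (t - r) r θ - par 0 (gψψ S) (t - r) r θ) +
        -(S.U (t - r) r θ / (1 + S.W (t - r) r θ / r)) * par 2 (gψψ S) (t - r) r θ -
        par 0 (gψψ S) (t - r) r θ := rfl
    simp only [angTrace, e1, e2, par_gψψ_u hS hr.1 hθ, par_gψψ_r hS hr.1 hθ, par_gψψ_θ hS hr.1 hθ,
      par_gθθ_u hS hr.1 hθ, neg_mul, exp_neg]
    generalize exp (2 * S.γ (t - r) r θ) = G at *
    generalize exp (2 * S.β (t - r) r θ) = E at *
    generalize 1 + S.W (t - r) r θ / r = v at *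
    field_simp
    ring
  · ring

/-- The coefficient of `h_{rr}` is `1 - g_{rr} g^{rr} = O(r⁻²)`, so that only the trace over the
sphere contributes in the limit. -/
theorem near_radialMomentum : Near (fun r θ => sin θ * radialMomentum S (t - r) r θ)
    fun r θ => d2U r θ * sin θ + U₂ r θ * cos θ + 2 * (m r θ * sin θ) := by
  have H0 := A.near_extr_rr hS
  have H1 := A.near_extr_rθ hS
  have HA := A.near_angTrace hS
  refine ((A.sqrt_lapse.const_mul (1 / 2)).mul ((((near_inv_r.mul ((A.U.mul A.inv_vE).mul
    ((A.near_sliceA.mul (H1.const_mul 2)).sub ((A.U.mul A.exp_γ).mul H0)))).mul near_sin).sub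
    (A.near_sliceA.mul HA)))).congr ?_ fun r θ _ => ?_
  · filter_upwards [hS.eventually_gt, A.eventually_pos] with r hr hv θ hθ
    have hr0 := hr.2
    have hv' := (hv θ hθ).ne'
    have hE := (exp_pos (2 * S.β (t - r) r θ)).ne'
    have e : sliceA S (t - r) r θ = (1 + S.W (t - r) r θ / r) * exp (2 * S.β (t - r) r θ) +
        r ^ 2 * exp (2 * S.γ (t - r) r θ) * S.U (t - r) r θ ^ 2 := by
      simp only [sliceA, guu, gur, BondiData.W]; field_simp; ring
    simp only [radialMomentum, e]
    generalize √((1 + S.W (t - r) r θ / r) * (exp (2 * S.β (t - r) r θ))⁻¹) = L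
    generalize exp (2 * S.β (t - r) r θ) = E at *
    generalize 1 + S.W (t - r) r θ / r = v at *
    field_simp
    ring
  · ring

/-- Since `g_{rθ}` is bounded, the trace terms are of lower order than `r h_{rθ}`. -/
theorem near_angularMomentum : Near (fun r θ => sin θ * angularMomentum S (t - r) r θ)
    fun r θ => U₂ r θ * sin θ - 1 / 2 * (d2m r θ * sin θ) := by
  have H0 := A.near_extr_rr hS
  have H1 := A.near_extr_rθ hS
  have HA := A.near_angTrace hS
  have B := A.near_sliceB
  refine ((A.sqrt_lapse.const_mul (1 / 2)).mul (((H1.sub (B.mul ((A.inv_vE.mul H0).sub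
    ((near_inv_r.mul near_inv_r).mul ((A.U.mul A.inv_vE).mul (H1.const_mul 2)))))).mul
    near_sin).sub ((near_inv_r.mul B).mul HA))).congr ?_ fun r θ _ => ?_
  · filter_upwards [hS.eventually_gt, A.eventually_pos] with r hr hv θ hθ
    have hr0 := hr.2
    have hv' := (hv θ hθ).ne'
    have hE := (exp_pos (2 * S.β (t - r) r θ)).ne'
    simp only [angularMomentum]
    generalize √((1 + S.W (t - r) r θ / r) * (exp (2 * S.β (t - r) r θ))⁻¹) = L
    generalize ((1 + S.W (t - r) r θ / r) * exp (2 * S.β (t - r) r θ))⁻¹ = w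
    field_simp
  · ring

theorem near_energyIntegrand (ψ : ℝ) :
    Near (fun r θ => energyIntegrand S t ![r, θ, ψ] * r ^ 2 * sin θ)
    fun r θ => 2 * (m r θ * sin θ) + (d2U r θ * sin θ + U₂ r θ * cos θ) := by
  obtain ⟨C, hC⟩ := A.γ
  have g := hC.exp_sub_one
  -- `e^{2γ} + e^{-2γ} = 2 + (e^{2γ} - 1)² e^{-2γ}` deviates from `2` only to second order in `γ`.
  refine (((((A.near_r_sliceA.const_mul 2).sub ((near_inv_r.mul (g.mul g)).mul A.exp_neg_γ)).add
    (A.near_sliceB_θ hS)).sub ((((A.γ1.sub A.γ0).const_mul 2).mul g).mul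
      ((A.exp_γ.add (near_const 1)).mul A.exp_neg_γ))).mul near_sin |>.add
    (near_cos.mul A.near_sliceB)).congr ?_ fun r θ _ => ?_
  · filter_upwards [hS.eventually_gt] with r hr θ hθ
    have hr0 := hr.2
    have hs := (sin_pos_of_pos_of_lt_pi hθ.1 hθ.2).ne'
    have hG := (exp_pos (2 * S.γ (t - r) r θ)).ne'
    rw [energyIntegrand_eq hS hr.1 hθ]
    simp only [neg_mul, exp_neg]
    generalize exp (2 * S.γ (t - r) r θ) = G at *
    field_simp
    ring
  · ring

end SliceAsymptotics

end

/-! ### Energy and momentum of the slices -/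

section

theorem integral_sphere_mul (f g : ℝ → ℝ) :
    ∫ p in Ioo 0 π ×ˢ Ioo 0 (2 * π), f p.1 * g p.2 =
      (∫ θ in Ioo 0 π, f θ) * ∫ ψ in Ioo 0 (2 * π), g ψ := by
  rw [Measure.volume_eq_prod]
  exact setIntegral_prod_mul f g _ _

theorem integral_Ioo_two_pi (g : ℝ → ℝ) :
    ∫ ψ in Ioo 0 (2 * π), g ψ = ∫ ψ in (0 : ℝ)..2 * π, g ψ := by
  rw [intervalIntegral.integral_of_le (by positivity), integral_Ioc_eq_integral_Ioo]

theorem integral_one_two_pi : ∫ _ψ in Ioo 0 (2 * π), (1 : ℝ) = 2 * π := by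
  rw [integral_Ioo_two_pi]; simp

theorem integral_cos_two_pi : ∫ ψ in Ioo 0 (2 * π), cos ψ = 0 := by
  rw [integral_Ioo_two_pi]; simp

theorem integral_sin_two_pi : ∫ ψ in Ioo 0 (2 * π), sin ψ = 0 := by
  rw [integral_Ioo_two_pi]; simp

/-- For an integrand which is a product of functions of `(r, θ)` and of `ψ` the sphere integral
factors. -/
theorem sphereIntegralTendsto_of_mul {F : (Fin 3 → ℝ) → ℝ} {f : ℝ → ℝ → ℝ} {g : ℝ → ℝ} {L : ℝ}
    (hF : ∀ᶠ r in atTop, ∀ θ ∈ Ioo 0 π, ∀ ψ, F ![r, θ, ψ] * (r ^ 2 * sin θ) = f r θ * g ψ)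
    (hf : ∀ᶠ r in atTop, IntegrableOn (f r) (Ioo 0 π)) (hg : Continuous g)
    (hL : Tendsto (fun r => (∫ θ in Ioo 0 π, f r θ) * ∫ ψ in Ioo 0 (2 * π), g ψ) atTop (𝓝 L)) :
    SphereIntegralTendsto F L := by
  have hm : MeasurableSet (Ioo 0 π ×ˢ Ioo 0 (2 * π)) := measurableSet_Ioo.prod measurableSet_Ioo
  refine ⟨?_, hL.congr' ?_⟩
  · filter_upwards [hF, hf] with r h1 h2
    have hg' : IntegrableOn g (Ioo 0 (2 * π)) :=
      (hg.integrableOn_Icc (a := 0) (b := 2 * π)).mono_set Ioo_subset_Icc_self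
    have h := Integrable.mul_prod h2 hg'
    rw [Measure.prod_restrict, ← Measure.volume_eq_prod] at h
    exact IntegrableOn.congr_fun h (fun p hp => (h1 p.1 hp.1 p.2).symm) hm
  · filter_upwards [hF] with r h1
    rw [← integral_sphere_mul]
    exact setIntegral_congr_fun hm fun p hp => (h1 p.1 hp.1 p.2).symm

/-- The Bondi energy-momentum as integrals over `θ`. -/
theorem bondiMomentum_eq (M : ℝ → ℝ → ℝ) (u : ℝ) : ∀ ν, bondiMomentum M ν u =
    ![1 / 4 * ∫ θ in Ioo 0 π, 2 * M u θ * sin θ, 0, 0,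
      1 / 4 * ∫ θ in Ioo 0 π, 2 * M u θ * (sin θ * cos θ)] ν := by
  have key : ∀ ν (f g : ℝ → ℝ), (∀ θ ψ, M u θ * nvec ν θ ψ * sin θ = f θ * g ψ) →
      bondiMomentum M ν u =
        1 / (4 * π) * ((∫ θ in Ioo 0 π, f θ) * ∫ ψ in Ioo 0 (2 * π), g ψ) := by
    intro ν f g h
    rw [bondiMomentum, ← integral_sphere_mul]
    simp only [h]
  have hπ := pi_ne_zero
  intro ν
  fin_cases ν
  · refine (key 0 (fun θ => M u θ * sin θ) (fun _ => 1) fun θ ψ => by simp [nvec]).trans ?_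
    rw [integral_one_two_pi]
    simp only [mul_assoc, integral_const_mul]
    simp
    field_simp
  · refine (key 1 (fun θ => M u θ * sin θ * sin θ) cos fun θ ψ => by simp [nvec]; ring).trans ?_
    rw [integral_cos_two_pi]
    simp
  · refine (key 2 (fun θ => M u θ * sin θ * sin θ) sin fun θ ψ => by simp [nvec]; ring).trans ?_
    rw [integral_sin_two_pi]
    simp
  · refine (key 3 (fun θ => M u θ * (sin θ * cos θ)) (fun _ => 1) fun θ ψ => by
      simp [nvec]; ring).trans ?_
    rw [integral_one_two_pi]
    simp only [mul_assoc, integral_const_mul]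
    simp
    field_simp

section

variable {S : BondiData} {c b U₂ m : ℝ → ℝ → ℝ} {K u₁ t r₀ : ℝ} {L : ℝ}

theorem tendsto_slice (t : ℝ) : Tendsto (fun r : ℝ => t - r) atTop atBot :=
  tendsto_const_nhds.add_atBot tendsto_neg_atTop_atBot

/-- The divergence of `U₂` integrates to zero, so that the limit is that of the integral of the mass
aspect. -/
theorem hasADMEnergy (hS : S.Regular r₀) (h : S.Leading c b U₂ m) (hb : SmoothCoeff b)
    (D : ScriData c U₂ m K u₁)
    (hL : Tendsto (fun u => ∫ θ in Ioo 0 π, m u θ * sin θ) atBot (𝓝 L)) :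
    HasADMEnergy S t (1 / 4 * L) := by
  have A := D.sliceAsymptotics hS h hb t
  have N := (A.near_energyIntegrand hS 0).const_mul (1 / (16 * π))
  refine sphereIntegralTendsto_of_mul (g := fun _ => 1) ?_ N.integrableOn continuous_const ?_
  · filter_upwards [hS.eventually_gt] with r hr θ hθ ψ
    rw [mul_one]
    have e := (energyIntegrand_eq (t := t) (ψ := ψ) hS hr.1 hθ).trans
      (energyIntegrand_eq (ψ := 0) hS hr.1 hθ).symm
    rw [← e]
    ring
  · have hI := N.tendsto_integral (L := 1 / (16 * π) * (2 * L)) <| by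
      refine (((hL.comp (tendsto_slice t)).const_mul 2).const_mul (1 / (16 * π))).congr' ?_
      filter_upwards [(tendsto_slice t).eventually (eventually_le_atBot u₁)] with r hr
      rw [integral_const_mul, D.integral_energy hr]
      rfl
    rw [integral_one_two_pi]
    convert hI.mul_const (2 * π) using 2
    have := pi_ne_zero
    field_simp
    ring

/-- The `θ`-dependence of the momentum integrands along the third axis. -/
theorem momentumIntegrand_axis (hS : S.Regular r₀) (h : S.Leading c b U₂ m)
    (hb : SmoothCoeff b) (D : ScriData c U₂ m K u₁) :
    Near (fun r θ => 1 / (8 * π) * (cos θ * (sin θ * radialMomentum S (t - r) r θ) -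
      sin θ * (sin θ * angularMomentum S (t - r) r θ))) fun r θ =>
      1 / (8 * π) * (cos θ * (d2 U₂ (t - r) θ * sin θ + U₂ (t - r) θ * cos θ +
        2 * (m (t - r) θ * sin θ)) -
        sin θ * (U₂ (t - r) θ * sin θ - 1 / 2 * (d2 m (t - r) θ * sin θ))) := by
  have A := D.sliceAsymptotics hS h hb t
  exact ((near_cos.mul (A.near_radialMomentum hS)).sub
    (near_sin.mul (A.near_angularMomentum hS))).const_mul _

theorem hasADMMomentum_two (hS : S.Regular r₀) (h : S.Leading c b U₂ m) (hb : SmoothCoeff b)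
    (D : ScriData c U₂ m K u₁)
    (hL : Tendsto (fun u => ∫ θ in Ioo 0 π, m u θ * (sin θ * cos θ)) atBot (𝓝 L)) :
    HasADMMomentum S t 2 (1 / 4 * L) := by
  have A := D.sliceAsymptotics hS h hb t
  have N := momentumIntegrand_axis (t := t) hS h hb D
  refine sphereIntegralTendsto_of_mul (g := fun _ => 1) ?_ N.integrableOn continuous_const ?_
  · filter_upwards [hS.eventually_gt, A.eventually_pos] with r hr hv θ hθ ψ
    have e := momentumIntegrand_eq (ψ := ψ) hS hr.1 hθ (hv θ hθ) 2
    simp only [Matrix.cons_val] at e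
    calc _ = 1 / (8 * π) * (momentumIntegrand S t 2 ![r, θ, ψ] * r ^ 2) * sin θ := by ring
      _ = _ := by rw [e]; ring
  · have hI := N.tendsto_integral (L := 1 / (8 * π) * L) <| by
      refine ((hL.comp (tendsto_slice t)).const_mul (1 / (8 * π))).congr' ?_
      filter_upwards [(tendsto_slice t).eventually (eventually_le_atBot u₁)] with r hr
      rw [integral_const_mul, D.integral_momentum hr]
      rfl
    rw [integral_one_two_pi]
    convert hI.mul_const (2 * π) using 2
    have := pi_ne_zero
    field_simp
    ring

/-- The momentum orthogonal to the axis vanishes by axial symmetry. -/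
theorem hasADMMomentum_zero {k : Fin 3} {g : ℝ → ℝ} (hS : S.Regular r₀)
    (h : S.Leading c b U₂ m) (hb : SmoothCoeff b) (D : ScriData c U₂ m K u₁) (hg : Continuous g)
    (hg0 : ∫ ψ in Ioo 0 (2 * π), g ψ = 0)
    (h1 : ∀ θ ψ, ![sin θ * cos ψ, sin θ * sin ψ, cos θ] k = sin θ * g ψ)
    (h2 : ∀ θ ψ, ![cos θ * cos ψ, cos θ * sin ψ, -sin θ] k = cos θ * g ψ) :
    HasADMMomentum S t k 0 := by
  have A := D.sliceAsymptotics hS h hb t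
  have N := ((near_sin.mul (A.near_radialMomentum hS)).add
    (near_cos.mul (A.near_angularMomentum hS))).const_mul (1 / (8 * π))
  refine sphereIntegralTendsto_of_mul (g := g) ?_ N.integrableOn hg (by simp [hg0])
  filter_upwards [hS.eventually_gt, A.eventually_pos] with r hr hv θ hθ ψ
  have e := momentumIntegrand_eq (ψ := ψ) hS hr.1 hθ (hv θ hθ) k
  rw [h1, h2] at e
  calc _ = 1 / (8 * π) * (momentumIntegrand S t k ![r, θ, ψ] * r ^ 2) * sin θ := by ring
    _ = _ := by rw [e]; ring

end

end

end AxiBondi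

theorem mainTheorem2 (S : AxiBondi.BondiData) (r₀ : ℝ) (hr₀ : 0 ≤ r₀)
    (hsmooth : S.Smooth r₀) (hvac : S.IsVacuum r₀)
    (c M : ℝ → ℝ → ℝ) (hrad : S.OutgoingRadiation c M)
    (hA : S.ConditionA) (hB : AxiBondi.ConditionB c) (hD : S.ConditionD) (t₀ : ℝ) :
    ∃ (m : Fin 4 → ℝ) (I J : ℝ),
      (∀ ν, Tendsto (AxiBondi.bondiMomentum M ν) atBot (𝓝 (m ν))) ∧
      Tendsto (fun u => ∫ θ in (0 : ℝ)..π, c u θ * AxiBondi.d0 c u θ * sin θ) atBot (𝓝 I) ∧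
      Tendsto (AxiBondi.momentumCorrection c 1) atBot (𝓝 J) ∧
      Tendsto (AxiBondi.momentumCorrection c (3 / 2)) atBot (𝓝 J) ∧
      AxiBondi.HasADMEnergy S t₀ (m 0 + I) ∧
      AxiBondi.HasADMMomentum S t₀ 0 (m 1) ∧
      AxiBondi.HasADMMomentum S t₀ 1 (m 2) ∧
      AxiBondi.HasADMMomentum S t₀ 2 (m 3 - 1 / 4 * J) := by
  obtain ⟨b, U₂, hc, hb, hU, hm, hlead⟩ := AxiBondi.exists_leading hr₀ hsmooth hrad hD
  have hS := hsmooth.regular hr₀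
  obtain ⟨K, u₁, D⟩ := hlead.scriData hS hvac hc hU hm
  obtain ⟨L₀, hL₀⟩ := D.exists_tendsto_integral_m_sin
  obtain ⟨L₃, hL₃⟩ := D.exists_tendsto_integral_m_sin_cos
  refine ⟨![1 / 4 * L₀, 0, 0, 1 / 4 * L₃], 0, 0, fun ν => ?_, D.tendsto_integral_c_d0_c,
    D.tendsto_momentumCorrection 1, D.tendsto_momentumCorrection (3 / 2), ?_, ?_, ?_, ?_⟩
  · simp only [funext fun u => AxiBondi.bondiMomentum_eq M u ν]
    fin_cases ν
    · exact hL₀.const_mul (1 / 4)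
    · exact tendsto_const_nhds
    · exact tendsto_const_nhds
    · exact hL₃.const_mul (1 / 4)
  · simpa using AxiBondi.hasADMEnergy hS hlead hb D hL₀
  · exact AxiBondi.hasADMMomentum_zero hS hlead hb D continuous_cos
      AxiBondi.integral_cos_two_pi (fun _ _ => rfl) fun _ _ => rfl
  · exact AxiBondi.hasADMMomentum_zero hS hlead hb D continuous_sin
      AxiBondi.integral_sin_two_pi (fun _ _ => rfl) fun _ _ => rfl
  · simpa using AxiBondi.hasADMMomentum_two hS hlead hb D hL₃
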